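/- **Setting.** Let $K$ be an ordered field in which every positive element is a square, let $\mathcal A$ be the exterior algebra of a $K$-vector space, and call an even element of $\mathcal A$ *positive* if its body (its image under the augmentation $\mathcal A\to K$) is positive; a positive element has a unique positive square root. Let $P$ be a polygon with a generic triangulation $T$ with fan centers $c_1,\dots,c_N$ ($N\ge 1$): there are vertices $a=c_0,c_1,\dots,c_N,c_{N+1}=b$ such that $c_0c_1$ and $c_Nc_{N+1}$ are boundary edges, the path $c_0c_1\cdots c_{N+1}$ turns alternately right and left, and the triangles of $T$ are, for $1\le i\le N$, the triangles joining $c_i$ to the boundary edges of $P$ on the way from $c_{i-1}$ to $c_{i+1}$ avoiding $c_i$ (the $i$-th fan segment). Thus $(a,b)$ is the longest arc. Let the edges of $T$ be oriented arbitrarily, let a positive even element $\lambda_{ij}$ (with $\sqrt{\lambda_{ij}}$ its positive root) be given for every edge of $T$, and an odd element $\boxed{ijk}$ for every triangle of $T$. *Flips.* In a quadrilateral $i,j,k,\ell$ (counterclockwise) with diagonal $i\to k$ put $a=\lambda_{i\ell},\ b=\lambda_{k\ell},\ c=\lambda_{jk},\ d=\lambda_{ij},\ e=\lambda_{ik},\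 \theta=\boxed{ik\ell},\ \sigma=\boxed{ijk}$. The flip replaces $(i,k)$ by $j\to\ell$, with $f=\lambda_{j\ell}$ given by $ef=ac+bd+\sqrt{abcd}\,\sigma\theta$, with $$\boxed{jk\ell}=\frac{\sigma\sqrt{bd}-\theta\sqrt{ac}}{\sqrt{ef}},\qquad \boxed{ij\ell}=\frac{\theta\sqrt{bd}+\sigma\sqrt{ac}}{\sqrt{ef}},$$ and reverses the orientation of $(k,\ell)$. For vertices $p\neq q$ of $P$, the super $\lambda$-length $\lambda_{pq}$ is the value obtained by any sequence of flips from $T$ to a triangulation containing $(p,q)$; $\lambda_{pp}=0$. Put $h^i_{jk}=\frac{\lambda_{jk}}{\lambda_{ij}\lambda_{ik}}$, $▲^i_{jk}=\sqrt{h^i_{jk}}\,\boxed{ijk}$, $▼^i_{jk}=\sqrt{1/h^i_{jk}}\,\boxed{ijk}$, with $▼^i_{jk}=0$ if two indices coincide. *Connection.* The graph $\Gamma_T$ has a hexagon inside each triangle of $T$, with two vertices near each corner, one next to each of the two sides there; vertices facing each other across a diagonal are joined. With $$E(x)=\begin{pmatrix}0&-x&0\\1/x&0&0\\0&0&1\end{pmatrix},\quad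 A^i_{jk}=\begin{pmatrix}1&0&0\\h^i_{jk}&1&-▲^i_{jk}\\▲^i_{jk}&0&1\end{pmatrix},\quad \rho=\begin{pmatrix}-1&0&0\\0&-1&0\\0&0&1\end{pmatrix},$$ inside a triangle $ijk$ the clockwise edge at the angle $i$ carries $A^i_{jk}$, the clockwise edge parallel to the side $ij$ carries $E(\lambda_{ij})$, and the opposite orientations carry the inverses; the edge crossing a diagonal $i\to j$ near $i$ carries the identity, the one near $j$ carries $\rho$. The holonomy of a path is the product of its matrices, later ones on the left. $H_{a,b}$ is the holonomy from the vertex of $\Gamma_T$ near $a$ next to the side $c_0c_1$ to the vertex near $b$ next to the side $c_Nc_{N+1}$. Put $\epsilon_a=0$ if $(c_0,c_1,c_2)$ is clockwise and $1$ otherwise; $\epsilon_b=0$ if $(c_{N-1},c_N,c_{N+1})$ is clockwise and $1$ otherwise. *Spin equivalence and signs of $\mu$-invariants.* Reversing around a triangle means reversing its three edges and negating its $\mu$-invariant. The default orientation has $c_1\to c_2\to\cdots\to c_N$ and all other diagonals oriented away from the fan centers. Given a set $R$ of triangles such that reversing around all of them makes all diagonals default, let $D$ be the result, and let $D'$ be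 obtained from $D$ by reversing further around all triangles of the fan segments with $(c_{i-1},c_i,c_{i+1})$ counterclockwise. The $\mu$-invariants below are those computed as follows, where one first flips (in any order) all the diagonals not joining consecutive fan centers: - $▼^{c_{N+1}}_{c_0,c_1}$: from $D$, then flipping $(c_{N-1},c_N),\dots,(c_2,c_3),(c_1,c_2)$; - $▼^{c_{N}}_{c_0,c_1}$: from $D$, then flipping $(c_{N-2},c_{N-1}),\dots,(c_2,c_3),(c_1,c_2)$; - $▼^{c_{1}}_{c_N,c_{N+1}}$: from $D'$, then flipping $(c_2,c_3),(c_3,c_4),\dots,(c_{N-1},c_N)$; - $▼^{c_{0}}_{c_N,c_{N+1}}$: from $D'$, then flipping $(c_1,c_2),(c_2,c_3),\dots,(c_{N-1},c_N)$. **Theorem 4.2.** Such a set $R$ exists. The vertices defining $H_{a,b}$ are joined by a path of $\Gamma_T$, all such paths have the same holonomy $H_{a,b}$, and for every such $R$ $$H_{a,b}=\rho^{r_b}\begin{pmatrix} -\frac{\lambda_{c_1,c_{N+1}}}{\lambda_{c_0,c_1}} & (-1)^{\epsilon_a}\lambda_{c_0,c_{N+1}} & ▼^{c_{N+1}}_{c_0,c_1}\\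 (-1)^{\epsilon_b}\frac{\lambda_{c_1,c_N}}{\lambda_{c_0,c_1}\lambda_{c_N,c_{N+1}}} & (-1)^{\epsilon_a+\epsilon_b-1}\frac{\lambda_{c_0,c_N}}{\lambda_{c_N,c_{N+1}}} & (-1)^{\epsilon_b-1}\frac{1}{\lambda_{c_N,c_{N+1}}}▼^{c_N}_{c_0,c_1}\\ \frac{1}{\lambda_{c_0,c_1}}▼^{c_1}_{c_N,c_{N+1}} & (-1)^{\epsilon_a-1}▼^{c_0}_{c_N,c_{N+1}} & 1+\star \end{pmatrix}\rho^{r_a},$$ where $r_a=1$ if the triangle with side $c_0c_1$ lies in $R$ and $0$ otherwise, $r_b=1$ if the triangle with side $c_Nc_{N+1}$ lies in $R$ and $0$ otherwise, and $$1+\star=1+(-1)^{\epsilon_a-1}\tfrac{1}{\lambda_{c_0,c_1}}▼^{c_1}_{c_N,c_{N+1}}▼^{c_0}_{c_N,c_{N+1}}=1+(-1)^{\epsilon_b-1}\tfrac{1}{\lambda_{c_N,c_{N+1}}}▼^{c_{N+1}}_{c_0,c_1}▼^{c_N}_{c_0,c_1}.$$ In particular, if all diagonals of $T$ have the default orientation,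 one may take $R=\emptyset$, and then $r_a=r_b=0$. -/

import Mathlib

/-! # Decorated super Teichmüller theory of a polygon

The vertices of an `n`-gon are the elements of `Fin n`, numbered counterclockwise, so that
`sbtw i j k` (Mathlib's strict cyclic order on `Fin n`) says that `i, j, k` are pairwise distinct
and occur in counterclockwise order.  Coefficients are taken in the exterior algebra of a vector
space `M` over an ordered field `K`. -/

noncomputable section

namespace SuperTeich

/-! ## The super-commutative algebra -/

section Algebra

variable {K M : Type*} [Field K] [AddCommGroup M] [Module K M]

/-- Even elements of the exterior algebra. -/
def IsEven (x : ExteriorAlgebra K M) : Prop :=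
  x ∈ CliffordAlgebra.evenOdd (0 : QuadraticForm K M) 0

/-- Odd elements of the exterior algebra. -/
def IsOdd (x : ExteriorAlgebra K M) : Prop :=
  x ∈ CliffordAlgebra.evenOdd (0 : QuadraticForm K M) 1

/-- Even elements whose body (the image under the augmentation `ExteriorAlgebra K M → K`)
is positive.  They are invertible. -/
def IsPosEven [LinearOrder K] (x : ExteriorAlgebra K M) : Prop :=
  IsEven x ∧ 0 < ExteriorAlgebra.algebraMapInv x

/-- The positive square root: the unique even `y` with positive body and `y * y = x`.  It exists
as soon as `x` is even and its body is the square of a nonzero element of `K`. -/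
def superSqrt [LinearOrder K] (x : ExteriorAlgebra K M) : ExteriorAlgebra K M :=
  Classical.epsilon fun y => IsPosEven y ∧ y * y = x

end Algebra

/-! ## The matrices `E`, `A`, `ρ` -/

section Matrices

variable {A : Type*} [Ring A]

/-- `E(x)`. -/
def matE (x : A) : Matrix (Fin 3) (Fin 3) A :=
  !![0, -x, 0; Ring.inverse x, 0, 0; 0, 0, 1]

/-- `E(x)⁻¹ = E(-x)`. -/
def matEInv (x : A) : Matrix (Fin 3) (Fin 3) A :=
  !![0, x, 0; -Ring.inverse x, 0, 0; 0, 0, 1]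

/-- `A(h|θ)`, as a function of `h` and of `s = √h θ`. -/
def matA (h s : A) : Matrix (Fin 3) (Fin 3) A :=
  !![1, 0, 0; h, 1, -s; s, 0, 1]

/-- `A(h|θ)⁻¹`, as a function of `h` and of `s = √h θ`. -/
def matAInv (h s : A) : Matrix (Fin 3) (Fin 3) A :=
  !![1, 0, 0; -h, 1, s; -s, 0, 1]

/-- The fermionic reflection. -/
def matRho : Matrix (Fin 3) (Fin 3) A :=
  !![-1, 0, 0; 0, -1, 0; 0, 0, 1]

theorem matE_mul_matEInv {x : A} (hx : IsUnit x) :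
    matE x * matEInv x = 1 ∧ matEInv x * matE x = 1 := by
  have h1 := Ring.mul_inverse_cancel x hx
  have h2 := Ring.inverse_mul_cancel x hx
  constructor <;> ext i j <;> fin_cases i <;> fin_cases j <;>
    simp [matE, matEInv, Matrix.mul_apply, Fin.sum_univ_three, h1, h2]

theorem matA_mul_matAInv (h : A) {s : A} (hs : s * s = 0) :
    matA h s * matAInv h s = 1 ∧ matAInv h s * matA h s = 1 := by
  constructor <;> ext i j <;> fin_cases i <;> fin_cases j <;>
    simp [matA, matAInv, Matrix.mul_apply, Fin.sum_univ_three, hs]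

end Matrices

/-! ## Decorated triangulations, flips, spin equivalence -/

section Decorated

variable {K M : Type*} [Field K] [LinearOrder K] [AddCommGroup M] [Module K M] {n : ℕ}

variable (K M n) in
/-- A triangulation of the `n`-gon, given by the vertex sets of its triangles, together with an
orientation of its edges (`orient i j` means `i → j`), the square roots `√λ_e` of the
`λ`-lengths of its edges and the `μ`-invariants of its triangles.  Only the values of
`orient`, `root` and `mu` at the edges and triangles of the triangulation are meaningful. -/
structure DecoratedTriangulation where
  tri : Set (Finset (Fin n))
  orient : Fin n → Fin n → Prop
  root : Sym2 (Fin n) → ExteriorAlgebra K M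
  mu : Finset (Fin n) → ExteriorAlgebra K M

namespace DecoratedTriangulation

variable (S : DecoratedTriangulation K M n)

/-- `(i, j)` is an edge (possibly a boundary edge) of the triangulation. -/
def IsEdge (i j : Fin n) : Prop := i ≠ j ∧ ∃ t ∈ S.tri, i ∈ t ∧ j ∈ t

/-- The data are those of a point of the decorated super Teichmüller space: every edge has exactly
one of its two orientations, the `√λ` are even with positive body, the `μ` are odd. -/
structure IsDecorated : Prop where
  orient_iff : ∀ i j, S.IsEdge i j → (S.orient i j ↔ ¬ S.orient j i)
  root_pos : ∀ i j, S.IsEdge i j → IsPosEven (S.root s(i, j))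
  mu_odd : ∀ t ∈ S.tri, IsOdd (S.mu t)

/-- The `λ`-length `λ_{ij}` of an edge, with the convention `λ_{ii} = 0`. -/
def lam (i j : Fin n) : ExteriorAlgebra K M :=
  if i = j then 0 else S.root s(i, j) * S.root s(i, j)

/-- The `h`-length `h^i_{jk} = λ_{jk} / (λ_{ij} λ_{ik})`. -/
def hLength (i j k : Fin n) : ExteriorAlgebra K M :=
  S.lam j k * Ring.inverse (S.lam i j * S.lam i k)

/-- The normalized `μ`-invariant `▲^i_{jk} = √(λ_{jk} / (λ_{ij} λ_{ik})) μ_{ijk}`. -/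
def muUp (i j k : Fin n) : ExteriorAlgebra K M :=
  S.root s(j, k) * Ring.inverse (S.root s(i, j) * S.root s(i, k)) * S.mu {i, j, k}

/-- The normalized `μ`-invariant `▼^i_{jk} = √(λ_{ij} λ_{ik} / λ_{jk}) μ_{ijk}`, with the
convention that it vanishes when two of the indices coincide. -/
def muDown (i j k : Fin n) : ExteriorAlgebra K M :=
  if i = j ∨ i = k ∨ j = k then 0
  else S.root s(i, j) * S.root s(i, k) * Ring.inverse (S.root s(j, k)) * S.mu {i, j, k}

/-- The super Ptolemy transformation in the quadrilateral with vertices `i, j, k, l` in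
counterclockwise order, whose diagonal `e = (i, k)`, oriented `i → k`, is replaced by
`f = (j, l)`, oriented `j → l`.  With `a = λ_{il}`, `b = λ_{kl}`, `c = λ_{jk}`, `d = λ_{ij}`,
`θ = μ_{ikl}`, `σ = μ_{ijk}`, the new values are given by
`e f = a c + b d + √(abcd) σ θ`,
`μ_{jkl} = (σ √(bd) - θ √(ac)) / √(ef)`, `μ_{ijl} = (θ √(bd) + σ √(ac)) / √(ef)`,
and the orientation of the side `(k, l)` is reversed. -/
def flip (i j k l : Fin n) : DecoratedTriangulation K M n :=
  let ra := S.root s(i, l)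
  let rb := S.root s(k, l)
  let rc := S.root s(j, k)
  let rd := S.root s(i, j)
  let re := S.root s(i, k)
  let θ := S.mu {i, k, l}
  let σ := S.mu {i, j, k}
  let rf := superSqrt ((S.lam i l * S.lam j k + S.lam k l * S.lam i j
      + ra * rb * rc * rd * σ * θ) * Ring.inverse (S.lam i k))
  { tri := (S.tri \ {{i, j, k}, {i, k, l}}) ∪ {{j, k, l}, {i, j, l}}
    orient := fun x y =>
      if x = j ∧ y = l then True
      else if x = l ∧ y = j then False
      else if (x = k ∧ y = l) ∨ (x = l ∧ y = k) then S.orient y x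
      else S.orient x y
    root := Function.update S.root s(j, l) rf
    mu := Function.update
      (Function.update S.mu {j, k, l} ((σ * (rb * rd) - θ * (ra * rc)) * Ring.inverse (re * rf)))
      {i, j, l} ((θ * (rb * rd) + σ * (ra * rc)) * Ring.inverse (re * rf)) }

/-- `S'` is obtained from `S` by flipping the interior diagonal `e`. -/
def IsFlip (e : Sym2 (Fin n)) (S' : DecoratedTriangulation K M n) : Prop :=
  ∃ i j k l, e = s(i, k) ∧ S.orient i k ∧ sbtw i j k ∧ sbtw i k l ∧
    {i, j, k} ∈ S.tri ∧ {i, k, l} ∈ S.tri ∧ S' = S.flip i j k l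

open Classical in
/-- The result of flipping the diagonal `e` (of changing nothing if `e` cannot be flipped). -/
def flipEdge (e : Sym2 (Fin n)) : DecoratedTriangulation K M n :=
  if h : ∃ S', S.IsFlip e S' then h.choose else S

/-- The result of flipping the diagonals in the list, from its head to its end. -/
def flips (L : List (Sym2 (Fin n))) : DecoratedTriangulation K M n :=
  L.foldl flipEdge S

/-- `x` is a value of the super `λ`-length of the arc `(p, q)`: it is the `λ`-length of `(p, q)`
in some decorated triangulation that contains this arc and that is obtained by a finite sequence
of super Ptolemy transformations.  By convention the `λ`-length is `0` if `p = q`. -/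
def IsSuperLambda (p q : Fin n) (x : ExteriorAlgebra K M) : Prop :=
  (p = q ∧ x = 0) ∨
    ∃ S', Relation.ReflTransGen (fun S₁ S₂ => ∃ e, IsFlip S₁ e S₂) S S' ∧
      S'.IsEdge p q ∧ x = S'.lam p q

/-- The super `λ`-length of an arbitrary arc of the polygon: its value computed by any sequence
of flips. -/
def superLambda (p q : Fin n) : ExteriorAlgebra K M :=
  Classical.epsilon (S.IsSuperLambda p q)

open Classical in
/-- The spin equivalence that, for each triangle `t ∈ R`, reverses the orientations of the three
edges of `t` and negates the `μ`-invariant of `t`. -/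
def reverse (R : Set (Finset (Fin n))) : DecoratedTriangulation K M n where
  tri := S.tri
  orient := fun x y =>
    if Odd {t | t ∈ R ∧ x ∈ t ∧ y ∈ t}.ncard then S.orient y x else S.orient x y
  root := S.root
  mu := fun t => if t ∈ R then -S.mu t else S.mu t

/-! ## The graph `Γ_T` and its flat connection -/

/-- The oriented edges of `Γ_T` and their matrices.  The vertex `(i, j, k)` of `Γ_T`, where
`{i, j, k}` is a triangle, is the vertex of the hexagon inside that triangle which is near `i` and
next to the side `(i, j)`. -/
inductive Step : Fin n × Fin n × Fin n → Fin n × Fin n × Fin n →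
    Matrix (Fin 3) (Fin 3) (ExteriorAlgebra K M) → Prop
  /-- The clockwise edge at the angle `i`. -/
  | angle (i j k : Fin n) : {i, j, k} ∈ S.tri → sbtw i j k →
      Step (i, j, k) (i, k, j) (matA (S.hLength i j k) (S.muUp i j k))
  /-- The counterclockwise edge at the angle `i`. -/
  | angleInv (i j k : Fin n) : {i, j, k} ∈ S.tri → sbtw i j k →
      Step (i, k, j) (i, j, k) (matAInv (S.hLength i j k) (S.muUp i j k))
  /-- The clockwise edge parallel to the side `(i, k)`. -/
  | side (i j k : Fin n) : {i, j, k} ∈ S.tri → sbtw i j k →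
      Step (i, k, j) (k, i, j) (matE (S.lam i k))
  /-- The counterclockwise edge parallel to the side `(i, k)`. -/
  | sideInv (i j k : Fin n) : {i, j, k} ∈ S.tri → sbtw i j k →
      Step (k, i, j) (i, k, j) (matEInv (S.lam i k))
  /-- The two edges that cross a diagonal near its tail. -/
  | crossTail (i j k l : Fin n) : {i, j, k} ∈ S.tri → {i, j, l} ∈ S.tri → k ≠ l → S.orient i j →
      Step (i, j, k) (i, j, l) 1
  /-- The two edges that cross a diagonal near its head. -/
  | crossHead (i j k l : Fin n) : {i, j, k} ∈ S.tri → {i, j, l} ∈ S.tri → k ≠ l → S.orient j i →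
      Step (i, j, k) (i, j, l) matRho

/-- `S.Holonomy u v H`: some path of `Γ_T` from `u` to `v` has holonomy `H`.  Later edges of a
path multiply from the left. -/
inductive Holonomy (u : Fin n × Fin n × Fin n) : Fin n × Fin n × Fin n →
    Matrix (Fin 3) (Fin 3) (ExteriorAlgebra K M) → Prop
  | refl : Holonomy u u 1
  | step {v w : Fin n × Fin n × Fin n} {H X : Matrix (Fin 3) (Fin 3) (ExteriorAlgebra K M)} :
      Holonomy u v H → S.Step v w X → Holonomy u w (X * H)

end DecoratedTriangulation

end Decorated

/-! ## Generic triangulations and fan centers -/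

section Generic

variable {n : ℕ}

/-- `v` is the next vertex of the polygon after `u` in counterclockwise order. -/
def IsNext (u v : Fin n) : Prop := u ≠ v ∧ ∀ w, ¬ sbtw u w v

/-- The arcs `(p, q)` and `(x, y)` cross in the interior of the polygon. -/
def Crosses (p q x y : Fin n) : Prop :=
  (sbtw p x q ∧ sbtw q y p) ∨ (sbtw q x p ∧ sbtw p y q)

/-- `c 0 = a, c 1, …, c N, c (N + 1) = b` can be the fan centers of a generic triangulation,
together with the end points of its longest arc: the path through them starts and
ends with a boundary edge of the polygon and turns alternately right and left. -/
structure IsFanCenters (c : ℕ → Fin n) (N : ℕ) : Prop where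
  one_le : 1 ≤ N
  first_side : IsNext (c 0) (c 1) ∨ IsNext (c 1) (c 0)
  last_side : IsNext (c N) (c (N + 1)) ∨ IsNext (c (N + 1)) (c N)
  turn : ∀ i, 1 ≤ i → i ≤ N →
    sbtw (c (i - 1)) (c i) (c (i + 1)) ∨ sbtw (c (i + 1)) (c i) (c (i - 1))
  alternate : ∀ i, 1 ≤ i → i < N →
    (sbtw (c (i - 1)) (c i) (c (i + 1)) ↔ sbtw (c (i + 2)) (c (i + 1)) (c i))

/-- The `i`-th fan segment: the triangles `{c_i, u, v}`, where `(u, v)` runs through the boundary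
edges of the polygon on the way from `c_{i-1}` to `c_{i+1}` that avoids `c_i`. -/
def fanSegment (c : ℕ → Fin n) (i : ℕ) : Set (Finset (Fin n)) :=
  {t | ∃ u v, IsNext u v ∧ t = {c i, u, v} ∧
    (u = c (i - 1) ∨ u = c (i + 1) ∨ Crosses (c (i - 1)) (c (i + 1)) (c i) u) ∧
    (v = c (i - 1) ∨ v = c (i + 1) ∨ Crosses (c (i - 1)) (c (i + 1)) (c i) v)}

/-- The generic triangulation with fan centers `c_1, …, c_N`: the union of its fan segments. -/
def genericTriangulation (c : ℕ → Fin n) (N : ℕ) : Set (Finset (Fin n)) :=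
  {t | ∃ i, 1 ≤ i ∧ i ≤ N ∧ t ∈ fanSegment c i}

/-- The interior diagonals of the generic triangulation that do not connect two consecutive fan
centers. -/
def innerDiagonals (c : ℕ → Fin n) (N : ℕ) : Set (Sym2 (Fin n)) :=
  {e | ∃ i v, 1 ≤ i ∧ i ≤ N ∧ Crosses (c (i - 1)) (c (i + 1)) (c i) v ∧ e = s(c i, v)}

/-- The default orientation of the interior diagonals: `c_1 → c_2 → ⋯ → c_N`, and all other
diagonals are oriented away from the fan centers. -/
def IsDefault (c : ℕ → Fin n) (N : ℕ) (orient : Fin n → Fin n → Prop) : Prop :=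
  (∀ i, 1 ≤ i → i < N → orient (c i) (c (i + 1))) ∧
    ∀ i v, 1 ≤ i → i ≤ N → Crosses (c (i - 1)) (c (i + 1)) (c i) v → orient (c i) v

/-- The triangles of the fan segments whose triple `(c_{i-1}, c_i, c_{i+1})` is counterclockwise.
Reversing around them replaces the default orientation by `c_1 ← c_2 ← ⋯ ← c_N`. -/
def ccwSegments (c : ℕ → Fin n) (N : ℕ) : Set (Finset (Fin n)) :=
  {t | ∃ i, 1 ≤ i ∧ i ≤ N ∧ sbtw (c (i - 1)) (c i) (c (i + 1)) ∧ t ∈ fanSegment c i}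

/-- The diagonals `(c_{m-1}, c_m), …, (c_2, c_3), (c_1, c_2)`, in this order. -/
def flipsUpFrom (c : ℕ → Fin n) (m : ℕ) : List (Sym2 (Fin n)) :=
  ((List.range' 1 (m - 1)).map fun i => s(c i, c (i + 1))).reverse

/-- The diagonals `(c_m, c_{m+1}), …, (c_{N-1}, c_N)`, in this order. -/
def flipsDownFrom (c : ℕ → Fin n) (m N : ℕ) : List (Sym2 (Fin n)) :=
  (List.range' m (N - m)).map fun i => s(c i, c (i + 1))

open Classical in
/-- `0` if `(x, y, z)` are oriented clockwise, `1` otherwise. -/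
def orientationType (x y z : Fin n) : ℕ := if sbtw z y x then 0 else 1

end Generic

end SuperTeich

end

set_option linter.unusedSectionVars false

/-! ## Even and odd elements -/

noncomputable section

namespace SuperTeich

section Parity

variable {K M : Type*} [Field K] [AddCommGroup M] [Module K M]

local notation "Λ" => ExteriorAlgebra K M

/-! The proof replaces holonomies by flat sections. A flat section `G` assigns to every vertex of
the graph a matrix of `OSp(1|2)` so that an edge from `u` to `v` with matrix `X` satisfies `G v = X
* G u`. Locally a section exists because the holonomy around a hexagon is trivial (`hexagon_angle`)
and because `ρ E(λ)` is the inverse of `E(λ)`, which settles the four-cycles at the diagonals.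
Globally it exists because the generic triangulation is assembled by gluing one triangle at a time
along one side (`IsLayout.isAssembled`, `IsAssembled.exists_section`). The holonomy from `u` to `v`
is then `G v * (G u)⁻¹` for every path.

The super Ptolemy relation says precisely that a section survives a flip: at each end of the old
diagonal two angle matrices multiply to a single new one, and at each end of the new diagonal one
old angle matrix splits into two (`IsQuad.angle_flip_tail` and its three companions). The old values
on the sides of the quadrilateral are kept, except for a factor `ρ` on the side whose orientation is
reversed (`IsFlippable.isDeveloped_flip`).

Row `0` of a section near a polygon vertex `i` is, up to sign, one vector `V i`: angle matrices fix
that row and `ρ` negates it. The `λ`-length of `(i, j)` is, up to sign, the invariant pairing of `V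
i` and `V j`, and positivity of the body fixes the sign. Hence super `λ`-lengths do not depend on
the flips (`IsRealized.superLambda_eq`).

To find the entries, one flips until a triangle `c₀ c₁ d` appears, with `d = c_{N+1}` or `d = c_N`.
In this triangle the row at `d` is an explicit combination of the rows at `(c₀, c₁)`, with
coefficients formed from two `λ`-lengths and a `▼` (`IsDeveloped.row_corner`). The default
orientation is chosen so that the flips introduce no sign at the corners concerned
(`exists_innerFlips`, `exists_centerFlips`). This gives rows `0` and `1` of the holonomy. The first
two entries of row `2` come from the same computation for the reversed sequence of centers, for
which `D'` has the default orientation, since the inverse of an orthosymplectic matrix is its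
`superAdj`. The corner entry is forced by the orthosymplectic relations and uniqueness of positive
square roots (`IsOSp.apply_two_two`). Finally, a spin equivalence multiplies the section by `ρ` on
the triangles of `R`, which accounts for the outer powers of `ρ`. -/

theorem ι_mul_swap (m₁ m₂ : M) :
    ExteriorAlgebra.ι K m₁ * ExteriorAlgebra.ι K m₂
      = -(ExteriorAlgebra.ι K m₂ * ExteriorAlgebra.ι K m₁) :=
  eq_neg_of_add_eq_zero_left (ExteriorAlgebra.ι_add_mul_swap m₁ m₂)

/-- Moving a vector past two vectors changes the sign twice. This is the source of the centrality of
all even elements. -/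
theorem ι_mul_ι_commute (m₁ m₂ : M) (y : Λ) :
    Commute (ExteriorAlgebra.ι K m₁ * ExteriorAlgebra.ι K m₂) y := by
  induction y using ExteriorAlgebra.induction with
  | algebraMap r => exact (Algebra.commutes r _).symm
  | ι m =>
    change _ * _ = _ * _
    rw [mul_assoc, ι_mul_swap m₂ m, mul_neg, ← mul_assoc, ι_mul_swap m₁ m, neg_mul, neg_neg,
      mul_assoc]
  | mul a b ha hb => exact ha.mul_right hb
  | add a b ha hb => exact ha.add_right hb

theorem IsEven.commute {x : Λ} (hx : IsEven x) (y : Λ) : Commute x y := by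
  induction x, hx using CliffordAlgebra.even_induction with
  | algebraMap r => exact Algebra.commutes r y
  | add a b _ _ ha hb => exact ha.add_left hb
  | ι_mul_ι_mul m₁ m₂ x _ h => exact (ι_mul_ι_commute m₁ m₂ y).mul_left h

theorem IsEven.add {x y : Λ} (hx : IsEven x) (hy : IsEven y) : IsEven (x + y) :=
  Submodule.add_mem _ hx hy

theorem IsEven.sub {x y : Λ} (hx : IsEven x) (hy : IsEven y) : IsEven (x - y) :=
  Submodule.sub_mem _ hx hy

theorem IsEven.neg {x : Λ} (hx : IsEven x) : IsEven (-x) :=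
  Submodule.neg_mem _ hx

theorem IsOdd.add {x y : Λ} (hx : IsOdd x) (hy : IsOdd y) : IsOdd (x + y) :=
  Submodule.add_mem _ hx hy

theorem IsOdd.sub {x y : Λ} (hx : IsOdd x) (hy : IsOdd y) : IsOdd (x - y) :=
  Submodule.sub_mem _ hx hy

theorem IsOdd.neg {x : Λ} (hx : IsOdd x) : IsOdd (-x) :=
  Submodule.neg_mem _ hx

theorem isEven_zero : IsEven (0 : Λ) := Submodule.zero_mem _

theorem isOdd_zero : IsOdd (0 : Λ) := Submodule.zero_mem _

theorem isEven_algebraMap (r : K) : IsEven (algebraMap K Λ r) :=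
  SetLike.algebraMap_mem_graded (CliffordAlgebra.evenOdd (0 : QuadraticForm K M)) r

theorem isEven_one : IsEven (1 : Λ) := by
  simpa using isEven_algebraMap (M := M) (1 : K)

theorem IsEven.mul {x y : Λ} (hx : IsEven x) (hy : IsEven y) : IsEven (x * y) := by
  have := SetLike.mul_mem_graded (A := CliffordAlgebra.evenOdd (0 : QuadraticForm K M)) hx hy
  rwa [add_zero] at this

theorem IsEven.mul_odd {x y : Λ} (hx : IsEven x) (hy : IsOdd y) : IsOdd (x * y) := by
  have := SetLike.mul_mem_graded (A := CliffordAlgebra.evenOdd (0 : QuadraticForm K M)) hx hy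
  rwa [zero_add] at this

theorem IsOdd.mul_even {x y : Λ} (hx : IsOdd x) (hy : IsEven y) : IsOdd (x * y) := by
  have := SetLike.mul_mem_graded (A := CliffordAlgebra.evenOdd (0 : QuadraticForm K M)) hx hy
  rwa [add_zero] at this

theorem IsOdd.mul {x y : Λ} (hx : IsOdd x) (hy : IsOdd y) : IsEven (x * y) := by
  have := SetLike.mul_mem_graded (A := CliffordAlgebra.evenOdd (0 : QuadraticForm K M)) hx hy
  rwa [show (1 + 1 : ZMod 2) = 0 from rfl] at this

theorem IsOdd.mul_comm {x y : Λ} (hx : IsOdd x) (hy : IsOdd y) : x * y = -(y * x) := by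
  induction x, hx using CliffordAlgebra.odd_induction with
  | ι m =>
    induction y, hy using CliffordAlgebra.odd_induction with
    | ι m' => exact ι_mul_swap m m'
    | add a b _ _ ha hb => rw [mul_add, ha, hb, add_mul, neg_add]
    | ι_mul_ι_mul m₁ m₂ a _ h =>
      have e := ι_mul_ι_commute (K := K) m₁ m₂ (ExteriorAlgebra.ι K m)
      change ExteriorAlgebra.ι K m * (ExteriorAlgebra.ι K m₁ * ExteriorAlgebra.ι K m₂ * a)
        = -(ExteriorAlgebra.ι K m₁ * ExteriorAlgebra.ι K m₂ * a * ExteriorAlgebra.ι K m)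
      change ExteriorAlgebra.ι K m * a = -(a * ExteriorAlgebra.ι K m) at h
      rw [← mul_assoc, ← e.eq, mul_assoc, h, mul_neg, mul_assoc _ a]
  | add a b _ _ ha hb => rw [add_mul, ha, hb, mul_add, neg_add]
  | ι_mul_ι_mul m₁ m₂ a _ h =>
    have e := ι_mul_ι_commute (K := K) m₁ m₂ y
    change ExteriorAlgebra.ι K m₁ * ExteriorAlgebra.ι K m₂ * a * y
      = -(y * (ExteriorAlgebra.ι K m₁ * ExteriorAlgebra.ι K m₂ * a))
    rw [mul_assoc, h, ← mul_assoc y, ← e.eq, mul_neg, mul_assoc _ y]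

theorem IsOdd.mul_self [CharZero K] {x : Λ} (hx : IsOdd x) : x * x = 0 := by
  have h := hx.mul_comm hx
  have h2 : (2 : K) • (x * x) = 0 := by rw [two_smul]; nth_rw 1 [h]; simp
  exact (smul_eq_zero.1 h2).resolve_left two_ne_zero

/-- The body of an element: its image under the augmentation. -/
abbrev body (x : Λ) : K := ExteriorAlgebra.algebraMapInv x

theorem body_add (x y : Λ) : body (x + y) = body x + body y := map_add _ x y

theorem body_mul (x y : Λ) : body (x * y) = body x * body y := map_mul _ x y

theorem body_algebraMap (r : K) : body (algebraMap K Λ r) = r :=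
  ExteriorAlgebra.algebraMap_leftInverse M r

theorem body_ι (m : M) : body (ExteriorAlgebra.ι K m) = 0 := by
  change ExteriorAlgebra.lift K _ _ = _
  rw [ExteriorAlgebra.lift_ι_apply]; rfl

theorem IsOdd.body_eq_zero {x : Λ} (hx : IsOdd x) : body x = 0 := by
  induction x, hx using CliffordAlgebra.odd_induction with
  | ι m =>
    exact body_ι m
  | add a b _ _ ha hb => exact (body_add a b).trans (by rw [ha, hb, add_zero])
  | ι_mul_ι_mul m₁ m₂ a _ h => exact (body_mul _ a).trans (by rw [h, mul_zero])

/-- `M` may be infinite-dimensional, so no degree bound is available. Instead nilpotency is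
propagated along the generation of the even part: central nilpotents add up, and a product of two
vectors squares to zero and commutes with everything. -/
theorem IsEven.isNilpotent_sub_body {x : Λ} (hx : IsEven x) :
    IsNilpotent (x - algebraMap K Λ (body x)) := by
  induction x, hx using CliffordAlgebra.even_induction with
  | algebraMap r =>
    have : body (algebraMap K Λ r) = r := body_algebraMap r
    have h2 : algebraMap K (CliffordAlgebra (0 : QuadraticForm K M)) r = algebraMap K Λ r := rfl
    rw [h2, this, sub_self]
    exact IsNilpotent.zero
  | add a b ha' hb' ha hb =>
    have : a + b - algebraMap K Λ (body (a + b))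
        = (a - algebraMap K Λ (body a)) + (b - algebraMap K Λ (body b)) := by
      simp only [body, map_add]; abel
    rw [this]
    exact Commute.isNilpotent_add
      (IsEven.commute (IsEven.sub ha' (isEven_algebraMap _)) _) ha hb
  | ι_mul_ι_mul m₁ m₂ a ha' h =>
    set w : Λ := ExteriorAlgebra.ι K m₁ * ExteriorAlgebra.ι K m₂ with hw
    have hb : body (w * a) = 0 := by
      rw [body_mul, hw, body_mul, body_ι, zero_mul, zero_mul]
    change IsNilpotent (w * a - algebraMap K Λ (body (w * a)))
    rw [hb, map_zero, sub_zero]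
    refine ⟨2, ?_⟩
    have hww : w * w = 0 := by
      rw [hw, mul_assoc, ← mul_assoc (ExteriorAlgebra.ι K m₂), ι_mul_swap m₂ m₁, neg_mul,
        mul_assoc, ExteriorAlgebra.ι_sq_zero, mul_zero, neg_zero, mul_zero]
    have hwa : a * w = w * a := (ι_mul_ι_commute m₁ m₂ a).eq.symm
    rw [pow_two, mul_assoc, ← mul_assoc a, hwa, mul_assoc w a a, ← mul_assoc, hww, zero_mul]

theorem IsEven.isUnit {x : Λ} (hx : IsEven x) (h : body x ≠ 0) : IsUnit x := by
  have h1 : IsUnit (algebraMap K Λ (body x)) := (IsUnit.mk0 _ h).map (algebraMap K Λ)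
  have h2 := IsNilpotent.isUnit_add_right_of_commute hx.isNilpotent_sub_body h1
    (IsEven.commute (hx.sub (isEven_algebraMap _)) _)
  simpa using h2

/-- If `y1` is the odd component of the inverse, `x * y1` is both odd and even, hence zero, and `x`
is a unit. For non-units `Ring.inverse` has the default value `0`, which is even. -/
theorem IsEven.ringInverse {x : Λ} (hx : IsEven x) : IsEven (Ring.inverse x) := by
  by_cases hu : IsUnit x
  · obtain ⟨y0, y1, hy0, hy1, hy⟩ : ∃ y0 y1 : Λ, IsEven y0 ∧ IsOdd y1 ∧ y0 + y1 = Ring.inverse x := by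
      have hc := (CliffordAlgebra.evenOdd_isCompl (0 : QuadraticForm K M)).codisjoint
      obtain ⟨a, b, ha, hb, hab⟩ := Submodule.codisjoint_iff_exists_add_eq.1 hc (Ring.inverse x)
      exact ⟨a, b, ha, hb, hab⟩
    have h1 : x * y0 + x * y1 = 1 := by rw [← mul_add, hy, Ring.mul_inverse_cancel _ hu]
    have hd := (CliffordAlgebra.evenOdd_isCompl (0 : QuadraticForm K M)).disjoint
    have h2 : x * y1 = 0 := by
      refine Submodule.disjoint_def.1 hd _ ?_ (hx.mul_odd hy1)
      have : x * y1 = 1 - x * y0 := by rw [← h1]; abel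
      rw [this]; exact isEven_one.sub (hx.mul hy0)
    have h3 : y1 = 0 := hu.mul_right_eq_zero.1 h2
    rw [← hy, h3, add_zero]; exact hy0
  · rw [Ring.inverse_non_unit _ hu]; exact isEven_zero

theorem exists_even_sqrt_one_add [CharZero K] (k : ℕ) :
    ∀ x : Λ, IsEven x → x ^ k = 0 → ∃ y : Λ, IsEven y ∧ body y = 1 ∧ y * y = 1 + x := by
  induction k using Nat.strong_induction_on with
  | _ k ih =>
    intro x hx hk
    rcases Nat.lt_or_ge k 2 with h2 | h2
    · have h0 : x = 0 := by
        rw [← pow_one x]; exact pow_eq_zero_of_le (by omega) hk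
      exact ⟨1, isEven_one, by simp [body], by simp [h0]⟩
    · have hnil : IsNilpotent x := ⟨k, hk⟩
      have hbx : body x = 0 := by
        have := hnil.map (ExteriorAlgebra.algebraMapInv (R := K) (M := M))
        exact this.eq_zero
      set c : Λ := algebraMap K Λ (1 / 2) with hc
      have hce : IsEven c := isEven_algebraMap _
      have hc2 : c + c = 1 := by rw [hc, ← map_add]; norm_num
      -- A Newton step: with `u = 1 + x/2` one has `1 + x = u² (1 + z)` for `z = -(x/(2u))²`. The
      -- nilpotency exponent of `z` is about half that of `x`, so the induction applies to `1 + z`.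
      set u : Λ := 1 + c * x with hu
      have hue : IsEven u := isEven_one.add (hce.mul hx)
      have hub : body u = 1 := by simp only [hu, body, map_add, map_mul, map_one] at hbx ⊢; simp [hbx]
      have huu : IsUnit u := hue.isUnit (by rw [hub]; exact one_ne_zero)
      set v := Ring.inverse u with hv
      have hve : IsEven v := hue.ringInverse
      have huv : u * v = 1 := Ring.mul_inverse_cancel _ huu
      set z : Λ := -((c * v) * (c * v) * (x * x)) with hz
      have hze : IsEven z := (((hce.mul hve).mul (hce.mul hve)).mul (hx.mul hx)).neg
      have hzk : z ^ ((k + 1) / 2) = 0 := by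
        rw [hz, neg_pow]
        rw [((((hce.mul hve).mul (hce.mul hve))).commute (x * x)).mul_pow, ← pow_two x, ← pow_mul,
          pow_eq_zero_of_le (by omega) hk, mul_zero, mul_zero]
      obtain ⟨w, hwe, hwb, hww⟩ := ih _ (by omega) z hze hzk
      refine ⟨u * w, hue.mul hwe, by
        simp only [body] at hub hwb ⊢
        rw [map_mul, hub, hwb, one_mul], ?_⟩
      have e1 : u * w * (u * w) = u * u * (w * w) := by
        rw [mul_assoc, ← mul_assoc w, ← (hue.commute w).eq, mul_assoc u w w, ← mul_assoc]
      have e2 : u * u * ((c * v) * (c * v) * (x * x)) = (c * x) * (c * x) := by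
        have a1 := (hve.commute c).eq
        have a2 := (hve.commute x).eq
        have : c * v * (c * v) * (x * x) = v * v * ((c * x) * (c * x)) := by
          have a3 := (hce.commute x).eq
          calc c * v * (c * v) * (x * x) = c * (v * c) * v * (x * x) := by simp only [mul_assoc]
            _ = (c * c) * (v * v) * (x * x) := by rw [a1]; simp only [mul_assoc]
            _ = (v * v) * ((c * c) * (x * x)) := by
              rw [((hve.mul hve).commute (c * c)).eq.symm, mul_assoc]
            _ = v * v * ((c * x) * (c * x)) := by
              rw [mul_assoc c c, ← mul_assoc c x x, a3, mul_assoc x c, ← mul_assoc c x]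
              rw [a3]
        rw [this, ← mul_assoc]
        have : u * u * (v * v) = 1 := by
          rw [mul_assoc, ← mul_assoc u v v, huv, one_mul, huv]
        rw [this, one_mul]
      rw [e1, hww, hz, ← sub_eq_add_neg, mul_sub, mul_one, e2, hu]
      have : c * x + c * x = x := by rw [← add_mul, hc2, one_mul]
      rw [mul_add, mul_one, add_mul, one_mul, ← add_assoc, add_sub_cancel_right, add_assoc, this]

theorem IsPosEven.isUnit [LinearOrder K] {x : Λ} (hx : IsPosEven x) : IsUnit x :=
  hx.1.isUnit hx.2.ne'

end Parity

/-! ### Positive even elements and their square roots. -/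

section Positive

variable {K M : Type*} [Field K] [LinearOrder K] [IsStrictOrderedRing K] [AddCommGroup M]
  [Module K M]

local notation "Λ" => ExteriorAlgebra K M

theorem IsPosEven.mul {x y : Λ} (hx : IsPosEven x) (hy : IsPosEven y) : IsPosEven (x * y) :=
  ⟨hx.1.mul hy.1, by rw [map_mul]; exact mul_pos hx.2 hy.2⟩

theorem IsPosEven.add {x y : Λ} (hx : IsPosEven x) (hy : IsPosEven y) : IsPosEven (x + y) :=
  ⟨hx.1.add hy.1, by rw [map_add]; exact add_pos hx.2 hy.2⟩

theorem IsPosEven.ringInverse {x : Λ} (hx : IsPosEven x) : IsPosEven (Ring.inverse x) := by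
  refine ⟨hx.1.ringInverse, ?_⟩
  have h := congrArg (ExteriorAlgebra.algebraMapInv (R := K) (M := M))
    (Ring.mul_inverse_cancel x hx.isUnit)
  rw [map_mul, map_one] at h
  exact pos_of_mul_pos_right (h ▸ one_pos) hx.2.le

/-- In `(x - y)(x + y) = 0` the second factor has positive body and is a unit. -/
theorem IsPosEven.eq_of_mul_self_eq {x y : Λ} (hx : IsPosEven x) (hy : IsPosEven y)
    (h : x * x = y * y) : x = y := by
  have h1 : (x - y) * (x + y) = 0 := by
    have := (hx.1.commute y).eq
    rw [sub_mul, mul_add, mul_add, h, this]; abel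
  exact sub_eq_zero.1 (((hx.add hy).isUnit).mul_left_eq_zero.1 h1)

theorem exists_isPosEven_sqrt (hK : ∀ x : K, 0 < x → IsSquare x) {x : Λ} (hx : IsPosEven x) :
    ∃ y, IsPosEven y ∧ y * y = x := by
  obtain ⟨b, hb⟩ := hK _ hx.2
  have hb0 : b ≠ 0 := by rintro rfl; rw [mul_zero] at hb; exact hx.2.ne' hb
  have hbb : body x = |b| * |b| := by rw [abs_mul_abs_self]; exact hb
  have hpos : 0 < |b| := abs_pos.2 hb0
  obtain ⟨k, hk⟩ := hx.1.isNilpotent_sub_body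
  set r := algebraMap K Λ (body x)⁻¹ with hr
  have hre : IsEven r := isEven_algebraMap _
  have hrb : r * algebraMap K Λ (body x) = 1 := by
    rw [hr, ← map_mul, inv_mul_cancel₀ hx.2.ne', map_one]
  -- Divided by its body, `x` becomes `1` plus a nilpotent; the root sought is `|b|` times a root of
  -- that. The absolute value makes its body positive.
  obtain ⟨y, hye, hyb, hyy⟩ := exists_even_sqrt_one_add k (r * (x - algebraMap K Λ (body x)))
    (hre.mul (hx.1.sub (isEven_algebraMap _)))
    (by rw [(hre.commute _).mul_pow, hk, mul_zero])
  refine ⟨algebraMap K Λ |b| * y, ⟨(isEven_algebraMap _).mul hye, ?_⟩, ?_⟩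
  · change 0 < body _
    rw [body_mul, hyb, mul_one, body_algebraMap]; exact hpos
  · have e : algebraMap K Λ |b| * y * (algebraMap K Λ |b| * y)
        = algebraMap K Λ (|b| * |b|) * (y * y) := by
      rw [map_mul, mul_assoc, ← mul_assoc y, ← ((isEven_algebraMap |b|).commute y).eq]
      simp only [mul_assoc]
    rw [e, ← hbb, hyy, mul_sub, hrb]
    rw [add_sub_cancel, ← mul_assoc, ((isEven_algebraMap (body x)).commute r).eq, hrb, one_mul]

theorem superSqrt_spec (hK : ∀ x : K, 0 < x → IsSquare x) {x : Λ} (hx : IsPosEven x) :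
    IsPosEven (superSqrt x) ∧ superSqrt x * superSqrt x = x :=
  Classical.epsilon_spec (exists_isPosEven_sqrt hK hx)

end Positive

end SuperTeich

end

/-! ## Matrix identities and orthosymplectic matrices -/

noncomputable section

set_option linter.unusedSimpArgs false

namespace SuperTeich

open Matrix

section MatrixIdentities

variable {A : Type*} [Ring A]

/-- Adjacent angles compose in a unipotent group: `s` is additive, while `h` acquires the correction
`s₂ * s₁`. This correction is the origin of the odd term in the Ptolemy relation. -/
theorem matA_mul (h₁ s₁ h₂ s₂ : A) :
    matA h₂ s₂ * matA h₁ s₁ = matA (h₁ + h₂ - s₂ * s₁) (s₁ + s₂) := by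
  ext i j
  fin_cases i <;> fin_cases j <;> simp [matA, Matrix.mul_apply, Fin.sum_univ_three] <;> abel

theorem matRho_mul_self : (matRho : Matrix (Fin 3) (Fin 3) A) * matRho = 1 := by
  ext i j
  fin_cases i <;> fin_cases j <;> simp [matRho, Matrix.mul_apply, Fin.sum_univ_three]

theorem matRho_mul_mul_self (H : Matrix (Fin 3) (Fin 3) A) : matRho * (matRho * H) = H := by
  rw [← mul_assoc, matRho_mul_self, one_mul]

theorem matRho_mul_matA (h s : A) : matRho * matA h s = matA h (-s) * matRho := by
  ext i j
  fin_cases i <;> fin_cases j <;> simp [matRho, matA, Matrix.mul_apply, Fin.sum_univ_three]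

theorem matRho_mul_matE (x : A) : matRho * matE x = matE x * matRho := by
  ext i j
  fin_cases i <;> fin_cases j <;> simp [matRho, matE, Matrix.mul_apply, Fin.sum_univ_three]

/-- The roots of the three `λ`-lengths and their inverses are scalars from a commutative ring `Z`,
so an identity over the noncommutative ring `A` is reduced to coefficients in `Z`. The product is
grouped into three factors `E * A`, each with a simple closed form; the only property of the odd
element needed is `μ * μ = 0`. -/
theorem hexagon {Z : Type*} [CommRing Z] [Algebra Z A] {p p' q q' r r' : Z}
    (hp : p * p' = 1) (hq : q * q' = 1) (hr : r * r' = 1) {μ : A} (hμ : μ * μ = 0)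
    {E₁ E₂ E₃ A₁ A₂ A₃ : Matrix (Fin 3) (Fin 3) A}
    (hE₁ : E₁ = !![0, -((r * r) • (1 : A)), 0; (r' * r') • 1, 0, 0; 0, 0, 1])
    (hE₂ : E₂ = !![0, -((q * q) • (1 : A)), 0; (q' * q') • 1, 0, 0; 0, 0, 1])
    (hE₃ : E₃ = !![0, -((p * p) • (1 : A)), 0; (p' * p') • 1, 0, 0; 0, 0, 1])
    (hA₁ : A₁ = matA ((q * q * (p' * p') * (r' * r')) • 1) ((q * (p' * r')) • μ))
    (hA₂ : A₂ = matA ((p * p * (r' * r') * (q' * q')) • 1) ((p * (r' * q')) • μ))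
    (hA₃ : A₃ = matA ((r * r * (q' * q') * (p' * p')) • 1) ((r * (q' * p')) • μ)) :
    E₃ * (A₃ * (E₂ * (A₂ * (E₁ * A₁)))) = 1 := by
  have e1 : E₁ * A₁ = !![-((q * q * (p' * p')) • (1 : A)), -((r * r) • 1), (r * q * p') • μ;
      (r' * r') • 1, 0, 0; (q * (p' * r')) • μ, 0, 1] := by
    rw [hE₁, hA₁]
    ext i j
    fin_cases i <;> fin_cases j <;>
      simp [matA, Matrix.mul_apply, Fin.sum_univ_three, smul_smul] <;> (congr 1; grind)
  have e2 : E₂ * A₂ = !![-((p * p * (r' * r')) • (1 : A)), -((q * q) • 1), (q * p * r') • μ;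
      (q' * q') • 1, 0, 0; (p * (r' * q')) • μ, 0, 1] := by
    rw [hE₂, hA₂]
    ext i j
    fin_cases i <;> fin_cases j <;>
      simp [matA, Matrix.mul_apply, Fin.sum_univ_three, smul_smul] <;> (congr 1; grind)
  have e3 : E₃ * A₃ = !![-((r * r * (q' * q')) • (1 : A)), -((p * p) • 1), (p * r * q') • μ;
      (p' * p') • 1, 0, 0; (r * (q' * p')) • μ, 0, 1] := by
    rw [hE₃, hA₃]
    ext i j
    fin_cases i <;> fin_cases j <;>
      simp [matA, Matrix.mul_apply, Fin.sum_univ_three, smul_smul] <;> (congr 1; grind)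
  rw [← mul_assoc A₂, ← mul_assoc]
  rw [show E₃ * A₃ * (E₂ * (A₂ * E₁ * A₁)) = (E₃ * A₃) * ((E₂ * A₂) * (E₁ * A₁)) by
    simp only [mul_assoc], e1, e2, e3]
  ext i j
  fin_cases i <;> fin_cases j <;>
    simp [Matrix.mul_apply, Fin.sum_univ_three, smul_smul, hμ, mul_add, add_mul] <;>
    (match_scalars <;> grind)

/-- The super-transpose conjugated by the symplectic form: the inverse of an element of
`OSp(1|2)`. -/
def superAdj (H : Matrix (Fin 3) (Fin 3) A) : Matrix (Fin 3) (Fin 3) A :=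
  !![H 1 1, -H 0 1, -H 2 1; -H 1 0, H 0 0, H 2 0; H 1 2, -H 0 2, H 2 2]

end MatrixIdentities

/-! ### The supergroup `OSp(1|2)`. -/

section OSp

variable {K M : Type*} [Field K] [LinearOrder K] [IsStrictOrderedRing K] [AddCommGroup M]
  [Module K M]

local notation "Λ" => ExteriorAlgebra K M

/-- Even elements are even, odd elements are odd. -/
structure IsSuper (H : Matrix (Fin 3) (Fin 3) Λ) : Prop where
  e00 : IsEven (H 0 0)
  e01 : IsEven (H 0 1)
  e10 : IsEven (H 1 0)
  e11 : IsEven (H 1 1)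
  e22 : IsEven (H 2 2)
  o02 : IsOdd (H 0 2)
  o12 : IsOdd (H 1 2)
  o20 : IsOdd (H 2 0)
  o21 : IsOdd (H 2 1)

/-- Reversing the order of the factors costs a sign exactly for products of two odd entries; the
signs in `superAdj` absorb it. -/
theorem superAdj_mul {X Y : Matrix (Fin 3) (Fin 3) Λ} (hX : IsSuper X) (hY : IsSuper Y) :
    superAdj (X * Y) = superAdj Y * superAdj X := by
  have c00 := fun i j => (hY.e00.commute (X i j)).eq
  have c01 := fun i j => (hY.e01.commute (X i j)).eq
  have c10 := fun i j => (hY.e10.commute (X i j)).eq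
  have c11 := fun i j => (hY.e11.commute (X i j)).eq
  have c22 := fun i j => (hY.e22.commute (X i j)).eq
  have d00 := fun i j => (hX.e00.commute (Y i j)).eq.symm
  have d01 := fun i j => (hX.e01.commute (Y i j)).eq.symm
  have d10 := fun i j => (hX.e10.commute (Y i j)).eq.symm
  have d11 := fun i j => (hX.e11.commute (Y i j)).eq.symm
  have d22 := fun i j => (hX.e22.commute (Y i j)).eq.symm
  ext i j
  fin_cases i <;> fin_cases j <;>
    simp [superAdj, Matrix.mul_apply, Fin.sum_univ_three, c00, c01, c10, c11, c22,
      d00, d01, d10, d11, d22, hY.o02.mul_comm hX.o20, hY.o02.mul_comm hX.o21,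
      hY.o12.mul_comm hX.o20, hY.o12.mul_comm hX.o21, hY.o20.mul_comm hX.o02,
      hY.o20.mul_comm hX.o12, hY.o21.mul_comm hX.o02, hY.o21.mul_comm hX.o12] <;> abel

theorem IsSuper.mul {X Y : Matrix (Fin 3) (Fin 3) Λ} (hX : IsSuper X) (hY : IsSuper Y) :
    IsSuper (X * Y) := by
  constructor <;> simp only [Matrix.mul_apply, Fin.sum_univ_three]
  · exact ((hX.e00.mul hY.e00).add (hX.e01.mul hY.e10)).add (hX.o02.mul hY.o20)
  · exact ((hX.e00.mul hY.e01).add (hX.e01.mul hY.e11)).add (hX.o02.mul hY.o21)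
  · exact ((hX.e10.mul hY.e00).add (hX.e11.mul hY.e10)).add (hX.o12.mul hY.o20)
  · exact ((hX.e10.mul hY.e01).add (hX.e11.mul hY.e11)).add (hX.o12.mul hY.o21)
  · exact ((hX.o20.mul hY.o02).add (hX.o21.mul hY.o12)).add (hX.e22.mul hY.e22)
  · exact ((hX.e00.mul_odd hY.o02).add (hX.e01.mul_odd hY.o12)).add (hX.o02.mul_even hY.e22)
  · exact ((hX.e10.mul_odd hY.o02).add (hX.e11.mul_odd hY.o12)).add (hX.o12.mul_even hY.e22)
  · exact ((hX.o20.mul_even hY.e00).add (hX.o21.mul_even hY.e10)).add (hX.e22.mul_odd hY.o20)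
  · exact ((hX.o20.mul_even hY.e01).add (hX.o21.mul_even hY.e11)).add (hX.e22.mul_odd hY.o21)

/-- The supergroup `OSp(1|2)`. -/
structure IsOSp (H : Matrix (Fin 3) (Fin 3) Λ) : Prop extends IsSuper H where
  mul_adj : H * superAdj H = 1
  adj_mul : superAdj H * H = 1
  -- The two preceding relations determine the body of this entry only up to sign. Fixing it makes
  -- the entry the positive square root in `IsOSp.apply_two_two`.
  body_eq : body (H 2 2) = 1

theorem IsOSp.mul {X Y : Matrix (Fin 3) (Fin 3) Λ} (hX : IsOSp X) (hY : IsOSp Y) :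
    IsOSp (X * Y) where
  toIsSuper := hX.toIsSuper.mul hY.toIsSuper
  mul_adj := by
    rw [superAdj_mul hX.toIsSuper hY.toIsSuper, mul_assoc, ← mul_assoc Y, hY.mul_adj, one_mul,
      hX.mul_adj]
  adj_mul := by
    rw [superAdj_mul hX.toIsSuper hY.toIsSuper, mul_assoc, ← mul_assoc _ X, hX.adj_mul, one_mul,
      hY.adj_mul]
  body_eq := by
    simp only [Matrix.mul_apply, Fin.sum_univ_three, body_add, body_mul, hX.body_eq, hY.body_eq,
      hX.o20.body_eq_zero, hX.o21.body_eq_zero]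
    simp

theorem isOSp_one : IsOSp (1 : Matrix (Fin 3) (Fin 3) Λ) := by
  have h3 : superAdj (1 : Matrix (Fin 3) (Fin 3) Λ) = 1 := by
    ext i j
    fin_cases i <;> fin_cases j <;> simp [superAdj]
  refine ⟨⟨?_, ?_, ?_, ?_, ?_, ?_, ?_, ?_, ?_⟩, by rw [h3, mul_one], by rw [h3, mul_one], ?_⟩ <;>
    simp [isEven_one, isEven_zero, isOdd_zero, body]

theorem isOSp_matRho : IsOSp (matRho : Matrix (Fin 3) (Fin 3) Λ) := by
  have h3 : superAdj (matRho : Matrix (Fin 3) (Fin 3) Λ) = matRho := by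
    ext i j
    fin_cases i <;> fin_cases j <;> simp [superAdj, matRho]
  refine ⟨⟨?_, ?_, ?_, ?_, ?_, ?_, ?_, ?_, ?_⟩, by rw [h3, matRho_mul_self],
    by rw [h3, matRho_mul_self], ?_⟩ <;>
    simp [isEven_one, isEven_one.neg, isEven_zero, isOdd_zero, body, matRho]

theorem isOSp_matE {x : Λ} (hx : IsPosEven x) : IsOSp (matE x) := by
  have h3 : superAdj (matE x) = matEInv x := by
    ext i j
    fin_cases i <;> fin_cases j <;> simp [superAdj, matE, matEInv]
  refine ⟨⟨?_, ?_, ?_, ?_, ?_, ?_, ?_, ?_, ?_⟩, by rw [h3, (matE_mul_matEInv hx.isUnit).1],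
    by rw [h3, (matE_mul_matEInv hx.isUnit).2], ?_⟩ <;>
    simp [isEven_one, isEven_zero, isOdd_zero, body, matE, hx.1.ringInverse, hx.1.neg]

theorem isOSp_matA {h s : Λ} (hh : IsEven h) (hs : IsOdd s) : IsOSp (matA h s) := by
  have h3 : superAdj (matA h s) = matAInv h s := by
    ext i j
    fin_cases i <;> fin_cases j <;> simp [superAdj, matA, matAInv]
  refine ⟨⟨?_, ?_, ?_, ?_, ?_, ?_, ?_, ?_, ?_⟩, by rw [h3, (matA_mul_matAInv h hs.mul_self).1],
    by rw [h3, (matA_mul_matAInv h hs.mul_self).2], ?_⟩ <;>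
    simp [isEven_one, isEven_zero, isOdd_zero, body, matA, hh, hs, hs.neg]

theorem IsOSp.adj {X : Matrix (Fin 3) (Fin 3) Λ} (hX : IsOSp X) : IsOSp (superAdj X) := by
  have hs : IsSuper (superAdj X) := by
    constructor <;> simp only [superAdj, of_apply, cons_val', cons_val_zero, cons_val_one,
      cons_val_two, cons_val_fin_one, cons_val]
    exacts [hX.e11, hX.e01.neg, hX.e10.neg, hX.e00, hX.e22, hX.o21.neg, hX.o20, hX.o12,
      hX.o02.neg]
  have h3 : superAdj (1 : Matrix (Fin 3) (Fin 3) Λ) = 1 := by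
    ext i j
    fin_cases i <;> fin_cases j <;> simp [superAdj]
  refine ⟨hs, ?_, ?_, by simpa [superAdj] using hX.body_eq⟩
  · rw [← superAdj_mul hs hX.toIsSuper, hX.adj_mul, h3]
  · rw [← superAdj_mul hX.toIsSuper hs, hX.mul_adj, h3]

/-- The `(2, 2)` entries of the two inverse relations read `(H 2 2)² = 1 + xy - yx = (1 + xy)²` for
odd `x, y`, because `(xy)² = 0`. Both `H 2 2` and `1 + xy` have body `1`, and positive square roots
are unique. The two choices of `x, y` yield the two expressions for `⋆`. -/
theorem IsOSp.apply_two_two {H : Matrix (Fin 3) (Fin 3) Λ} (hH : IsOSp H) :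
    H 2 2 = 1 + H 2 0 * H 2 1 ∧ H 2 2 = 1 + H 0 2 * H 1 2 := by
  have pos : IsPosEven (H 2 2) := ⟨hH.e22, by
    have := hH.body_eq
    change 0 < body _
    rw [this]; exact one_pos⟩
  have key : ∀ x y : Λ, IsOdd x → IsOdd y → H 2 2 * H 2 2 = 1 + (x * y - y * x) →
      H 2 2 = 1 + x * y := by
    intro x y hx hy h
    have hbody : body (1 + x * y) = 1 := by
      rw [body_add, body_mul, hx.body_eq_zero, zero_mul, add_zero]; exact map_one _
    refine pos.eq_of_mul_self_eq ⟨isEven_one.add (hx.mul hy), ?_⟩ ?_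
    · change 0 < body _
      rw [hbody]; exact one_pos
    · have h1 : x * y * (x * y) = 0 := by
        rw [mul_assoc, ← mul_assoc y, hy.mul_comm hx, neg_mul, mul_assoc x y y, hy.mul_self]
        simp
      rw [h, hy.mul_comm hx, mul_add, add_mul, add_mul, h1]
      simp [add_assoc]
  constructor
  · apply key _ _ hH.o20 hH.o21
    have := congrFun (congrFun hH.mul_adj 2) 2
    simp [superAdj, Matrix.mul_apply, Fin.sum_univ_three] at this
    rw [← this]; abel
  · apply key _ _ hH.o02 hH.o12
    have := congrFun (congrFun hH.adj_mul 2) 2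
    simp [superAdj, Matrix.mul_apply, Fin.sum_univ_three] at this
    rw [← this, hH.o02.mul_comm hH.o12]; abel

end OSp

/-! ### The super Ptolemy relation as identities between parameters of angle matrices. -/

section FlipIdentities

variable {A : Type*} [Ring A] {Z : Type*} [CommRing Z] [Algebra Z A]
  {a b c d e f a' b' c' d' e' f' p : Z}
variable {σ θ : A}

/-- Central units `a, …, f` with inverses `a', …, f'` and odd elements `σ, θ` with product `p`,
related by the super Ptolemy equation. -/
structure PtolemyData (a b c d e f a' b' c' d' e' f' p : Z) (σ θ : A) : Prop where
  ha : a * a' = 1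
  hb : b * b' = 1
  hc : c * c' = 1
  hd : d * d' = 1
  he : e * e' = 1
  hf : f * f' = 1
  hσ : σ * σ = 0
  hθ : θ * θ = 0
  hσθ : σ * θ = p • 1
  hθσ : θ * σ = -(p • 1)
  h : f * f * (e * e) = a * a * (c * c) + b * b * (d * d) + a * b * c * d * p

/-- The odd term of the Ptolemy relation contains `p = σθ`, so it disappears once multiplied by `σ`
or `θ`. -/
theorem smul_eq_zero_of_mul_eq (hσ : σ * σ = 0) (hσθ : σ * θ = p • 1) : p • σ = 0 := by
  rw [← mul_one σ, ← mul_smul_comm, ← hσθ, ← mul_assoc, hσ, zero_mul]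

theorem smul_eq_zero_of_mul_eq_neg (hθ : θ * θ = 0) (hθσ : θ * σ = -(p • 1)) : p • θ = 0 := by
  have : -(p • θ) = 0 := by
    rw [← mul_one θ, ← mul_smul_comm, ← mul_neg, ← hθσ, ← mul_assoc, hθ, zero_mul]
  simpa using this

/-- The suffix names a corner of the quadrilateral: `tail` and `head` are the ends of the old
diagonal, `left` and `right` the tail and head of the new one. An `add_` lemma compares odd
parameters and the `h_` lemma with the same suffix compares even ones; together they match the two
sides of `matA_mul` at that corner. The odd identities at `tail` and `head` do not need the Ptolemy
equation. -/
theorem PtolemyData.add_tail (D : PtolemyData a b c d e f a' b' c' d' e' f' p σ θ) :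
    (f * (d' * a')) • ((e' * f') • ((b * d) • θ + (a * c) • σ))
      = (c * (d' * e')) • σ + (b * (e' * a')) • θ := by
  obtain ⟨ha, hb, hc, hd, he, hf, hσ, hθ, hσθ, hθσ, h⟩ := D
  clear h
  match_scalars <;> grind

theorem PtolemyData.add_head (D : PtolemyData a b c d e f a' b' c' d' e' f' p σ θ) :
    (f * (c' * b')) • ((e' * f') • ((b * d) • σ - (a * c) • θ))
      = (d * (e' * c')) • σ - (a * (e' * b')) • θ := by
  obtain ⟨ha, hb, hc, hd, he, hf, hσ, hθ, hσθ, hθσ, h⟩ := D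
  clear h
  match_scalars <;> grind

theorem PtolemyData.h_tail (D : PtolemyData a b c d e f a' b' c' d' e' f' p σ θ) :
    (f * f * (d' * d' * (a' * a'))) • (1 : A)
      = (c * c * (d' * d' * (e' * e'))) • 1 + (b * b * (e' * e' * (a' * a'))) • 1
        - ((b * (e' * a')) • θ) * ((c * (d' * e')) • σ) := by
  obtain ⟨ha, hb, hc, hd, he, hf, hσ, hθ, hσθ, hθσ, h⟩ := D
  rw [smul_mul_smul_comm, hθσ]
  clear hb hc hf
  match_scalars
  grind

theorem PtolemyData.h_head (D : PtolemyData a b c d e f a' b' c' d' e' f' p σ θ) :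
    (f * f * (c' * c' * (b' * b'))) • (1 : A)
      = (a * a * (e' * e' * (b' * b'))) • 1 + (d * d * (e' * e' * (c' * c'))) • 1
        + ((d * (e' * c')) • σ) * ((a * (e' * b')) • θ) := by
  obtain ⟨ha, hb, hc, hd, he, hf, hσ, hθ, hσθ, hθσ, h⟩ := D
  rw [smul_mul_smul_comm, hσθ]
  clear ha hd hf
  match_scalars
  grind

theorem PtolemyData.add_left (D : PtolemyData a b c d e f a' b' c' d' e' f' p σ θ) :
    (e * (d' * c')) • σ = (a * (d' * f')) • ((e' * f') • ((b * d) • θ + (a * c) • σ))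
      + (b * (f' * c')) • ((e' * f') • ((b * d) • σ - (a * c) • θ)) := by
  obtain ⟨ha, hb, hc, hd, he, hf, hσ, hθ, hσθ, hθσ, h⟩ := D
  have h0 := smul_eq_zero_of_mul_eq hσ hσθ
  -- The factor `(ef)²` is created so that the Ptolemy equation can be inserted; the term with `p`
  -- then acts on `σ` by zero.
  have h1 : (e * (d' * c')) • σ = (e' * f' * f' * c' * d') • ((e * e * f * f) • σ) := by
    clear h; match_scalars; grind
  have h2 : (e * e * f * f) • σ = (a * a * (c * c) + b * b * (d * d)) • σ
      + (a * b * c * d) • (p • σ) := by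
    match_scalars; linear_combination h
  rw [h1, h2, h0]
  clear h h1 h2
  match_scalars <;> grind

theorem PtolemyData.add_right (D : PtolemyData a b c d e f a' b' c' d' e' f' p σ θ) :
    (e * (a' * b')) • θ = (d * (f' * a')) • ((e' * f') • ((b * d) • θ + (a * c) • σ))
      - (c * (f' * b')) • ((e' * f') • ((b * d) • σ - (a * c) • θ)) := by
  obtain ⟨ha, hb, hc, hd, he, hf, hσ, hθ, hσθ, hθσ, h⟩ := D
  have h0 := smul_eq_zero_of_mul_eq_neg hθ hθσ
  have h1 : (e * (a' * b')) • θ = (e' * f' * f' * a' * b') • ((e * e * f * f) • θ) := by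
    clear h; match_scalars; grind
  have h2 : (e * e * f * f) • θ = (a * a * (c * c) + b * b * (d * d)) • θ
      + (a * b * c * d) • (p • θ) := by
    match_scalars; linear_combination h
  rw [h1, h2, h0]
  clear h h1 h2
  match_scalars <;> grind

/-- The product of the odd elements is preserved by a flip up to sign. Since `p² = 0`, the factor
`a²c² + b²d²` acts on `p` as `(ef)²`, which cancels the denominators. -/
theorem PtolemyData.product (D : PtolemyData a b c d e f a' b' c' d' e' f' p σ θ) :
    ((e' * f') • ((b * d) • θ + (a * c) • σ)) * ((e' * f') • ((b * d) • σ - (a * c) • θ))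
      = -(p • (1 : A)) := by
  obtain ⟨ha, hb, hc, hd, he, hf, hσ, hθ, hσθ, hθσ, h⟩ := D
  have hp : p • (p • (1 : A)) = 0 := by
    rw [← hσθ, ← smul_mul_assoc, smul_eq_zero_of_mul_eq hσ hσθ, zero_mul]
  have h2 : (e * e * f * f) • (p • (1 : A)) = (a * a * (c * c) + b * b * (d * d)) • (p • (1 : A))
      + (a * b * c * d) • (p • (p • (1 : A))) := by
    match_scalars; linear_combination p * h
  rw [hp] at h2
  have h1 : p • (1 : A) = (e' * f' * e' * f') • ((e * e * f * f) • (p • (1 : A))) := by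
    clear h h2
    match_scalars; grind
  rw [h1, h2, smul_mul_smul_comm, add_mul, mul_sub, mul_sub]
  simp only [smul_mul_smul_comm, hσ, hθ, hσθ, hθσ]
  clear h h1 h2
  match_scalars <;> grind

theorem PtolemyData.product' (D : PtolemyData a b c d e f a' b' c' d' e' f' p σ θ) :
    ((e' * f') • ((b * d) • σ - (a * c) • θ)) * ((e' * f') • ((b * d) • θ + (a * c) • σ))
      = p • (1 : A) := by
  have h := D.product
  rw [smul_mul_smul_comm] at h ⊢
  have : ((b * d) • σ - (a * c) • θ) * ((b * d) • θ + (a * c) • σ)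
      = -(((b * d) • θ + (a * c) • σ) * ((b * d) • σ - (a * c) • θ)) := by
    simp only [mul_add, mul_sub, add_mul, sub_mul, smul_mul_smul_comm, D.hσ, D.hθ, D.hσθ, D.hθσ]
    match_scalars; ring
  rw [this, smul_neg, h, neg_neg]

theorem PtolemyData.h_left (D : PtolemyData a b c d e f a' b' c' d' e' f' p σ θ) :
    (e * e * (d' * d' * (c' * c'))) • (1 : A)
      = (b * b * (f' * f' * (c' * c'))) • 1 + (a * a * (d' * d' * (f' * f'))) • 1
        - ((a * (d' * f')) • ((e' * f') • ((b * d) • θ + (a * c) • σ)))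
          * ((b * (f' * c')) • ((e' * f') • ((b * d) • σ - (a * c) • θ))) := by
  rw [smul_mul_smul_comm, D.product]
  obtain ⟨ha, hb, hc, hd, he, hf, hσ, hθ, hσθ, hθσ, h⟩ := D
  clear ha hb he
  match_scalars
  grind

theorem PtolemyData.h_right (D : PtolemyData a b c d e f a' b' c' d' e' f' p σ θ) :
    (e * e * (a' * a' * (b' * b'))) • (1 : A)
      = (d * d * (f' * f' * (a' * a'))) • 1 + (c * c * (f' * f' * (b' * b'))) • 1
        + ((c * (f' * b')) • ((e' * f') • ((b * d) • σ - (a * c) • θ)))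
          * ((d * (f' * a')) • ((e' * f') • ((b * d) • θ + (a * c) • σ))) := by
  rw [smul_mul_smul_comm, D.product']
  obtain ⟨ha, hb, hc, hd, he, hf, hσ, hθ, hσθ, hθσ, h⟩ := D
  clear hc hd he
  match_scalars
  grind

end FlipIdentities

end SuperTeich

end

/-! ## Central elements and flips of decorations -/

noncomputable section

namespace SuperTeich

open Matrix

section Central

variable {K M : Type*} [Field K] [LinearOrder K] [IsStrictOrderedRing K] [AddCommGroup M]
  [Module K M]

local notation "Λ" => ExteriorAlgebra K M

/-- Even elements are central, so square roots of `λ`-lengths can be treated as scalars from the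
commutative ring `Subring.center Λ`. This is how the identities over an abstract scalar ring apply
to decorations. -/
theorem IsPosEven.exists_central {x : Λ} (hx : IsPosEven x) :
    ∃ z z' : Subring.center Λ, x = z • 1 ∧ z * z' = 1 := by
  have h1 : x ∈ Subring.center Λ := Subring.mem_center_iff.2 fun y => (hx.1.commute y).eq.symm
  have h2 : Ring.inverse x ∈ Subring.center Λ :=
    Subring.mem_center_iff.2 fun y => (hx.1.ringInverse.commute y).eq.symm
  exact ⟨⟨x, h1⟩, ⟨_, h2⟩, by simp [Subring.smul_def],
    Subtype.ext (Ring.mul_inverse_cancel x hx.isUnit)⟩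

theorem ringInverse_central {z z' : Subring.center Λ} (h : z * z' = 1) :
    Ring.inverse (z • (1 : Λ)) = z' • 1 := by
  have h2 : (z • (1 : Λ)) * (z' • 1) = 1 := by
    rw [smul_mul_smul_comm, h, one_smul, mul_one]
  have h3 : (z' • (1 : Λ)) * (z • 1) = 1 := by
    rw [smul_mul_smul_comm, mul_comm, h, one_smul, mul_one]
  have := Ring.inverse_unit ⟨z • (1 : Λ), z' • 1, h2, h3⟩
  simpa using this

end Central

namespace DecoratedTriangulation

variable {K M : Type*} [Field K] [LinearOrder K] [IsStrictOrderedRing K] [AddCommGroup M]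
  [Module K M] {n : ℕ}

local notation "Λ" => ExteriorAlgebra K M

theorem insert_rotate (i j k : Fin n) : ({j, k, i} : Finset (Fin n)) = {i, j, k} := by
  ext x; simp; tauto

theorem insert_swap (i j k : Fin n) : ({i, k, j} : Finset (Fin n)) = {i, j, k} := by
  ext x; simp; tauto

/-- The matrix of the clockwise edge at the angle `i`. -/
def angle (S : DecoratedTriangulation K M n) (i j k : Fin n) : Matrix (Fin 3) (Fin 3) Λ :=
  matA (S.hLength i j k) (S.muUp i j k)

variable {S : DecoratedTriangulation K M n} {i j k l : Fin n}

theorem lam_comm (S : DecoratedTriangulation K M n) (i j : Fin n) : S.lam i j = S.lam j i := by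
  unfold lam; rw [Sym2.eq_swap]; simp only [eq_comm]

theorem lam_central {z : Subring.center Λ} (hij : i ≠ j) (h : S.root s(i, j) = z • 1) :
    S.lam i j = (z * z) • 1 := by
  rw [lam, if_neg hij, h, smul_mul_smul_comm, mul_one]

/-- The set `t` is a separate argument so that the three corners of one triangle can be evaluated
with literally the same `S.mu t`. -/
theorem angle_central {p p' r r' q : Subring.center Λ} (hij : i ≠ j) (hik : i ≠ k) (hjk : j ≠ k)
    (hp : S.root s(i, j) = p • 1) (hr : S.root s(i, k) = r • 1) (hq : S.root s(j, k) = q • 1)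
    (hpp : p * p' = 1) (hrr : r * r' = 1) {t : Finset (Fin n)} (ht : {i, j, k} = t) :
    S.angle i j k = matA ((q * q * (p' * p' * (r' * r'))) • 1) ((q * (p' * r')) • S.mu t) := by
  subst ht
  have e1 : Ring.inverse (S.lam i j * S.lam i k) = ((p' * p') * (r' * r')) • (1 : Λ) := by
    rw [lam_central hij hp, lam_central hik hr, smul_mul_smul_comm, mul_one]
    apply ringInverse_central
    linear_combination (p * p' + 1) * (r * r') ^ 2 * hpp + (r * r' + 1) * hrr
  have e2 : Ring.inverse (S.root s(i, j) * S.root s(i, k)) = (p' * r') • (1 : Λ) := by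
    rw [hp, hr, smul_mul_smul_comm, mul_one]
    apply ringInverse_central
    linear_combination (r * r') * hpp + hrr
  rw [angle, hLength, muUp, lam_central hjk hq, e1, e2, hq, smul_mul_smul_comm,
    smul_mul_smul_comm, mul_one, smul_mul_assoc, one_mul]

theorem matE_central {z z' : Subring.center Λ} (hz : z * z' = 1) :
    matE ((z * z) • (1 : Λ)) = !![0, -((z * z) • (1 : Λ)), 0; (z' * z') • 1, 0, 0; 0, 0, 1] := by
  rw [matE, ringInverse_central (z := z * z) (z' := z' * z')]
  linear_combination (z * z' + 1) * hz

/-- The holonomy around a hexagon is trivial. -/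
theorem hexagon_angle (hij : i ≠ j) (hik : i ≠ k) (hjk : j ≠ k)
    (h1 : IsPosEven (S.root s(i, j))) (h2 : IsPosEven (S.root s(j, k)))
    (h3 : IsPosEven (S.root s(i, k))) (hμ : IsOdd (S.mu {i, j, k})) :
    matE (S.lam j i) * (S.angle j k i * (matE (S.lam k j) * (S.angle k i j *
      (matE (S.lam i k) * S.angle i j k)))) = 1 := by
  obtain ⟨p, p', hp, hpp⟩ := h1.exists_central
  obtain ⟨q, q', hq, hqq⟩ := h2.exists_central
  obtain ⟨r, r', hr, hrr⟩ := h3.exists_central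
  have hp2 : S.root s(j, i) = p • 1 := by rw [Sym2.eq_swap, hp]
  have hq2 : S.root s(k, j) = q • 1 := by rw [Sym2.eq_swap, hq]
  have hr2 : S.root s(k, i) = r • 1 := by rw [Sym2.eq_swap, hr]
  rw [lam_central hij.symm hp2, lam_central hjk.symm hq2, lam_central hik hr,
    angle_central hij hik hjk hp hr hq hpp hrr rfl,
    angle_central hik.symm hjk.symm hij hr2 hq2 hp hrr hqq
      (insert_rotate k i j).symm,
    angle_central hjk hij.symm hik.symm hq hp2 hr2 hqq hpp
      (insert_rotate i j k)]
  refine hexagon hpp hqq hrr hμ.mul_self (matE_central hrr) (matE_central hqq) (matE_central hpp)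
    ?_ ?_ ?_ <;> congr 2 <;> ring

/-! ### Flips -/

theorem flip_root_of_ne {e : Sym2 (Fin n)} (h : e ≠ s(j, l)) :
    (S.flip i j k l).root e = S.root e := Function.update_of_ne h _ _

theorem flip_root_self : (S.flip i j k l).root s(j, l) =
    superSqrt ((S.lam i l * S.lam j k + S.lam k l * S.lam i j
      + S.root s(i, l) * S.root s(k, l) * S.root s(j, k) * S.root s(i, j)
        * S.mu {i, j, k} * S.mu {i, k, l}) * Ring.inverse (S.lam i k)) :=
  Function.update_self _ _ _

theorem flip_mu_left : (S.flip i j k l).mu {i, j, l} =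
    (S.mu {i, k, l} * (S.root s(k, l) * S.root s(i, j))
      + S.mu {i, j, k} * (S.root s(i, l) * S.root s(j, k)))
      * Ring.inverse (S.root s(i, k) * (S.flip i j k l).root s(j, l)) := by
  rw [flip_root_self]; exact Function.update_self _ _ _

theorem flip_mu_right (h : ({j, k, l} : Finset (Fin n)) ≠ {i, j, l}) :
    (S.flip i j k l).mu {j, k, l} =
    (S.mu {i, j, k} * (S.root s(k, l) * S.root s(i, j))
      - S.mu {i, k, l} * (S.root s(i, l) * S.root s(j, k)))
      * Ring.inverse (S.root s(i, k) * (S.flip i j k l).root s(j, l)) := by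
  rw [flip_root_self]
  exact (Function.update_of_ne h _ _).trans (Function.update_self _ _ _)

theorem flip_mu_of_ne {t : Finset (Fin n)} (h : t ≠ {i, j, l}) (h2 : t ≠ {j, k, l}) :
    (S.flip i j k l).mu t = S.mu t :=
  (Function.update_of_ne h _ _).trans (Function.update_of_ne h2 _ _)

/-- The hypotheses under which a flip is computed. -/
structure IsQuad (S : DecoratedTriangulation K M n) (i j k l : Fin n) : Prop where
  ij : i ≠ j
  ik : i ≠ k
  il : i ≠ l
  jk : j ≠ k
  jl : j ≠ l
  kl : k ≠ l
  pij : IsPosEven (S.root s(i, j))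
  pik : IsPosEven (S.root s(i, k))
  pil : IsPosEven (S.root s(i, l))
  pjk : IsPosEven (S.root s(j, k))
  pkl : IsPosEven (S.root s(k, l))
  oσ : IsOdd (S.mu {i, j, k})
  oθ : IsOdd (S.mu {i, k, l})

theorem IsPosEven.lam (hij : i ≠ j) (h : IsPosEven (S.root s(i, j))) : IsPosEven (S.lam i j) := by
  rw [DecoratedTriangulation.lam, if_neg hij]; exact h.mul h

/-- The term with `σθ` has body zero, so the radicand has the body of `(ac + bd)/e`, which is
positive, and `superSqrt` meets its specification. -/
theorem IsQuad.flip_root (hK : ∀ x : K, 0 < x → IsSquare x) (Q : S.IsQuad i j k l) :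
    IsPosEven ((S.flip i j k l).root s(j, l)) ∧
    (S.flip i j k l).root s(j, l) * (S.flip i j k l).root s(j, l) =
      (S.lam i l * S.lam j k + S.lam k l * S.lam i j
      + S.root s(i, l) * S.root s(k, l) * S.root s(j, k) * S.root s(i, j)
        * S.mu {i, j, k} * S.mu {i, k, l}) * Ring.inverse (S.lam i k) := by
  rw [flip_root_self]
  apply superSqrt_spec hK
  refine IsPosEven.mul ?_ (IsPosEven.lam Q.ik Q.pik).ringInverse
  have h1 := ((IsPosEven.lam Q.il Q.pil).mul (IsPosEven.lam Q.jk Q.pjk)).add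
    ((IsPosEven.lam Q.kl Q.pkl).mul (IsPosEven.lam Q.ij Q.pij))
  have h2 := (((Q.pil.1.mul Q.pkl.1).mul Q.pjk.1).mul Q.pij.1).mul_odd Q.oσ
  refine ⟨h1.1.add (h2.mul Q.oθ), ?_⟩
  change 0 < body _
  rw [body_add, body_mul _ (S.mu {i, k, l}), Q.oθ.body_eq_zero, mul_zero, add_zero]
  exact h1.2

theorem IsQuad.set_ne (Q : S.IsQuad i j k l) : ({j, k, l} : Finset (Fin n)) ≠ {i, j, l} := by
  intro h
  have : i ∈ ({j, k, l} : Finset (Fin n)) := by rw [h]; simp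
  simp [Q.ij, Q.ik, Q.il] at this

theorem IsQuad.ptolemy (hK : ∀ x : K, 0 < x → IsSquare x) (Q : S.IsQuad i j k l) :
    ∃ a b c d e f a' b' c' d' e' f' p : Subring.center Λ,
      PtolemyData a b c d e f a' b' c' d' e' f' p (S.mu {i, j, k}) (S.mu {i, k, l}) ∧
      S.root s(i, l) = a • 1 ∧ S.root s(k, l) = b • 1 ∧ S.root s(j, k) = c • 1 ∧
      S.root s(i, j) = d • 1 ∧ S.root s(i, k) = e • 1 ∧
      (S.flip i j k l).root s(j, l) = f • 1 ∧
      (S.flip i j k l).mu {i, j, l}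
        = (e' * f') • ((b * d) • S.mu {i, k, l} + (a * c) • S.mu {i, j, k}) ∧
      (S.flip i j k l).mu {j, k, l}
        = (e' * f') • ((b * d) • S.mu {i, j, k} - (a * c) • S.mu {i, k, l}) := by
  obtain ⟨hf1, hf2⟩ := Q.flip_root hK
  obtain ⟨a, a', ha, haa⟩ := Q.pil.exists_central
  obtain ⟨b, b', hb, hbb⟩ := Q.pkl.exists_central
  obtain ⟨c, c', hc, hcc⟩ := Q.pjk.exists_central
  obtain ⟨d, d', hd, hdd⟩ := Q.pij.exists_central
  obtain ⟨e, e', he, hee⟩ := Q.pik.exists_central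
  obtain ⟨f, f', hf, hff⟩ := hf1.exists_central
  have hp : S.mu {i, j, k} * S.mu {i, k, l} ∈ Subring.center Λ :=
    Subring.mem_center_iff.2 fun y => ((Q.oσ.mul Q.oθ).commute y).eq.symm
  have hpe : S.mu {i, j, k} * S.mu {i, k, l} = (⟨_, hp⟩ : Subring.center Λ) • (1 : Λ) := by
    simp [Subring.smul_def]
  have hinv : Ring.inverse (S.root s(i, k) * (S.flip i j k l).root s(j, l))
      = (e' * f') • (1 : Λ) := by
    rw [he, hf, smul_mul_smul_comm, mul_one]
    apply ringInverse_central
    linear_combination (f * f') * hee + hff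
  have hinj : Function.Injective fun z : Subring.center Λ => z • (1 : Λ) := by
    intro x y hxy
    simpa [Subring.smul_def] using hxy
  refine ⟨a, b, c, d, e, f, a', b', c', d', e', f', ⟨_, hp⟩,
    ⟨haa, hbb, hcc, hdd, hee, hff, Q.oσ.mul_self, Q.oθ.mul_self, hpe, ?_, ?_⟩,
    ha, hb, hc, hd, he, hf, ?_, ?_⟩
  · rw [Q.oθ.mul_comm Q.oσ]; exact congrArg Neg.neg hpe
  · apply hinj
    have hee2 : e * e * (e' * e') = 1 := by linear_combination (e * e' + 1) * hee
    simp only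
    rw [mul_assoc _ (S.mu {i, j, k}), hpe, lam_central Q.il ha, lam_central Q.jk hc,
      lam_central Q.kl hb, lam_central Q.ij hd, lam_central Q.ik he,
      ringInverse_central hee2, hf, ha, hb, hc, hd] at hf2
    simp only [smul_mul_smul_comm, mul_one, ← add_smul] at hf2
    have := hinj hf2
    congr 1
    rw [this]
    linear_combination (a * a * (c * c) + b * b * (d * d) + a * b * c * d * ⟨_, hp⟩) * hee2
  · rw [flip_mu_left, hinv, ha, hb, hc, hd]
    simp only [mul_one, mul_smul_comm]
    module
  · rw [flip_mu_right Q.set_ne, hinv, ha, hb, hc, hd]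
    simp only [mul_one, mul_smul_comm]
    module

theorem matRho_conj_matA (h s : Λ) : matRho * matA h s * matRho = matA h (-s) := by
  rw [matRho_mul_matA, mul_assoc, matRho_mul_self, mul_one]

theorem flip_root_central {x y : Fin n} (h : s(x, y) ≠ s(j, l)) {z : Subring.center Λ}
    (hz : S.root s(x, y) = z • 1) : (S.flip i j k l).root s(x, y) = z • 1 := by
  rw [flip_root_of_ne h, hz]

/-- This and the next three lemmas are the Ptolemy relation in matrix form. At `i` and `k` two old
angles merge, at `j` and `l` an old angle splits. A conjugation by `ρ` appears at `k` and `l`: one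
`ρ` comes from crossing a diagonal near its head, the other from the reversal of the side `(k, l)`.
-/
theorem IsQuad.angle_flip_tail (hK : ∀ x : K, 0 < x → IsSquare x) (Q : S.IsQuad i j k l) :
    (S.flip i j k l).angle i j l = S.angle i k l * S.angle i j k := by
  obtain ⟨a, b, c, d, e, f, a', b', c', d', e', f', p, D, ha, hb, hc, hd, he, hf, hl, hr⟩ :=
    Q.ptolemy hK
  rw [angle_central Q.ij Q.il Q.jl (flip_root_central (by simp [Q.ij, Q.il]) hd)
      (flip_root_central (by simp [Q.ij, Q.il]) ha) hf D.hd D.ha rfl,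
    angle_central Q.ik Q.il Q.kl he ha hb D.he D.ha rfl,
    angle_central Q.ij Q.ik Q.jk hd he hc D.hd D.he rfl, matA_mul, hl]
  exact congrArg₂ matA D.h_tail D.add_tail

theorem IsQuad.angle_flip_head (hK : ∀ x : K, 0 < x → IsSquare x) (Q : S.IsQuad i j k l) :
    (S.flip i j k l).angle k l j = S.angle k i j * (matRho * S.angle k l i * matRho) := by
  obtain ⟨a, b, c, d, e, f, a', b', c', d', e', f', p, D, ha, hb, hc, hd, he, hf, hl, hr⟩ :=
    Q.ptolemy hK
  rw [angle_central Q.kl Q.jk.symm Q.jl.symm (flip_root_central (by simp [Q.jk.symm, Q.kl]) hb)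
      (flip_root_central (by simp [Q.jk.symm, Q.kl]) (Sym2.eq_swap ▸ hc)) (Sym2.eq_swap ▸ hf)
      D.hb D.hc (insert_rotate j k l),
    angle_central Q.ik.symm Q.jk.symm Q.ij (Sym2.eq_swap ▸ he) (Sym2.eq_swap ▸ hc) hd
      D.he D.hc (insert_rotate k i j).symm,
    angle_central Q.kl Q.ik.symm Q.il.symm hb (Sym2.eq_swap ▸ he) (Sym2.eq_swap ▸ ha)
      D.hb D.he (insert_rotate i k l), matRho_conj_matA, matA_mul, hr]
  refine congrArg₂ matA ?_ ?_
  · have := D.h_head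
    rw [mul_neg, sub_neg_eq_add]
    convert this using 3 <;> ring_nf
  · have := D.add_head
    rw [neg_add_eq_sub]
    convert this using 3 <;> ring_nf

theorem IsQuad.angle_flip_left (hK : ∀ x : K, 0 < x → IsSquare x) (Q : S.IsQuad i j k l) :
    S.angle j k i = (S.flip i j k l).angle j l i * (S.flip i j k l).angle j k l := by
  obtain ⟨a, b, c, d, e, f, a', b', c', d', e', f', p, D, ha, hb, hc, hd, he, hf, hl, hr⟩ :=
    Q.ptolemy hK
  rw [angle_central Q.jk Q.ij.symm Q.ik.symm hc (Sym2.eq_swap ▸ hd) (Sym2.eq_swap ▸ he)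
      D.hc D.hd (insert_rotate i j k),
    angle_central Q.jl Q.ij.symm Q.il.symm hf
      (flip_root_central (by simp [Q.ij, Q.il]) (Sym2.eq_swap ▸ hd))
      (flip_root_central (by simp [Q.ij, Q.il, Q.jl.symm]) (Sym2.eq_swap ▸ ha)) D.hf D.hd
      (insert_rotate i j l),
    angle_central Q.jk Q.jl Q.kl (flip_root_central (by simp [Q.jk.symm, Q.kl]) hc) hf
      (flip_root_central (by simp [Q.jk.symm, Q.kl]) hb) D.hc D.hf rfl, matA_mul, hl, hr]
  refine congrArg₂ matA ?_ ?_
  · have := D.h_left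
    convert this using 3 <;> ring_nf
  · have := D.add_left
    rw [add_comm] at this
    convert this using 3 <;> ring_nf

theorem IsQuad.angle_flip_right (hK : ∀ x : K, 0 < x → IsSquare x) (Q : S.IsQuad i j k l) :
    S.angle l i k
      = (matRho * (S.flip i j k l).angle l j k * matRho) * (S.flip i j k l).angle l i j := by
  obtain ⟨a, b, c, d, e, f, a', b', c', d', e', f', p, D, ha, hb, hc, hd, he, hf, hl, hr⟩ :=
    Q.ptolemy hK
  rw [angle_central Q.il.symm Q.kl.symm Q.ik (Sym2.eq_swap ▸ ha) (Sym2.eq_swap ▸ hb) he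
      D.ha D.hb (insert_rotate l i k).symm,
    angle_central Q.jl.symm Q.kl.symm Q.jk (Sym2.eq_swap ▸ hf)
      (flip_root_central (by simp [Q.jk.symm, Q.kl, Q.jl.symm]) (Sym2.eq_swap ▸ hb))
      (flip_root_central (by simp [Q.jk.symm, Q.kl]) hc) D.hf D.hb (insert_rotate l j k).symm,
    angle_central Q.il.symm Q.jl.symm Q.ij
      (flip_root_central (by simp [Q.ij, Q.il, Q.jl.symm]) (Sym2.eq_swap ▸ ha)) (Sym2.eq_swap ▸ hf)
      (flip_root_central (by simp [Q.ij, Q.il]) hd) D.ha D.hf (insert_rotate l i j).symm,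
    matRho_conj_matA, matA_mul, hl, hr]
  refine congrArg₂ matA ?_ ?_
  · have := D.h_right
    rw [neg_mul, sub_neg_eq_add]
    convert this using 3 <;> ring_nf
  · have := D.add_right
    rw [sub_eq_add_neg] at this
    convert this using 3 <;> ring_nf

end DecoratedTriangulation

end SuperTeich

end

/-! ## Non-crossing triangulations -/

noncomputable section

namespace SuperTeich

section NonCrossing

variable {n : ℕ}

theorem sbtw_iff_lt {i j k : Fin n} :
    sbtw i j k ↔ (i < j ∧ j < k) ∨ (j < k ∧ k < i) ∨ (k < i ∧ i < j) := Iff.rfl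

theorem sbtw_ne {i j k : Fin n} (h : sbtw i j k) : i ≠ j ∧ i ≠ k ∧ j ≠ k := by
  rw [sbtw_iff_lt] at h; grind

theorem sbtw_or_sbtw {i j k : Fin n} (h : i ≠ j) (h2 : i ≠ k) (h3 : j ≠ k) :
    sbtw i j k ∨ sbtw i k j := by
  simp only [sbtw_iff_lt]; grind

theorem sbtw_trans_split {i j k l : Fin n} (h1 : sbtw i j k) (h2 : sbtw i k l) :
    sbtw i j l ∧ sbtw j k l := by
  simp only [sbtw_iff_lt] at *; grind

theorem triple_eq {i j k x y z : Fin n} (h : sbtw i j k)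
    (he : ({x, y, z} : Finset (Fin n)) = {i, j, k}) :
    (x = i ∧ y = j ∧ z = k) ∨ (x = j ∧ y = k ∧ z = i) ∨ (x = k ∧ y = i ∧ z = j) ∨
    (x = i ∧ y = k ∧ z = j) ∨ (x = j ∧ y = i ∧ z = k) ∨ (x = k ∧ y = j ∧ z = i) := by
  obtain ⟨h1, h2, h3⟩ := sbtw_ne h
  have hx : x ∈ ({i, j, k} : Finset (Fin n)) := by rw [← he]; simp
  have hy : y ∈ ({i, j, k} : Finset (Fin n)) := by rw [← he]; simp
  have hz : z ∈ ({i, j, k} : Finset (Fin n)) := by rw [← he]; simp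
  have hi : i ∈ ({x, y, z} : Finset (Fin n)) := by rw [he]; simp
  have hj : j ∈ ({x, y, z} : Finset (Fin n)) := by rw [he]; simp
  have hk : k ∈ ({x, y, z} : Finset (Fin n)) := by rw [he]; simp
  simp only [Finset.mem_insert, Finset.mem_singleton] at *
  grind

theorem triple_eq_of_sbtw {i j k x y z : Fin n} (h : sbtw i j k) (h' : sbtw x y z)
    (he : ({x, y, z} : Finset (Fin n)) = {i, j, k}) :
    (x = i ∧ y = j ∧ z = k) ∨ (x = j ∧ y = k ∧ z = i) ∨ (x = k ∧ y = i ∧ z = j) := by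
  rcases triple_eq h he with h1 | h1 | h1 | h1 | h1 | h1
  · exact Or.inl h1
  · exact Or.inr (Or.inl h1)
  · exact Or.inr (Or.inr h1)
  all_goals
    obtain ⟨rfl, rfl, rfl⟩ := h1
    exfalso
    simp only [sbtw_iff_lt] at *
    grind

/-- A set of triangles no two of whose edges cross. -/
structure IsNonCrossing (T : Set (Finset (Fin n))) : Prop where
  exists_sbtw : ∀ t ∈ T, ∃ i j k, sbtw i j k ∧ t = {i, j, k}
  not_cross : ∀ t ∈ T, ∀ t' ∈ T, ∀ p ∈ t, ∀ q ∈ t, ∀ x ∈ t', ∀ y ∈ t',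
    ¬ (sbtw p x q ∧ sbtw q y p)

variable {T : Set (Finset (Fin n))}

theorem IsNonCrossing.sbtw_or (hT : IsNonCrossing T) {x y z : Fin n} (h : {x, y, z} ∈ T) :
    sbtw x y z ∨ sbtw x z y := by
  obtain ⟨i, j, k, h1, h2⟩ := hT.exists_sbtw _ h
  rcases triple_eq h1 h2 with h | h | h | h | h | h <;> obtain ⟨rfl, rfl, rfl⟩ := h
  · exact Or.inl h1
  · exact Or.inl h1.cyclic_left
  · exact Or.inl h1.cyclic_right
  · exact Or.inr h1
  · exact Or.inr h1.cyclic_left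
  · exact Or.inr h1.cyclic_right

theorem IsNonCrossing.ne (hT : IsNonCrossing T) {x y z : Fin n} (h : {x, y, z} ∈ T) :
    x ≠ y ∧ x ≠ z ∧ y ≠ z := by
  rcases hT.sbtw_or h with h | h
  · exact sbtw_ne h
  · have := sbtw_ne h; exact ⟨this.2.1, this.1, this.2.2.symm⟩

/-- Two different apexes on the same side of `(i, k)` would make a side of one triangle cross a side
of the other. -/
theorem IsNonCrossing.eq_of_sbtw (hT : IsNonCrossing T) {i j k j' : Fin n}
    (h : {i, j, k} ∈ T) (h' : {i, j', k} ∈ T) (hs : sbtw i j k) (hs' : sbtw i j' k) : j = j' := by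
  have n1 := hT.not_cross _ h' _ h i (by simp) j' (by simp) j (by simp) k (by simp)
  have n2 := hT.not_cross _ h _ h' i (by simp) j (by simp) j' (by simp) k (by simp)
  simp only [sbtw_iff_lt] at *
  grind

/-- Two triangles with a common side lie on different sides of it. -/
theorem IsNonCrossing.opposite (hT : IsNonCrossing T) {x y z w : Fin n}
    (h : {x, y, z} ∈ T) (h' : {x, y, w} ∈ T) (hzw : z ≠ w) :
    (sbtw x z y ∧ sbtw x y w) ∨ (sbtw x w y ∧ sbtw x y z) := by
  have e : ∀ a : Fin n, ({x, a, y} : Finset (Fin n)) = {x, y, a} := by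
    intro a; ext b; simp; tauto
  rcases hT.sbtw_or h with h1 | h1 <;> rcases hT.sbtw_or h' with h2 | h2
  · exfalso; apply hzw
    refine hT.eq_of_sbtw (i := y) (k := x) ?_ ?_ h1.cyclic_left h2.cyclic_left
    · rwa [← e z, show ({y, z, x} : Finset (Fin n)) = {x, z, y} by ext b; simp; tauto] at *
    · rwa [← e w, show ({y, w, x} : Finset (Fin n)) = {x, w, y} by ext b; simp; tauto] at *
  · exact Or.inr ⟨h2, h1⟩
  · exact Or.inl ⟨h1, h2⟩
  · exfalso; exact hzw (hT.eq_of_sbtw (e z ▸ h) (e w ▸ h') h1 h2)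

/-- A chord has two sides, and each carries at most one triangle. -/
theorem IsNonCrossing.third_eq (hT : IsNonCrossing T) {x y z w u : Fin n}
    (h : {x, y, z} ∈ T) (h' : {x, y, w} ∈ T) (h'' : {x, y, u} ∈ T) (hzw : z ≠ w) :
    u = z ∨ u = w := by
  by_contra hn
  push Not at hn
  have a := hT.opposite h h' hzw
  have b := hT.opposite h h'' hn.1.symm
  have c := hT.opposite h' h'' hn.2.symm
  have d1 : ∀ {a}, sbtw x a y → ¬ sbtw x y a := fun h1 h2 => sbtw_asymm h1 h2.cyclic_left
  grind

/-- The triangles after a flip. -/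
def flipTri (T : Set (Finset (Fin n))) (i j k l : Fin n) : Set (Finset (Fin n)) :=
  (T \ {{i, j, k}, {i, k, l}}) ∪ {{j, k, l}, {i, j, l}}

theorem mem_flipTri {t : Finset (Fin n)} {i j k l : Fin n} : t ∈ flipTri T i j k l ↔
    (t ∈ T ∧ t ≠ {i, j, k} ∧ t ≠ {i, k, l}) ∨ t = {j, k, l} ∨ t = {i, j, l} := by
  simp [flipTri]; tauto

/-- The old diagonal is the only chord that crosses the new one without crossing a side of the
quadrilateral. -/
theorem not_cross_flip {i j k l x y : Fin n} (h1 : sbtw i j k) (h2 : sbtw i k l)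
    (h3 : sbtw j x l) (h4 : sbtw l y j)
    (n1 : ¬ (sbtw j x k ∧ sbtw k y j)) (n2 : ¬ (sbtw k x l ∧ sbtw l y k))
    (n3 : ¬ (sbtw l y i ∧ sbtw i x l)) (n4 : ¬ (sbtw i y j ∧ sbtw j x i)) : x = k ∧ y = i := by
  simp only [sbtw_iff_lt] at *
  grind

theorem IsNonCrossing.not_mem_flip (hT : IsNonCrossing T) {i j k l : Fin n} (hs : sbtw i j k)
    (hs' : sbtw i k l) (h : {i, j, k} ∈ T) {t : Finset (Fin n)} (ht : t ∈ T) (hj : j ∈ t) :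
    l ∉ t := fun hl => hT.not_cross _ h _ ht i (by simp) k (by simp) j hj l hl
      ⟨hs, hs'.cyclic_left⟩

theorem IsNonCrossing.eq_of_mem (hT : IsNonCrossing T) {i j k l : Fin n} (hs : sbtw i j k)
    (hs' : sbtw i k l) (h : {i, j, k} ∈ T) (h' : {i, k, l} ∈ T) {t : Finset (Fin n)} (ht : t ∈ T)
    (hi : i ∈ t) (hk : k ∈ t) : t = {i, j, k} ∨ t = {i, k, l} := by
  obtain ⟨a, b, c, hb, rfl⟩ := hT.exists_sbtw t ht
  have hik : i ≠ k := (sbtw_ne hs).2.1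
  have hjl : j ≠ l := (sbtw_ne (sbtw_trans_split hs hs').2).2.1
  obtain ⟨u, hu⟩ : ∃ u, ({a, b, c} : Finset (Fin n)) = {i, k, u} := by
    simp only [Finset.mem_insert, Finset.mem_singleton] at hi hk
    rcases hi with rfl | rfl | rfl <;> rcases hk with rfl | rfl | rfl <;>
      first
      | exact absurd rfl hik
      | exact ⟨_, rfl⟩
      | exact ⟨a, by ext z; simp; tauto⟩
      | exact ⟨b, by ext z; simp; tauto⟩
      | exact ⟨c, by ext z; simp; tauto⟩
  have h1 : ({i, j, k} : Finset (Fin n)) = {i, k, j} := by ext z; simp; tauto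
  rw [hu] at ht ⊢
  rw [h1] at h ⊢
  rcases hT.third_eq h h' ht hjl with rfl | rfl
  · exact Or.inl rfl
  · exact Or.inr rfl

/-- An edge after a flip is either an old edge different from the flipped one, or the new one. -/
theorem IsNonCrossing.edge_flip (hT : IsNonCrossing T) {i j k l : Fin n} (hs : sbtw i j k)
    (hs' : sbtw i k l) (h : {i, j, k} ∈ T) (h' : {i, k, l} ∈ T) {t : Finset (Fin n)}
    (ht : t ∈ flipTri T i j k l) {p q : Fin n} (hp : p ∈ t) (hq : q ∈ t) (hpq : p ≠ q) :
    ((∃ t' ∈ T, p ∈ t' ∧ q ∈ t') ∧ ¬ (p = i ∧ q = k) ∧ ¬ (p = k ∧ q = i)) ∨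
      (p = j ∧ q = l) ∨ (p = l ∧ q = j) := by
  obtain ⟨n1, n2, n3⟩ := sbtw_ne hs
  obtain ⟨-, n4, n5⟩ := sbtw_ne hs'
  rcases mem_flipTri.1 ht with ⟨h1, h2, h3⟩ | rfl | rfl
  · refine Or.inl ⟨⟨t, h1, hp, hq⟩, ?_, ?_⟩
    · rintro ⟨rfl, rfl⟩
      rcases hT.eq_of_mem hs hs' h h' h1 hp hq with h | h <;> contradiction
    · rintro ⟨rfl, rfl⟩
      rcases hT.eq_of_mem hs hs' h h' h1 hq hp with h | h <;> contradiction
  · simp only [Finset.mem_insert, Finset.mem_singleton] at hp hq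
    have e1 : ∃ t' ∈ T, j ∈ t' ∧ k ∈ t' := ⟨_, h, by simp, by simp⟩
    have e2 : ∃ t' ∈ T, k ∈ t' ∧ l ∈ t' := ⟨_, h', by simp, by simp⟩
    grind
  · simp only [Finset.mem_insert, Finset.mem_singleton] at hp hq
    have e1 : ∃ t' ∈ T, i ∈ t' ∧ j ∈ t' := ⟨_, h, by simp, by simp⟩
    have e2 : ∃ t' ∈ T, i ∈ t' ∧ l ∈ t' := ⟨_, h', by simp, by simp⟩
    grind

theorem IsNonCrossing.flip (hT : IsNonCrossing T) {i j k l : Fin n} (hs : sbtw i j k)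
    (hs' : sbtw i k l) (h : {i, j, k} ∈ T) (h' : {i, k, l} ∈ T) :
    IsNonCrossing (flipTri T i j k l) := by
  have split := sbtw_trans_split hs hs'
  constructor
  · intro t ht
    rcases mem_flipTri.1 ht with ⟨h1, -, -⟩ | rfl | rfl
    · exact hT.exists_sbtw t h1
    · exact ⟨j, k, l, split.2, rfl⟩
    · exact ⟨i, j, l, split.1, rfl⟩
  · have main : ∀ t ∈ T, ∀ x ∈ t, ∀ y ∈ t, ¬ (x = k ∧ y = i) → ¬ (sbtw j x l ∧ sbtw l y j) := by
      intro t ht x hx y hy hxy ⟨c1, c2⟩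
      apply hxy
      refine not_cross_flip hs hs' c1 c2 ?_ ?_ ?_ ?_
      · exact hT.not_cross _ h _ ht j (by simp) k (by simp) x hx y hy
      · exact hT.not_cross _ h' _ ht k (by simp) l (by simp) x hx y hy
      · exact hT.not_cross _ h' _ ht l (by simp) i (by simp) y hy x hx
      · exact hT.not_cross _ h _ ht i (by simp) j (by simp) y hy x hx
    intro t ht t' ht' p hp q hq x hx y hy ⟨c1, c2⟩
    have hpq : p ≠ q := (sbtw_ne c1).2.1
    have hxy : x ≠ y := by
      rintro rfl; exact sbtw_asymm c1 c2
    have c3 : sbtw x q y ∧ sbtw y p x := by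
      simp only [sbtw_iff_lt] at c1 c2 ⊢; grind
    rcases hT.edge_flip hs hs' h h' ht hp hq hpq with ⟨⟨u, hu, hpu, hqu⟩, a1, a2⟩ |
        ⟨rfl, rfl⟩ | ⟨rfl, rfl⟩ <;>
      rcases hT.edge_flip hs hs' h h' ht' hx hy hxy with ⟨⟨u', hu', hxu, hyu⟩, b1, b2⟩ |
        ⟨rfl, rfl⟩ | ⟨rfl, rfl⟩
    · exact hT.not_cross _ hu _ hu' p hpu q hqu x hxu y hyu ⟨c1, c2⟩
    · exact main u hu q hqu p hpu (fun e => a1 ⟨e.2, e.1⟩) c3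
    · exact main u hu p hpu q hqu a2 ⟨c3.2, c3.1⟩
    · exact main u' hu' x hxu y hyu b2 ⟨c1, c2⟩
    · exact sbtw_irrefl_left c1
    · exact sbtw_irrefl_right c1
    · exact main u' hu' y hyu x hxu (fun e => b1 ⟨e.2, e.1⟩) ⟨c2, c1⟩
    · exact sbtw_irrefl_right c1
    · exact sbtw_irrefl_left c1

end NonCrossing

end SuperTeich

end

/-! ## Flat sections of the connection -/

noncomputable section

namespace SuperTeich

open Matrix

namespace DecoratedTriangulation

variable {K M : Type*} [Field K] [LinearOrder K] [IsStrictOrderedRing K] [AddCommGroup M]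
  [Module K M] {n : ℕ}

local notation "Λ" => ExteriorAlgebra K M
variable (K M) in
/-- `3 × 3` matrices over the exterior algebra. -/
abbrev SuperMatrix := Matrix (Fin 3) (Fin 3) (ExteriorAlgebra K M)

open Classical in
/-- The matrix of the edge of `Γ_T` that crosses the diagonal `(i, j)` near `i`. -/
def crossing (S : DecoratedTriangulation K M n) (i j : Fin n) : SuperMatrix K M :=
  if S.orient i j then 1 else matRho

theorem crossing_mul_self (S : DecoratedTriangulation K M n) (i j : Fin n) :
    S.crossing i j * S.crossing i j = 1 := by
  unfold crossing; split_ifs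
  · exact one_mul 1
  · exact matRho_mul_self

/-- A flat section of the connection over the triangles in `T`: a function on the vertices of
`Γ_T` that is compatible with the matrices of the edges. -/
structure IsFlat (S : DecoratedTriangulation K M n) (T : Set (Finset (Fin n)))
    (G : Fin n → Fin n → Fin n → SuperMatrix K M) : Prop where
  angle : ∀ i j k, {i, j, k} ∈ T → sbtw i j k → G i k j = S.angle i j k * G i j k
  side : ∀ i j k, {i, j, k} ∈ T → sbtw i j k → G k i j = matE (S.lam i k) * G i k j
  cross : ∀ i j k l, {i, j, k} ∈ T → {i, j, l} ∈ T → k ≠ l → G i j l = S.crossing i j * G i j k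

/-- A decorated triangulation with an invertible flat section. -/
structure IsDeveloped (S : DecoratedTriangulation K M n) (G : Fin n → Fin n → Fin n → SuperMatrix K M) :
    Prop where
  dec : S.IsDecorated
  nc : IsNonCrossing S.tri
  flat : S.IsFlat S.tri G
  osp : ∀ i j k, {i, j, k} ∈ S.tri → IsOSp (G i j k)

variable {S : DecoratedTriangulation K M n} {G : Fin n → Fin n → Fin n → SuperMatrix K M} {i j k l : Fin n}

theorem IsDecorated.root_pos_of_mem (hS : S.IsDecorated) {t : Finset (Fin n)} (ht : t ∈ S.tri)
    (hi : i ∈ t) (hj : j ∈ t) (hij : i ≠ j) : IsPosEven (S.root s(i, j)) :=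
  hS.root_pos i j ⟨hij, t, ht, hi, hj⟩

theorem IsDecorated.isOSp_angle (hS : S.IsDecorated) (h : {i, j, k} ∈ S.tri) (hij : i ≠ j)
    (hik : i ≠ k) (hjk : j ≠ k) : IsOSp (S.angle i j k) := by
  have p1 := hS.root_pos_of_mem h (by simp) (by simp) hij
  have p2 := hS.root_pos_of_mem h (by simp) (by simp) hik
  have p3 := hS.root_pos_of_mem h (by simp) (by simp) hjk
  refine isOSp_matA ?_ ?_
  · exact (IsPosEven.lam hjk p3).1.mul
      ((IsPosEven.lam hij p1).mul (IsPosEven.lam hik p2)).ringInverse.1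
  · exact (p3.1.mul (p1.mul p2).ringInverse.1).mul_odd (hS.mu_odd _ h)

theorem IsDecorated.isOSp_side (hS : S.IsDecorated) {t : Finset (Fin n)} (ht : t ∈ S.tri)
    (hi : i ∈ t) (hj : j ∈ t) (hij : i ≠ j) : IsOSp (matE (S.lam i j)) :=
  isOSp_matE (IsPosEven.lam hij (hS.root_pos_of_mem ht hi hj hij))

theorem IsOSp.mul_left_cancel {X Y Z : SuperMatrix K M} (hX : IsOSp X) (h : X * Y = X * Z) : Y = Z := by
  have := congrArg (superAdj X * ·) h
  simpa only [← mul_assoc, hX.adj_mul, one_mul] using this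

/-- The hexagon relation determines the value along the last side of a triangle. -/
theorem IsDecorated.side_of_hexagon (hS : S.IsDecorated) (h : {i, j, k} ∈ S.tri)
    (hs : sbtw i j k) {g₁ g₂ g₃ g₄ g₅ g₆ : SuperMatrix K M} (h1 : g₂ = S.angle i j k * g₁)
    (h2 : g₃ = matE (S.lam i k) * g₂) (h3 : g₄ = S.angle k i j * g₃)
    (h5 : g₆ = S.angle j k i * g₅) (h6 : g₁ = matE (S.lam j i) * g₆) :
    g₅ = matE (S.lam k j) * g₄ := by
  obtain ⟨n1, n2, n3⟩ := sbtw_ne hs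
  have hh := hexagon_angle n1 n2 n3 (hS.root_pos_of_mem h (by simp) (by simp) n1)
    (hS.root_pos_of_mem h (by simp) (by simp) n3) (hS.root_pos_of_mem h (by simp) (by simp) n2)
    (hS.mu_odd _ h)
  have h' : {j, k, i} ∈ S.tri := by rwa [insert_rotate]
  apply IsOSp.mul_left_cancel (hS.isOSp_angle h' n3 n1.symm n2.symm)
  apply IsOSp.mul_left_cancel (hS.isOSp_side h (by simp) (by simp) n1.symm)
  rw [← h5, ← h6, h3, h2, h1]
  have := congrArg (· * g₁) hh
  simp only [one_mul, mul_assoc] at this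
  exact this.symm

theorem IsDecorated.isQuad (hS : S.IsDecorated) (hs : sbtw i j k) (hs' : sbtw i k l)
    (h : {i, j, k} ∈ S.tri) (h' : {i, k, l} ∈ S.tri) : S.IsQuad i j k l := by
  obtain ⟨n1, n2, n3⟩ := sbtw_ne hs
  obtain ⟨-, n4, n5⟩ := sbtw_ne hs'
  exact {
    ij := n1
    ik := n2
    il := n4
    jk := n3
    jl := (sbtw_ne (sbtw_trans_split hs hs').2).2.1
    kl := n5
    pij := hS.root_pos_of_mem h (by simp) (by simp) n1
    pik := hS.root_pos_of_mem h (by simp) (by simp) n2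
    pil := hS.root_pos_of_mem h' (by simp) (by simp) n4
    pjk := hS.root_pos_of_mem h (by simp) (by simp) n3
    pkl := hS.root_pos_of_mem h' (by simp) (by simp) n5
    oσ := hS.mu_odd _ h
    oθ := hS.mu_odd _ h' }

theorem IsDecorated.orient_symm (hS : S.IsDecorated) {t : Finset (Fin n)} (ht : t ∈ S.tri)
    (hi : i ∈ t) (hj : j ∈ t) (hij : i ≠ j) : S.orient i j ↔ ¬ S.orient j i :=
  hS.orient_iff i j ⟨hij, t, ht, hi, hj⟩

theorem flip_orient_iff {x y : Fin n} : (S.flip i j k l).orient x y ↔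
    (x = j ∧ y = l) ∨ (¬ (x = l ∧ y = j) ∧
      ((((x = k ∧ y = l) ∨ (x = l ∧ y = k)) ∧ S.orient y x) ∨
        (¬ ((x = k ∧ y = l) ∨ (x = l ∧ y = k)) ∧ S.orient x y))) := by
  unfold flip
  simp only
  split_ifs <;> grind

theorem IsDecorated.flip (hK : ∀ x : K, 0 < x → IsSquare x) (hS : S.IsDecorated)
    (nc : IsNonCrossing S.tri) (hs : sbtw i j k) (hs' : sbtw i k l)
    (h : {i, j, k} ∈ S.tri) (h' : {i, k, l} ∈ S.tri) : (S.flip i j k l).IsDecorated := by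
  have Q := hS.isQuad hs hs' h h'
  have edge : ∀ {x y : Fin n}, (S.flip i j k l).IsEdge x y →
      S.IsEdge x y ∨ (x = j ∧ y = l) ∨ (x = l ∧ y = j) := by
    rintro x y ⟨hxy, t, ht, hx, hy⟩
    rcases nc.edge_flip hs hs' h h' ht hx hy hxy with ⟨⟨u, hu, hxu, hyu⟩, -⟩ | h | h
    · exact Or.inl ⟨hxy, u, hu, hxu, hyu⟩
    · exact Or.inr (Or.inl h)
    · exact Or.inr (Or.inr h)
  have hjl := Q.jl
  constructor
  · intro x y hxy
    rw [flip_orient_iff, flip_orient_iff]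
    have hne := hxy.1
    rcases edge hxy with e | ⟨rfl, rfl⟩ | ⟨rfl, rfl⟩
    · have e' : S.IsEdge y x := ⟨e.1.symm, by obtain ⟨t, a, b, c⟩ := e.2; exact ⟨t, a, c, b⟩⟩
      have o1 := hS.orient_iff _ _ e
      have o2 := hS.orient_iff _ _ e'
      by_cases c1 : x = j ∧ y = l <;> by_cases c2 : x = l ∧ y = j <;>
        by_cases c3 : x = k ∧ y = l <;> by_cases c4 : x = l ∧ y = k <;> grind
    · grind
    · grind
  · intro x y hxy
    by_cases e : s(x, y) = s(j, l)
    · rw [e]; exact (Q.flip_root hK).1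
    · rw [flip_root_of_ne e]
      rcases edge hxy with e' | ⟨rfl, rfl⟩ | ⟨rfl, rfl⟩
      · exact hS.root_pos _ _ e'
      · exact absurd rfl e
      · exact absurd Sym2.eq_swap e
  · intro t ht
    have hinv := (Q.pik.mul (Q.flip_root hK).1).ringInverse
    by_cases t1 : t = {i, j, l}
    · rw [t1, flip_mu_left]
      exact (((Q.oθ.mul_even (Q.pkl.mul Q.pij).1)).add
        (Q.oσ.mul_even (Q.pil.mul Q.pjk).1)).mul_even hinv.1
    · by_cases t2 : t = {j, k, l}
      · rw [t2, flip_mu_right Q.set_ne]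
        exact (((Q.oσ.mul_even (Q.pkl.mul Q.pij).1)).sub
          (Q.oθ.mul_even (Q.pil.mul Q.pjk).1)).mul_even hinv.1
      · rw [flip_mu_of_ne t1 t2]
        rcases mem_flipTri.1 ht with ⟨h1, -, -⟩ | h1 | h1
        · exact hS.mu_odd t h1
        · exact absurd h1 t2
        · exact absurd h1 t1

end DecoratedTriangulation

end SuperTeich

end

/-! ## The flat section after a flip -/

noncomputable section

namespace SuperTeich

open Matrix

namespace DecoratedTriangulation

variable {K M : Type*} [Field K] [LinearOrder K] [IsStrictOrderedRing K] [AddCommGroup M]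
  [Module K M] {n : ℕ}

local notation "Λ" => ExteriorAlgebra K M

/-- The flat section after a flip, on the triangle `{i, j, l}` at the tail. -/
def flipTail (S : DecoratedTriangulation K M n) (G : Fin n → Fin n → Fin n → SuperMatrix K M)
    (i j k l x y : Fin n) : SuperMatrix K M :=
  -- Old values are kept on the two old sides. At the two ends of the new diagonal the value is the
  -- one imposed by the angle relation, with `superAdj` as the inverse.
  if x = i then G x y k
  else if x = j then
    if y = i then G j i k else superAdj ((S.flip i j k l).angle j l i) * G j i k
  else if y = i then G l i k else (S.flip i j k l).angle l i j * G l i k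

/-- The flat section after a flip, on the triangle `{j, k, l}` at the head. -/
def flipHead (S : DecoratedTriangulation K M n) (G : Fin n → Fin n → Fin n → SuperMatrix K M)
    (i j k l x y : Fin n) : SuperMatrix K M :=
  -- Inside the quadrilateral the values on the side `(k, l)` are multiplied by `matRho`, so that
  -- the values beyond that side can stay unchanged although its orientation is reversed.
  if x = k then if y = j then G k j i else matRho * G k l i
  else if x = j then
    if y = k then G j k i else (S.flip i j k l).angle j k l * G j k i
  else if y = k then matRho * G l k i
    else superAdj ((S.flip i j k l).angle l j k) * (matRho * G l k i)

/-- The flat section after a flip. -/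
def flipSection (S : DecoratedTriangulation K M n) (G : Fin n → Fin n → Fin n → SuperMatrix K M)
    (i j k l x y z : Fin n) : SuperMatrix K M :=
  if ({x, y, z} : Finset (Fin n)) = {i, j, l} then S.flipTail G i j k l x y
  else if ({x, y, z} : Finset (Fin n)) = {j, k, l} then S.flipHead G i j k l x y
  else G x y z

variable {S : DecoratedTriangulation K M n} {G : Fin n → Fin n → Fin n → SuperMatrix K M} {i j k l : Fin n}

theorem flipSection_tail {x y z : Fin n} (h : ({x, y, z} : Finset (Fin n)) = {i, j, l}) :
    S.flipSection G i j k l x y z = S.flipTail G i j k l x y := by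
  rw [flipSection, if_pos h]

theorem flipSection_head (Q : S.IsQuad i j k l) {x y z : Fin n}
    (h : ({x, y, z} : Finset (Fin n)) = {j, k, l}) :
    S.flipSection G i j k l x y z = S.flipHead G i j k l x y := by
  rw [flipSection, if_neg (by rw [h]; exact Q.set_ne), if_pos h]

theorem flipSection_of_ne {x y z : Fin n} (h : ({x, y, z} : Finset (Fin n)) ≠ {i, j, l})
    (h2 : ({x, y, z} : Finset (Fin n)) ≠ {j, k, l}) :
    S.flipSection G i j k l x y z = G x y z := by
  rw [flipSection, if_neg h, if_neg h2]

/-- A quadrilateral of a developed triangulation that is about to be flipped. -/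
structure IsFlippable (S : DecoratedTriangulation K M n) (G : Fin n → Fin n → Fin n → SuperMatrix K M)
    (i j k l : Fin n) : Prop extends S.IsDeveloped G where
  s₁ : sbtw i j k
  s₂ : sbtw i k l
  m₁ : {i, j, k} ∈ S.tri
  m₂ : {i, k, l} ∈ S.tri
  or : S.orient i k

theorem IsFlippable.isQuad (F : S.IsFlippable G i j k l) : S.IsQuad i j k l :=
  F.dec.isQuad F.s₁ F.s₂ F.m₁ F.m₂

/-- The old section in terms of the new angles. The first two equations combine two old angles
through the crossing of the old diagonal, which carries `1` near `i` and `ρ` near `k`; the last two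
express one old angle as two new ones. -/
theorem IsFlippable.values (hK : ∀ x : K, 0 < x → IsSquare x) (F : S.IsFlippable G i j k l) :
    G i l k = (S.flip i j k l).angle i j l * G i j k ∧
    G k j i = (S.flip i j k l).angle k l j * (matRho * G k l i) ∧
    G j i k = (S.flip i j k l).angle j l i * ((S.flip i j k l).angle j k l * G j k i) ∧
    G l k i = matRho * ((S.flip i j k l).angle l j k *
      (matRho * ((S.flip i j k l).angle l i j * G l i k))) := by
  have Q := F.isQuad
  have e1 : ({i, k, j} : Finset (Fin n)) = {i, j, k} := insert_swap i j k
  have e2 : ({k, i, j} : Finset (Fin n)) = {i, j, k} := (insert_rotate k i j).symm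
  have e3 : ({k, i, l} : Finset (Fin n)) = {i, k, l} := Finset.insert_comm _ _ _
  have e4 : ({j, k, i} : Finset (Fin n)) = {i, j, k} := insert_rotate i j k
  have e5 : ({k, l, i} : Finset (Fin n)) = {i, k, l} := insert_rotate i k l
  have e6 : ({l, i, k} : Finset (Fin n)) = {i, k, l} := (insert_rotate l i k).symm
  have oki : ¬ S.orient k i := (F.dec.orient_symm F.m₁ (by simp) (by simp) Q.ik).1 F.or
  have c1 := F.flat.cross i k j l (by rw [e1]; exact F.m₁) F.m₂ Q.jl
  have c2 := F.flat.cross k i l j (by rw [e3]; exact F.m₂) (by rw [e2]; exact F.m₁) Q.jl.symm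
  rw [crossing, if_pos F.or, one_mul] at c1
  rw [crossing, if_neg oki] at c2
  refine ⟨?_, ?_, ?_, ?_⟩
  · rw [Q.angle_flip_tail hK, F.flat.angle i k l F.m₂ F.s₂, c1, F.flat.angle i j k F.m₁ F.s₁,
      mul_assoc]
  · rw [Q.angle_flip_head hK, F.flat.angle k i j (by rw [e2]; exact F.m₁) F.s₁.cyclic_right, c2,
      F.flat.angle k l i (by rw [e5]; exact F.m₂) F.s₂.cyclic_left]
    simp only [mul_assoc, matRho_mul_mul_self]
  · rw [← mul_assoc, ← Q.angle_flip_left hK]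
    exact F.flat.angle j k i (by rw [e4]; exact F.m₁) F.s₁.cyclic_left
  · have := F.flat.angle l i k (by rw [e6]; exact F.m₂) F.s₂.cyclic_right
    rw [this, Q.angle_flip_right hK]
    simp only [mul_assoc]

theorem IsFlippable.isDecorated_flip (hK : ∀ x : K, 0 < x → IsSquare x)
    (F : S.IsFlippable G i j k l) : (S.flip i j k l).IsDecorated :=
  F.dec.flip hK F.nc F.s₁ F.s₂ F.m₁ F.m₂

theorem flip_tri : (S.flip i j k l).tri = flipTri S.tri i j k l := rfl

theorem flip_angle_of_mem (F : S.IsFlippable G i j k l) {x y z : Fin n} (h : {x, y, z} ∈ S.tri)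
    (h1 : ({x, y, z} : Finset (Fin n)) ≠ {i, j, l})
    (h2 : ({x, y, z} : Finset (Fin n)) ≠ {j, k, l}) :
    (S.flip i j k l).angle x y z = S.angle x y z ∧
      ∀ a ∈ ({x, y, z} : Finset (Fin n)), ∀ b ∈ ({x, y, z} : Finset (Fin n)),
        (S.flip i j k l).lam a b = S.lam a b := by
  have hne : ∀ a ∈ ({x, y, z} : Finset (Fin n)), ∀ b ∈ ({x, y, z} : Finset (Fin n)),
      s(a, b) ≠ s(j, l) := by
    intro a ha b hb e
    have := F.nc.not_mem_flip F.s₁ F.s₂ F.m₁ h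
    rcases Sym2.eq_iff.1 e with ⟨rfl, rfl⟩ | ⟨rfl, rfl⟩
    · exact this ha hb
    · exact this hb ha
  have hr : ∀ a ∈ ({x, y, z} : Finset (Fin n)), ∀ b ∈ ({x, y, z} : Finset (Fin n)),
      (S.flip i j k l).root s(a, b) = S.root s(a, b) :=
    fun a ha b hb => flip_root_of_ne (hne a ha b hb)
  have hl : ∀ a ∈ ({x, y, z} : Finset (Fin n)), ∀ b ∈ ({x, y, z} : Finset (Fin n)),
        (S.flip i j k l).lam a b = S.lam a b := by
    intro a ha b hb
    unfold lam; rw [hr a ha b hb]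
  refine ⟨?_, hl⟩
  unfold angle hLength muUp
  rw [hl y (by simp) z (by simp), hl x (by simp) y (by simp), hl x (by simp) z (by simp),
    hr y (by simp) z (by simp), hr x (by simp) y (by simp), hr x (by simp) z (by simp),
    flip_mu_of_ne h1 h2]

section Cases

theorem flipTail_values (F : S.IsFlippable G i j k l) :
    S.flipTail G i j k l i j = G i j k ∧ S.flipTail G i j k l i l = G i l k ∧
    S.flipTail G i j k l j i = G j i k ∧ S.flipTail G i j k l l i = G l i k ∧
    S.flipTail G i j k l j l = superAdj ((S.flip i j k l).angle j l i) * G j i k ∧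
    S.flipTail G i j k l l j = (S.flip i j k l).angle l i j * G l i k := by
  have Q := F.isQuad
  have q1 := Q.ij.symm
  have q2 := Q.il.symm
  have q3 := Q.jl.symm
  refine ⟨?_, ?_, ?_, ?_, ?_, ?_⟩ <;> simp [flipTail, *]

theorem flipHead_values (F : S.IsFlippable G i j k l) :
    S.flipHead G i j k l k j = G k j i ∧ S.flipHead G i j k l k l = matRho * G k l i ∧
    S.flipHead G i j k l j k = G j k i ∧ S.flipHead G i j k l l k = matRho * G l k i ∧
    S.flipHead G i j k l j l = (S.flip i j k l).angle j k l * G j k i ∧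
    S.flipHead G i j k l l j
      = superAdj ((S.flip i j k l).angle l j k) * (matRho * G l k i) := by
  have Q := F.isQuad
  have q1 := Q.jk
  have q2 := Q.kl.symm
  have q3 := Q.jl.symm
  refine ⟨?_, ?_, ?_, ?_, ?_, ?_⟩ <;> simp [flipHead, *]

/-- The angle relations and the relations along the two old sides follow from the choice of values
and the merged angle at `i`. The relation along the new diagonal is the sixth edge of the hexagon
and follows from the other five. -/
theorem IsFlippable.flat_tail (hK : ∀ x : K, 0 < x → IsSquare x) (F : S.IsFlippable G i j k l) :
    (S.flip i j k l).IsFlat {{i, j, l}} (S.flipSection G i j k l) := by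
  have Q := F.isQuad
  have split := sbtw_trans_split F.s₁ F.s₂
  obtain ⟨v1, v2, v3, v4, v5, v6⟩ := flipTail_values F
  have hD := F.isDecorated_flip hK
  have hmem : {i, j, l} ∈ (S.flip i j k l).tri := mem_flipTri.2 (Or.inr (Or.inr rfl))
  have e1 : ({i, k, j} : Finset (Fin n)) = {i, j, k} := insert_swap i j k
  have e4 : ({j, k, i} : Finset (Fin n)) = {i, j, k} := insert_rotate i j k
  have lam1 : (S.flip i j k l).lam i l = S.lam i l := by
    unfold lam; rw [flip_root_of_ne (by simp [Q.ij, Q.il])]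
  have lam2 : (S.flip i j k l).lam j i = S.lam j i := by
    unfold lam; rw [flip_root_of_ne (by simp [Q.ij, Q.il])]
  have A1 : G i l k = (S.flip i j k l).angle i j l * G i j k := (F.values hK).1
  have A2 : S.flipTail G i j k l j i
      = (S.flip i j k l).angle j l i * S.flipTail G i j k l j l := by
    rw [v3, v5, ← mul_assoc, (hD.isOSp_angle (by rw [insert_rotate]; exact hmem) Q.jl Q.ij.symm
      Q.il.symm).mul_adj, one_mul]
  have B1 : G l i k = matE ((S.flip i j k l).lam i l) * G i l k := by
    rw [lam1]; exact F.flat.side i k l F.m₂ F.s₂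
  have B2 : G i j k = matE ((S.flip i j k l).lam j i) * G j i k := by
    rw [lam2]; exact F.flat.side j k i (by rw [e4]; exact F.m₁) F.s₁.cyclic_left
  have B3 : S.flipTail G i j k l j l
      = matE ((S.flip i j k l).lam l j) * S.flipTail G i j k l l j := by
    refine hD.side_of_hexagon hmem split.1 A1 B1 v6 A2 ?_
    rw [v3]; exact B2
  constructor
  · intro x y z h hs
    rw [flipSection_tail h, flipSection_tail ((insert_swap x y z).trans h)]
    rcases triple_eq_of_sbtw split.1 hs h with ⟨rfl, rfl, rfl⟩ | ⟨rfl, rfl, rfl⟩ | ⟨rfl, rfl, rfl⟩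
    · rw [v1, v2]; exact A1
    · exact A2
    · rw [v4]; exact v6
  · intro x y z h hs
    rw [flipSection_tail ((insert_rotate z x y).symm.trans h),
      flipSection_tail ((insert_swap x y z).trans h)]
    rcases triple_eq_of_sbtw split.1 hs h with ⟨rfl, rfl, rfl⟩ | ⟨rfl, rfl, rfl⟩ | ⟨rfl, rfl, rfl⟩
    · rw [v4, v2]; exact B1
    · rw [v1, v3]; exact B2
    · exact B3
  · intro x y z w h h' hzw
    have h1 := F.nc.flip F.s₁ F.s₂ F.m₁ F.m₂
    have : ({x, y, z} : Finset (Fin n)) = {x, y, w} := Eq.trans h (Eq.symm h')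
    have hz : z ∈ ({x, y, w} : Finset (Fin n)) := by rw [← this]; simp
    have hne := h1.ne (x := x) (y := y) (z := z) (by rw [h]; exact hmem)
    simp only [Finset.mem_insert, Finset.mem_singleton] at hz
    rcases hz with rfl | rfl | rfl
    · exact absurd rfl hne.2.1
    · exact absurd rfl hne.2.2
    · exact absurd rfl hzw

theorem IsFlippable.flat_head (hK : ∀ x : K, 0 < x → IsSquare x) (F : S.IsFlippable G i j k l) :
    (S.flip i j k l).IsFlat {{j, k, l}} (S.flipSection G i j k l) := by
  have Q := F.isQuad
  have split := sbtw_trans_split F.s₁ F.s₂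
  obtain ⟨v1, v2, v3, v4, v5, v6⟩ := flipHead_values F
  have hD := F.isDecorated_flip hK
  have hmem : {j, k, l} ∈ (S.flip i j k l).tri := mem_flipTri.2 (Or.inr (Or.inl rfl))
  have e2 : ({k, i, j} : Finset (Fin n)) = {i, j, k} := (insert_rotate k i j).symm
  have e6 : ({l, i, k} : Finset (Fin n)) = {i, k, l} := (insert_rotate l i k).symm
  have lam1 : (S.flip i j k l).lam k j = S.lam k j := by
    unfold lam; rw [flip_root_of_ne (by simp [Q.jk.symm, Q.kl])]
  have lam2 : (S.flip i j k l).lam l k = S.lam l k := by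
    unfold lam; rw [flip_root_of_ne (by simp [Q.jk.symm, Q.kl, Q.jl.symm])]
  have A1 : S.flipHead G i j k l k j
      = (S.flip i j k l).angle k l j * S.flipHead G i j k l k l := by
    rw [v1, v2]; exact (F.values hK).2.1
  have A2 : S.flipHead G i j k l l k
      = (S.flip i j k l).angle l j k * S.flipHead G i j k l l j := by
    rw [v4, v6, ← mul_assoc, (hD.isOSp_angle (by rw [← insert_rotate]; exact hmem)
      Q.jl.symm Q.kl.symm Q.jk).mul_adj, one_mul]
  have A3 : S.flipHead G i j k l j l
      = (S.flip i j k l).angle j k l * S.flipHead G i j k l j k := by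
    rw [v5, v3]
  have B1 : S.flipHead G i j k l j k
      = matE ((S.flip i j k l).lam k j) * S.flipHead G i j k l k j := by
    rw [lam1, v3, v1]
    exact F.flat.side k i j (by rw [e2]; exact F.m₁) F.s₁.cyclic_right
  have B2 : S.flipHead G i j k l k l
      = matE ((S.flip i j k l).lam l k) * S.flipHead G i j k l l k := by
    rw [lam2, v2, v4, F.flat.side l i k (by rw [e6]; exact F.m₂) F.s₂.cyclic_right,
      ← mul_assoc, matRho_mul_matE, mul_assoc]
  have hmem' : {k, l, j} ∈ (S.flip i j k l).tri := by rw [insert_rotate]; exact hmem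
  have B3 : S.flipHead G i j k l l j
      = matE ((S.flip i j k l).lam j l) * S.flipHead G i j k l j l :=
    hD.side_of_hexagon hmem' split.2.cyclic_left A1 B1 A3 A2 B2
  constructor
  · intro x y z h hs
    rw [flipSection_head Q h, flipSection_head Q ((insert_swap x y z).trans h)]
    rcases triple_eq_of_sbtw split.2 hs h with ⟨rfl, rfl, rfl⟩ | ⟨rfl, rfl, rfl⟩ | ⟨rfl, rfl, rfl⟩
    · exact A3
    · exact A1
    · exact A2
  · intro x y z h hs
    rw [flipSection_head Q ((insert_rotate z x y).symm.trans h),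
      flipSection_head Q ((insert_swap x y z).trans h)]
    rcases triple_eq_of_sbtw split.2 hs h with ⟨rfl, rfl, rfl⟩ | ⟨rfl, rfl, rfl⟩ | ⟨rfl, rfl, rfl⟩
    · exact B3
    · exact B1
    · exact B2
  · intro x y z w h h' hzw
    have h1 := F.nc.flip F.s₁ F.s₂ F.m₁ F.m₂
    have : ({x, y, z} : Finset (Fin n)) = {x, y, w} := Eq.trans h (Eq.symm h')
    have hz : z ∈ ({x, y, w} : Finset (Fin n)) := by rw [← this]; simp
    have hne := h1.ne (x := x) (y := y) (z := z) (by rw [h]; exact hmem)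
    simp only [Finset.mem_insert, Finset.mem_singleton] at hz
    rcases hz with rfl | rfl | rfl
    · exact absurd rfl hne.2.1
    · exact absurd rfl hne.2.2
    · exact absurd rfl hzw

end Cases

end DecoratedTriangulation

end SuperTeich

end

/-! ## Flips of developed triangulations -/

noncomputable section

namespace SuperTeich

open Matrix

namespace DecoratedTriangulation

variable {K M : Type*} [Field K] [LinearOrder K] [IsStrictOrderedRing K] [AddCommGroup M]
  [Module K M] {n : ℕ}

local notation "Λ" => ExteriorAlgebra K M

variable {S : DecoratedTriangulation K M n} {G : Fin n → Fin n → Fin n → SuperMatrix K M}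
  {i j k l : Fin n}

/-- The sign that accounts for the reversal of the side `(k, l)`. -/
def sideSign (k l x y : Fin n) : SuperMatrix K M :=
  if (x = k ∧ y = l) ∨ (x = l ∧ y = k) then matRho else 1

theorem sideSign_mul_self (k l x y : Fin n) :
    (sideSign k l x y : SuperMatrix K M) * sideSign k l x y = 1 := by
  unfold sideSign; split_ifs
  · exact matRho_mul_self
  · exact one_mul 1

theorem crossing_comm_sideSign (S : DecoratedTriangulation K M n) (k l x y a b : Fin n) :
    S.crossing a b * sideSign k l x y = sideSign k l x y * S.crossing a b := by
  unfold crossing sideSign; split_ifs <;> simp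

theorem IsFlippable.crossing_flip (F : S.IsFlippable G i j k l) {x y : Fin n}
    {t : Finset (Fin n)} (ht : t ∈ S.tri) (hx : x ∈ t) (hy : y ∈ t) (hxy : x ≠ y) :
    (S.flip i j k l).crossing x y = S.crossing x y * sideSign k l x y := by
  have h1 := F.nc.not_mem_flip F.s₁ F.s₂ F.m₁ ht
  have n1 : ¬ (x = j ∧ y = l) := by rintro ⟨rfl, rfl⟩; exact h1 hx hy
  have n2 : ¬ (x = l ∧ y = j) := by rintro ⟨rfl, rfl⟩; exact h1 hy hx
  have o := F.dec.orient_symm ht hx hy hxy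
  have key := flip_orient_iff (S := S) (i := i) (j := j) (k := k) (l := l) (x := x) (y := y)
  unfold crossing sideSign
  by_cases c : (x = k ∧ y = l) ∨ (x = l ∧ y = k)
  · have : (S.flip i j k l).orient x y ↔ ¬ S.orient x y := by grind
    by_cases d : S.orient x y <;> simp [this, d, c, matRho_mul_self]
  · have : (S.flip i j k l).orient x y ↔ S.orient x y := by grind
    by_cases d : S.orient x y <;> simp [this, d, c]

/-- An old side of the quadrilateral belongs to an old triangle with another apex `u`; this relates
the new section there to the old one, which reduces crossings of that side to the old flatness. -/
theorem IsFlippable.new_value (F : S.IsFlippable G i j k l) {x y z : Fin n}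
    (h : ({x, y, z} : Finset (Fin n)) = {j, k, l} ∨ ({x, y, z} : Finset (Fin n)) = {i, j, l})
    (h1 : ¬ (x = j ∧ y = l)) (h2 : ¬ (x = l ∧ y = j)) :
    ∃ u, (({x, y, u} : Finset (Fin n)) = {i, j, k} ∨ ({x, y, u} : Finset (Fin n)) = {i, k, l}) ∧
      S.flipSection G i j k l x y z = sideSign k l x y * G x y u := by
  have Q := F.isQuad
  have split := sbtw_trans_split F.s₁ F.s₂
  obtain ⟨v1, v2, v3, v4, -⟩ := flipTail_values F
  obtain ⟨w1, w2, w3, w4, -⟩ := flipHead_values F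
  have Qij := Q.ij
  have Qil := Q.il
  have Qik := Q.ik
  have Qjk := Q.jk
  have Qkl := Q.kl
  have Qjl := Q.jl
  rcases h with h | h
  · rw [flipSection_head Q h]
    rcases triple_eq split.2 h with e | e | e | e | e | e <;> obtain ⟨rfl, rfl, rfl⟩ := e
    · refine ⟨i, Or.inl (insert_rotate _ _ _), ?_⟩
      rw [w3, sideSign, if_neg (by grind), one_mul]
    · refine ⟨i, Or.inr (insert_rotate _ _ _), ?_⟩
      rw [w2, sideSign, if_pos (by grind)]
    · exact absurd ⟨rfl, rfl⟩ h2
    · exact absurd ⟨rfl, rfl⟩ h1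
    · refine ⟨i, Or.inl (by ext; simp; tauto), ?_⟩
      rw [w1, sideSign, if_neg (by grind), one_mul]
    · refine ⟨i, Or.inr (by ext; simp; tauto), ?_⟩
      rw [w4, sideSign, if_pos (by grind)]
  · rw [flipSection_tail h]
    rcases triple_eq split.1 h with e | e | e | e | e | e <;> obtain ⟨rfl, rfl, rfl⟩ := e
    · refine ⟨k, Or.inl rfl, ?_⟩
      rw [v1, sideSign, if_neg (by grind), one_mul]
    · exact absurd ⟨rfl, rfl⟩ h1
    · refine ⟨k, Or.inr (by ext; simp; tauto), ?_⟩
      rw [v4, sideSign, if_neg (by grind), one_mul]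
    · refine ⟨k, Or.inr (by ext; simp; tauto), ?_⟩
      rw [v2, sideSign, if_neg (by grind), one_mul]
    · refine ⟨k, Or.inl (by ext; simp; tauto), ?_⟩
      rw [v3, sideSign, if_neg (by grind), one_mul]
    · exact absurd ⟨rfl, rfl⟩ h2

theorem IsFlippable.old_ne (F : S.IsFlippable G i j k l) {t : Finset (Fin n)} (ht : t ∈ S.tri) :
    t ≠ {i, j, l} ∧ t ≠ {j, k, l} := by
  have h := F.nc.not_mem_flip F.s₁ F.s₂ F.m₁ ht
  constructor
  · rintro rfl; exact h (by simp) (by simp)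
  · rintro rfl; exact h (by simp) (by simp)

/-- The values at the two ends of the new diagonal were defined independently in its two triangles.
That they match is the content of the splitting of the old angles at `j` and `l`. -/
theorem IsFlippable.cross_new (hK : ∀ x : K, 0 < x → IsSquare x) (F : S.IsFlippable G i j k l) :
    S.flipSection G i j k l j l i = S.flipSection G i j k l j l k ∧
    S.flipSection G i j k l l j i = matRho * S.flipSection G i j k l l j k := by
  have Q := F.isQuad
  obtain ⟨-, -, -, -, v5, v6⟩ := flipTail_values F
  obtain ⟨-, -, -, -, w5, w6⟩ := flipHead_values F
  have hD := F.isDecorated_flip hK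
  obtain ⟨-, -, a1, a2⟩ := F.values hK
  rw [flipSection_tail (insert_rotate _ _ _), flipSection_head Q (insert_swap _ _ _),
    flipSection_tail (by ext; simp; tauto), flipSection_head Q (insert_rotate _ _ _).symm,
    v5, v6, w5, w6]
  have m1 : {j, l, i} ∈ (S.flip i j k l).tri :=
    mem_flipTri.2 (Or.inr (Or.inr (insert_rotate _ _ _)))
  have m2 : {l, j, k} ∈ (S.flip i j k l).tri :=
    mem_flipTri.2 (Or.inr (Or.inl (insert_rotate _ _ _).symm))
  have o1 := hD.isOSp_angle m1 Q.jl Q.ij.symm Q.il.symm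
  have o2 := hD.isOSp_angle m2 Q.jl.symm Q.kl.symm Q.jk
  constructor
  · rw [a1, ← mul_assoc, o1.adj_mul, one_mul]
  · rw [a2, matRho_mul_mul_self, ← mul_assoc (superAdj _), o2.adj_mul, one_mul,
      matRho_mul_mul_self]

theorem third_unique {x y a b : Fin n} (e : ({x, y, a} : Finset (Fin n)) = {x, y, b})
    (h1 : x ≠ a) (h2 : y ≠ a) : a = b := by
  have : a ∈ ({x, y, b} : Finset (Fin n)) := by rw [← e]; simp
  simp only [Finset.mem_insert, Finset.mem_singleton] at this
  grind

theorem IsQuad.new_disjoint (Q : S.IsQuad i j k l) {x y a b : Fin n} (hxy : x ≠ y)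
    (e1 : ¬ (x = j ∧ y = l)) (e2 : ¬ (x = l ∧ y = j))
    (ha : ({x, y, a} : Finset (Fin n)) = {j, k, l})
    (hb : ({x, y, b} : Finset (Fin n)) = {i, j, l}) : False := by
  have x1 : x ∈ ({j, k, l} : Finset (Fin n)) := by rw [← ha]; simp
  have y1 : y ∈ ({j, k, l} : Finset (Fin n)) := by rw [← ha]; simp
  have x2 : x ∈ ({i, j, l} : Finset (Fin n)) := by rw [← hb]; simp
  have y2 : y ∈ ({i, j, l} : Finset (Fin n)) := by rw [← hb]; simp
  simp only [Finset.mem_insert, Finset.mem_singleton] at x1 y1 x2 y2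
  obtain ⟨q1, q2, q3, q4, q5, q6⟩ := Q
  grind

theorem IsQuad.crossing_flip_new (Q : S.IsQuad i j k l) :
    (S.flip i j k l).crossing j l = 1 ∧ (S.flip i j k l).crossing l j = matRho := by
  constructor
  · rw [crossing, if_pos]; exact flip_orient_iff.2 (Or.inl ⟨rfl, rfl⟩)
  · rw [crossing, if_neg]; rw [flip_orient_iff]; have := Q.jl; grind

-- Away from the new diagonal two triangles sharing a side cannot both be new. If one of them is
-- new, `sideSign` occurs both in its value and in the changed crossing matrix, and the two
-- occurrences cancel.
set_option maxHeartbeats 1000000 in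
theorem IsFlippable.cross_flip (hK : ∀ x : K, 0 < x → IsSquare x) (F : S.IsFlippable G i j k l)
    {x y z w : Fin n} (h : {x, y, z} ∈ (S.flip i j k l).tri)
    (h' : {x, y, w} ∈ (S.flip i j k l).tri) (hzw : z ≠ w) :
    S.flipSection G i j k l x y w
      = (S.flip i j k l).crossing x y * S.flipSection G i j k l x y z := by
  have Q := F.isQuad
  have ncF := F.nc.flip F.s₁ F.s₂ F.m₁ F.m₂
  have ne1 := ncF.ne h
  have ne2 := ncF.ne h'
  obtain ⟨hor, hor2⟩ := Q.crossing_flip_new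
  obtain ⟨c1, c2⟩ := F.cross_new hK
  have m3 : ({j, l, k} : Finset (Fin n)) ∈ (S.flip i j k l).tri :=
    mem_flipTri.2 (Or.inr (Or.inl (insert_swap _ _ _)))
  have m4 : ({j, l, i} : Finset (Fin n)) ∈ (S.flip i j k l).tri :=
    mem_flipTri.2 (Or.inr (Or.inr (insert_rotate _ _ _)))
  by_cases e1 : x = j ∧ y = l
  · obtain ⟨rfl, rfl⟩ := e1
    have hz := ncF.third_eq m3 m4 h Q.ik.symm
    have hw := ncF.third_eq m3 m4 h' Q.ik.symm
    rw [hor, one_mul]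
    rcases hz with rfl | rfl <;> rcases hw with rfl | rfl
    · exact absurd rfl hzw
    · exact c1
    · exact c1.symm
    · exact absurd rfl hzw
  by_cases e2 : x = l ∧ y = j
  · obtain ⟨rfl, rfl⟩ := e2
    have hz := ncF.third_eq m3 m4 (by rw [Finset.insert_comm]; exact h) Q.ik.symm
    have hw := ncF.third_eq m3 m4 (by rw [Finset.insert_comm]; exact h') Q.ik.symm
    rw [hor2]
    rcases hz with rfl | rfl <;> rcases hw with rfl | rfl
    · exact absurd rfl hzw
    · exact c2
    · rw [c2, matRho_mul_mul_self]
    · exact absurd rfl hzw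
  rcases mem_flipTri.1 h with ⟨h1, p1, p2⟩ | h1 <;>
    rcases mem_flipTri.1 h' with ⟨h2, q1, q2⟩ | h2
  · have n1 := F.old_ne h1
    have n2 := F.old_ne h2
    rw [flipSection_of_ne n1.1 n1.2, flipSection_of_ne n2.1 n2.2,
      F.crossing_flip h1 (by simp) (by simp) ne1.1, sideSign, if_neg, mul_one]
    · exact F.flat.cross x y z w h1 h2 hzw
    · intro hc
      have e : ({x, y, i} : Finset (Fin n)) = {i, k, l} := by
        rcases hc with ⟨rfl, rfl⟩ | ⟨rfl, rfl⟩
        · exact insert_rotate _ _ _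
        · ext; simp; tauto
      rcases F.nc.third_eq h1 h2 (by rw [e]; exact F.m₂) hzw with rfl | rfl
      · exact p2 e
      · exact q2 e
  · have n1 := F.old_ne h1
    obtain ⟨u, hu, hv⟩ := F.new_value h2 e1 e2
    have hum : {x, y, u} ∈ S.tri := by
      rcases hu with hu | hu <;> rw [hu]
      exacts [F.m₁, F.m₂]
    have huz : z ≠ u := by
      rintro rfl
      rcases hu with hu | hu
      · exact p1 hu
      · exact p2 hu
    rw [hv, flipSection_of_ne n1.1 n1.2, F.crossing_flip h1 (by simp) (by simp) ne1.1,
      crossing_comm_sideSign, mul_assoc, F.flat.cross x y z u h1 hum huz]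
  · have n2 := F.old_ne h2
    obtain ⟨u, hu, hv⟩ := F.new_value h1 e1 e2
    have hum : {x, y, u} ∈ S.tri := by
      rcases hu with hu | hu <;> rw [hu]
      exacts [F.m₁, F.m₂]
    have huz : u ≠ w := by
      rintro rfl
      rcases hu with hu | hu
      · exact q1 hu
      · exact q2 hu
    rw [hv, flipSection_of_ne n2.1 n2.2, F.crossing_flip h2 (by simp) (by simp) ne1.1,
      mul_assoc, ← mul_assoc (sideSign _ _ _ _), sideSign_mul_self, one_mul,
      F.flat.cross x y u w hum h2 huz]
  · exfalso
    rcases h1 with h1 | h1 <;> rcases h2 with h2 | h2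
    · exact hzw (third_unique (h1.trans h2.symm) ne1.2.1 ne1.2.2)
    · exact Q.new_disjoint ne1.1 e1 e2 h1 h2
    · exact Q.new_disjoint ne1.1 e1 e2 h2 h1
    · exact hzw (third_unique (h1.trans h2.symm) ne1.2.1 ne1.2.2)

theorem IsFlippable.flat_flip (hK : ∀ x : K, 0 < x → IsSquare x) (F : S.IsFlippable G i j k l) :
    (S.flip i j k l).IsFlat (S.flip i j k l).tri (S.flipSection G i j k l) := by
  have Q := F.isQuad
  have ft := F.flat_tail hK
  have fh := F.flat_head hK
  have ncF := F.nc.flip F.s₁ F.s₂ F.m₁ F.m₂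
  constructor
  · intro x y z h hs
    rcases mem_flipTri.1 h with ⟨h1, -, -⟩ | h1 | h1
    · have n1 := F.old_ne h1
      have n2 := F.old_ne (t := {x, z, y}) (by rw [insert_swap]; exact h1)
      rw [flipSection_of_ne n1.1 n1.2, flipSection_of_ne n2.1 n2.2,
        (flip_angle_of_mem F h1 n1.1 n1.2).1]
      exact F.flat.angle x y z h1 hs
    · exact fh.angle x y z h1 hs
    · exact ft.angle x y z h1 hs
  · intro x y z h hs
    rcases mem_flipTri.1 h with ⟨h1, -, -⟩ | h1 | h1
    · have n1 := F.old_ne h1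
      have n2 := F.old_ne (t := {x, z, y}) (by rw [insert_swap]; exact h1)
      have n3 := F.old_ne (t := {z, x, y}) (by rw [← insert_rotate]; exact h1)
      rw [flipSection_of_ne n2.1 n2.2, flipSection_of_ne n3.1 n3.2,
        (flip_angle_of_mem F h1 n1.1 n1.2).2 x (by simp) z (by simp)]
      exact F.flat.side x y z h1 hs
    · exact fh.side x y z h1 hs
    · exact ft.side x y z h1 hs
  · intro x y z w h h' hzw
    exact F.cross_flip hK h h' hzw

/-- A flip of a developed triangulation is developed. -/
theorem IsFlippable.isDeveloped_flip (hK : ∀ x : K, 0 < x → IsSquare x)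
    (F : S.IsFlippable G i j k l) :
    (S.flip i j k l).IsDeveloped (S.flipSection G i j k l) := by
  have Q := F.isQuad
  refine ⟨F.isDecorated_flip hK, F.nc.flip F.s₁ F.s₂ F.m₁ F.m₂, F.flat_flip hK, ?_⟩
  have split := sbtw_trans_split F.s₁ F.s₂
  have hD := F.isDecorated_flip hK
  have m1 : ({i, j, l} : Finset (Fin n)) ∈ (S.flip i j k l).tri :=
    mem_flipTri.2 (Or.inr (Or.inr rfl))
  have m2 : ({j, k, l} : Finset (Fin n)) ∈ (S.flip i j k l).tri :=
    mem_flipTri.2 (Or.inr (Or.inl rfl))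
  have o1 : ∀ x y z, ({x, y, z} : Finset (Fin n)) = {i, j, k} → IsOSp (G x y z) :=
    fun x y z h => F.osp x y z (by rw [h]; exact F.m₁)
  have o2 : ∀ x y z, ({x, y, z} : Finset (Fin n)) = {i, k, l} → IsOSp (G x y z) :=
    fun x y z h => F.osp x y z (by rw [h]; exact F.m₂)
  have g1 := o1 i j k rfl
  have g2 := o2 i l k (insert_swap _ _ _)
  have g3 := o1 j i k (Finset.insert_comm _ _ _)
  have g4 := o2 l i k (insert_rotate _ _ _).symm
  have g5 := o1 k j i (by ext; simp; tauto)
  have g6 := o2 k l i (insert_rotate _ _ _)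
  have g7 := o1 j k i (insert_rotate _ _ _)
  have g8 := o2 l k i (by ext; simp; tauto)
  have r : IsOSp (matRho : SuperMatrix K M) := isOSp_matRho
  have Qij := Q.ij
  have Qil := Q.il
  have Qjk := Q.jk
  have Qkl := Q.kl
  have Qjl := Q.jl
  have a1 := hD.isOSp_angle (i := j) (j := l) (k := i)
    (by rw [insert_rotate]; exact m1) Qjl Qij.symm Qil.symm
  have a2 := hD.isOSp_angle (i := l) (j := i) (k := j)
    (by rw [← insert_rotate]; exact m1) Qil.symm Qjl.symm Qij
  have a3 := hD.isOSp_angle (i := j) (j := k) (k := l) m2 Qjk Qjl Qkl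
  have a4 := hD.isOSp_angle (i := l) (j := j) (k := k)
    (by rw [← insert_rotate]; exact m2) Qjl.symm Qkl.symm Qjk
  intro x y z h
  rcases mem_flipTri.1 h with ⟨h1, -, -⟩ | h1 | h1
  · have n1 := F.old_ne h1
    rw [flipSection_of_ne n1.1 n1.2]; exact F.osp _ _ _ h1
  · rw [flipSection_head Q h1]
    unfold flipHead
    split_ifs
    exacts [g5, r.mul g6, g7, a3.mul g7, r.mul g8, a4.adj.mul (r.mul g8)]
  · rw [flipSection_tail h1]
    have hc := triple_eq split.1 h1
    unfold flipTail
    split_ifs with hx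
    · subst hx
      rcases hc with e | e | e | e | e | e <;> obtain ⟨e1, rfl, rfl⟩ := e
      · exact g1
      · exact absurd e1 Qij
      · exact absurd e1 Qil
      · exact g2
      · exact absurd e1 Qij
      · exact absurd e1 Qil
    exacts [g3, a1.adj.mul g3, g4, a2.mul g4]

/-- Row `0` of the section at a vertex of the polygon does not change under a flip. -/
theorem IsFlippable.value_flip_of_mem (F : S.IsFlippable G i j k l) {x y z : Fin n}
    (h : {x, y, z} ∈ S.tri) : S.flipSection G i j k l x y z = G x y z :=
  flipSection_of_ne (F.old_ne h).1 (F.old_ne h).2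

end DecoratedTriangulation

end SuperTeich

end

/-! ## Rows of flat sections and super λ-lengths -/

noncomputable section

namespace SuperTeich

open Matrix

section Rows

variable {A : Type*} [Ring A]

theorem matA_mul_row_zero (h s : A) (X : Matrix (Fin 3) (Fin 3) A) : (matA h s * X) 0 = X 0 := by
  ext b; simp [matA, Matrix.mul_apply, Fin.sum_univ_three]

theorem matRho_mul_row_zero (X : Matrix (Fin 3) (Fin 3) A) :
    (matRho * X : Matrix (Fin 3) (Fin 3) A) 0 = -X 0 := by
  ext b; simp [matRho, Matrix.mul_apply, Fin.sum_univ_three]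

theorem matE_mul_row_zero (x : A) (X : Matrix (Fin 3) (Fin 3) A) :
    (matE x * X) 0 = -(x • X 1) := by
  ext b; simp [matE, Matrix.mul_apply, Fin.sum_univ_three]

theorem matE_mul_row_one (x : A) (X : Matrix (Fin 3) (Fin 3) A) :
    (matE x * X) 1 = Ring.inverse x • X 0 := by
  ext b; simp [matE, Matrix.mul_apply, Fin.sum_univ_three]

/-- The pairing of two row vectors that is invariant under the orthosymplectic group. -/
def rowPairing (v w : Fin 3 → A) : A := v 0 * w 1 - v 1 * w 0 + v 2 * w 2

theorem rowPairing_neg_left (v w : Fin 3 → A) : rowPairing (-v) w = -rowPairing v w := by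
  simp [rowPairing]; abel

theorem rowPairing_neg_right (v w : Fin 3 → A) : rowPairing v (-w) = -rowPairing v w := by
  simp [rowPairing]; abel

theorem rowPairing_smul {x : A} (hx : ∀ y, Commute x y) (v w : Fin 3 → A) :
    rowPairing v (x • w) = x * rowPairing v w := by
  simp only [rowPairing, Pi.smul_apply, smul_eq_mul, mul_add, mul_sub]
  rw [← mul_assoc, ← (hx _).eq, ← mul_assoc (v 1), ← (hx _).eq, ← mul_assoc (v 2),
    ← (hx _).eq]
  simp only [mul_assoc]

end Rows

theorem IsOSp.rowPairing_eq_one {K M : Type*} [Field K] [LinearOrder K] [IsStrictOrderedRing K]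
    [AddCommGroup M] [Module K M] {H : Matrix (Fin 3) (Fin 3) (ExteriorAlgebra K M)}
    (hH : IsOSp H) : rowPairing (H 0) (H 1) = 1 := by
  have := congrFun (congrFun hH.mul_adj 0) 0
  simp only [Matrix.mul_apply, Fin.sum_univ_three, superAdj] at this
  simpa [rowPairing, sub_eq_add_neg] using this

namespace DecoratedTriangulation

variable {K M : Type*} [Field K] [LinearOrder K] [IsStrictOrderedRing K] [AddCommGroup M]
  [Module K M] {n : ℕ}

local notation "Λ" => ExteriorAlgebra K M

variable {S : DecoratedTriangulation K M n} {G : Fin n → Fin n → Fin n → SuperMatrix K M}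
  {i j k l : Fin n}

theorem crossing_mul_row_zero (S : DecoratedTriangulation K M n) (i j : Fin n)
    (X : SuperMatrix K M) : (S.crossing i j * X) 0 = X 0 ∨ (S.crossing i j * X) 0 = -X 0 := by
  unfold crossing; split_ifs
  · left; rw [one_mul]
  · right; exact matRho_mul_row_zero X

theorem sideSign_mul_row_zero (k l i j : Fin n) (X : SuperMatrix K M) :
    (sideSign k l i j * X : SuperMatrix K M) 0 = X 0 ∨
      (sideSign k l i j * X : SuperMatrix K M) 0 = -X 0 := by
  unfold sideSign; split_ifs
  · right; exact matRho_mul_row_zero X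
  · left; rw [one_mul]

/-- The first row of a flat section at a corner of a triangle. -/
theorem IsFlat.row_zero_swap {T : Set (Finset (Fin n))} (hG : S.IsFlat T G)
    (h : {i, j, k} ∈ T) (hs : sbtw i j k ∨ sbtw i k j) : G i j k 0 = G i k j 0 := by
  rcases hs with hs | hs
  · rw [hG.angle i j k h hs]; exact (matA_mul_row_zero _ _ _).symm
  · rw [hG.angle i k j (by rwa [insert_swap]) hs]; exact matA_mul_row_zero _ _ _

theorem IsDeveloped.row_zero_swap (hG : S.IsDeveloped G) (h : {i, j, k} ∈ S.tri) :
    G i j k 0 = G i k j 0 := hG.flat.row_zero_swap h (hG.nc.sbtw_or h)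

theorem IsDeveloped.lam_pos (hG : S.IsDeveloped G) (h : {i, j, k} ∈ S.tri) :
    IsPosEven (S.lam i j) :=
  IsPosEven.lam (hG.nc.ne h).1 (hG.dec.root_pos_of_mem h (by simp) (by simp) (hG.nc.ne h).1)

theorem IsDeveloped.row_zero_of_sbtw (hG : S.IsDeveloped G) (h : {i, j, k} ∈ S.tri)
    (hs : sbtw i k j) : G j i k 0 = -(S.lam i j • G i j k 1) := by
  rw [hG.flat.side i k j (by rwa [insert_swap]) hs, matE_mul_row_zero]

theorem IsDeveloped.row_zero_of_sbtw' (hG : S.IsDeveloped G) (h : {i, j, k} ∈ S.tri)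
    (hs : sbtw i j k) : G j i k 0 = S.lam i j • G i j k 1 := by
  rw [hG.flat.side j k i (by rwa [insert_rotate]) hs.cyclic_left, matE_mul_row_one, smul_smul,
    lam_comm S j i, Ring.mul_inverse_cancel _ (hG.lam_pos h).isUnit, one_smul]

/-- Up to sign, the first row of a flat section at a vertex of the polygon is given by `V`. -/
def IsRowSystem (T : Set (Finset (Fin n))) (G : Fin n → Fin n → Fin n → SuperMatrix K M)
    (V : Fin n → Fin 3 → ExteriorAlgebra K M) : Prop :=
  ∀ i j k, {i, j, k} ∈ T → G i j k 0 = V i ∨ G i j k 0 = -V i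

/-- `V` consists, up to signs, of the first rows of an invertible flat section. -/
def IsRealized (S : DecoratedTriangulation K M n) (V : Fin n → Fin 3 → ExteriorAlgebra K M) : Prop :=
  ∃ G, S.IsDeveloped G ∧ IsRowSystem S.tri G V

/-- Row `0` at `j` is `±λ` times row `1` at `i`, and rows `0` and `1` of an orthosymplectic matrix
pair to `1`. -/
theorem IsDeveloped.lam_eq (hG : S.IsDeveloped G) (h : {i, j, k} ∈ S.tri) :
    S.lam i j = rowPairing (G i j k 0) (G j i k 0) ∨
      S.lam i j = -rowPairing (G i j k 0) (G j i k 0) := by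
  have hc : ∀ y, Commute (S.lam i j) y := (hG.lam_pos h).1.commute
  rcases hG.nc.sbtw_or h with hs | hs
  · left
    rw [hG.row_zero_of_sbtw' h hs, rowPairing_smul hc, (hG.osp _ _ _ h).rowPairing_eq_one, mul_one]
  · right
    rw [hG.row_zero_of_sbtw h hs, rowPairing_neg_right, rowPairing_smul hc,
      (hG.osp _ _ _ h).rowPairing_eq_one, mul_one, neg_neg]

variable {V : Fin n → Fin 3 → ExteriorAlgebra K M} {S' : DecoratedTriangulation K M n}

theorem exists_triple {t : Finset (Fin n)} {x y z i j : Fin n} (ht : t = {x, y, z}) (hxy : x ≠ y)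
    (hxz : x ≠ z) (hyz : y ≠ z) (hi : i ∈ t) (hj : j ∈ t) (hij : i ≠ j) :
    ∃ k, t = {i, j, k} := by
  subst ht
  simp only [Finset.mem_insert, Finset.mem_singleton] at hi hj
  rcases hi with rfl | rfl | rfl <;> rcases hj with rfl | rfl | rfl
  all_goals first
    | exact absurd rfl hij
    | exact ⟨x, rfl⟩
    | exact ⟨x, by ext; simp only [Finset.mem_insert, Finset.mem_singleton]; tauto⟩
    | exact ⟨y, rfl⟩
    | exact ⟨y, by ext; simp only [Finset.mem_insert, Finset.mem_singleton]; tauto⟩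
    | exact ⟨z, rfl⟩
    | exact ⟨z, by ext; simp only [Finset.mem_insert, Finset.mem_singleton]; tauto⟩

theorem IsEdge.exists_third (nc : IsNonCrossing S.tri) (h : S.IsEdge i j) :
    ∃ k, {i, j, k} ∈ S.tri := by
  obtain ⟨hij, t, ht, hi, hj⟩ := h
  obtain ⟨x, y, z, hs, e⟩ := nc.exists_sbtw t ht
  obtain ⟨h1, h2, h3⟩ := sbtw_ne hs
  obtain ⟨k, hk⟩ := exists_triple e h1 h2 h3 hi hj hij
  exact ⟨k, hk ▸ ht⟩

theorem isEdge_of_mem (nc : IsNonCrossing S.tri) (h : {i, j, k} ∈ S.tri) : S.IsEdge i j :=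
  ⟨(nc.ne h).1, _, h, by simp, by simp⟩

theorem IsRealized.lam_eq (hS : S.IsRealized V) (h : S.IsEdge i j) :
    IsPosEven (S.lam i j) ∧ (S.lam i j = rowPairing (V i) (V j) ∨
      S.lam i j = -rowPairing (V i) (V j)) := by
  obtain ⟨G, hG, hV⟩ := hS
  obtain ⟨k, hk⟩ := h.exists_third hG.nc
  refine ⟨hG.lam_pos hk, ?_⟩
  have := hG.lam_eq hk
  rcases hV _ _ _ hk with e1 | e1 <;>
    rcases hV j i k (by rwa [Finset.insert_comm]) with e2 | e2 <;>
    rw [e1, e2] at this <;>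
    try simp only [rowPairing_neg_left, rowPairing_neg_right, neg_neg] at this
  exacts [this, this.symm, this.symm, this]

/-- The vectors determine a `λ`-length up to sign, and two positive elements cannot be opposite. -/
theorem IsRealized.lam_unique (hS : S.IsRealized V) (hS' : S'.IsRealized V) (h : S.IsEdge i j)
    (h' : S'.IsEdge i j) : S.lam i j = S'.lam i j := by
  obtain ⟨p, e⟩ := hS.lam_eq h
  obtain ⟨p', e'⟩ := hS'.lam_eq h'
  have key : S.lam i j = S'.lam i j ∨ S.lam i j = -S'.lam i j := by
    rcases e with e | e <;> rcases e' with e' | e' <;> rw [e, e'] <;> simp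
  rcases key with key | key
  · exact key
  · exfalso
    have h1 := p.2
    have h2 := p'.2
    rw [key, map_neg] at h1
    linarith

theorem IsFlip.isFlippable {e : Sym2 (Fin n)} (h : S.IsFlip e S') (hG : S.IsDeveloped G) :
    ∃ i j k l, S.IsFlippable G i j k l ∧ S' = S.flip i j k l := by
  obtain ⟨i, j, k, l, -, h1, h2, h3, h4, h5, h6⟩ := h
  exact ⟨i, j, k, l, ⟨hG, h2, h3, h4, h5, h1⟩, h6⟩

theorem IsFlippable.isRowSystem_flip (hK : ∀ x : K, 0 < x → IsSquare x)
    (F : S.IsFlippable G i j k l) (hV : IsRowSystem S.tri G V) :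
    IsRowSystem (S.flip i j k l).tri (S.flipSection G i j k l) V := by
  have hD := F.isDeveloped_flip hK
  have gen : ∀ x y z, {x, y, z} ∈ (S.flip i j k l).tri → ¬ (x = j ∧ y = l) → ¬ (x = l ∧ y = j) →
      S.flipSection G i j k l x y z 0 = V x ∨ S.flipSection G i j k l x y z 0 = -V x := by
    intro x y z h n1 n2
    rcases mem_flipTri.1 h with ⟨h1, -, -⟩ | h1
    · rw [F.value_flip_of_mem h1]; exact hV _ _ _ h1
    · obtain ⟨u, hu, e⟩ := F.new_value h1 n1 n2
      have hm : {x, y, u} ∈ S.tri := by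
        rcases hu with hu | hu <;> rw [hu]
        exacts [F.m₁, F.m₂]
      rw [e]
      rcases sideSign_mul_row_zero k l x y (G x y u) with e1 | e1 <;> rw [e1] <;>
        rcases hV _ _ _ hm with e2 | e2 <;> simp [e2]
  intro x y z h
  -- At an end of the new diagonal, row `0` agrees with the one at the other side of the same
  -- corner, and that side is old.
  by_cases hc : (x = j ∧ y = l) ∨ (x = l ∧ y = j)
  · have hne := hD.nc.ne h
    rw [hD.row_zero_swap h]
    apply gen x z y (by rwa [insert_swap]) <;> grind
  · exact gen x y z h (fun h => hc (Or.inl h)) (fun h => hc (Or.inr h))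

theorem IsRealized.of_isFlip (hK : ∀ x : K, 0 < x → IsSquare x) (hS : S.IsRealized V)
    {e : Sym2 (Fin n)} (h : S.IsFlip e S') : S'.IsRealized V := by
  obtain ⟨G, hG, hV⟩ := hS
  obtain ⟨i, j, k, l, F, rfl⟩ := h.isFlippable hG
  exact ⟨_, F.isDeveloped_flip hK, F.isRowSystem_flip hK hV⟩

/-- Reachability by flips. -/
def Reaches (S S' : DecoratedTriangulation K M n) : Prop :=
  Relation.ReflTransGen (fun S₁ S₂ : DecoratedTriangulation K M n => ∃ e, IsFlip S₁ e S₂) S S'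

theorem IsRealized.of_reaches (hK : ∀ x : K, 0 < x → IsSquare x) (hS : S.IsRealized V)
    (h : S.Reaches S') : S'.IsRealized V := by
  unfold Reaches at h
  induction h with
  | refl => exact hS
  | tail _ h ih => obtain ⟨e, h⟩ := h; exact ih.of_isFlip hK h

theorem Reaches.flipEdge (h : S.Reaches S') (e : Sym2 (Fin n)) : S.Reaches (S'.flipEdge e) := by
  unfold DecoratedTriangulation.flipEdge
  split_ifs with hx
  · exact Relation.ReflTransGen.tail h ⟨e, hx.choose_spec⟩
  · exact h

theorem reaches_flips (S : DecoratedTriangulation K M n) (L : List (Sym2 (Fin n))) :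
    S.Reaches (S.flips L) := by
  have : ∀ (S' : DecoratedTriangulation K M n), S.Reaches S' → S.Reaches (S'.flips L) := by
    induction L with
    | nil => intro S' h; exact h
    | cons e L ih => intro S' h; exact ih _ (h.flipEdge e)
  exact this S Relation.ReflTransGen.refl

/-- The super `λ`-length of an arc is its `λ`-length in any decorated triangulation that contains
the arc and has the same vectors at the vertices of the polygon. -/
theorem IsRealized.superLambda_eq (hK : ∀ x : K, 0 < x → IsSquare x) (hS : S.IsRealized V)
    (hr : S.Reaches S') {S₂ : DecoratedTriangulation K M n} (h2 : S₂.IsRealized V)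
    (h : S'.IsEdge i j) (h' : S₂.IsEdge i j) : S.superLambda i j = S₂.lam i j := by
  have hex : ∃ x, S.IsSuperLambda i j x := ⟨_, Or.inr ⟨S', hr, h, rfl⟩⟩
  rcases Classical.epsilon_spec hex with ⟨e, -⟩ | ⟨S₁, hr₁, he, e⟩
  · exact absurd e h.1
  · exact e.trans ((hS.of_reaches hK hr₁).lam_unique h2 he h')

theorem superLambda_self (S : DecoratedTriangulation K M n) (i : Fin n) :
    S.superLambda i i = 0 := by
  have hex : ∃ x, S.IsSuperLambda i i x := ⟨0, Or.inl ⟨rfl, rfl⟩⟩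
  rcases Classical.epsilon_spec hex with ⟨-, e⟩ | ⟨S₁, -, he, -⟩
  · exact e
  · exact absurd rfl he.1

/-- The choice inside `flipEdge` is harmless: the orientation singles out `i` and `k`, and the two
triangles at the diagonal single out `j` and `l`. -/
theorem IsFlippable.flipEdge_eq (F : S.IsFlippable G i j k l) :
    S.flipEdge s(i, k) = S.flip i j k l := by
  have hex : ∃ S', S.IsFlip s(i, k) S' :=
    ⟨_, i, j, k, l, rfl, F.or, F.s₁, F.s₂, F.m₁, F.m₂, rfl⟩
  rw [flipEdge, dif_pos hex]
  obtain ⟨i', j', k', l', h0, h1, h2, h3, h4, h5, h6⟩ := hex.choose_spec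
  rw [h6]
  have o := (F.dec.orient_symm F.m₁ (by simp) (by simp) F.isQuad.ik).1 F.or
  rcases Sym2.eq_iff.1 h0 with ⟨rfl, rfl⟩ | ⟨rfl, rfl⟩
  · obtain rfl := F.nc.eq_of_sbtw F.m₁ h4 F.s₁ h2
    obtain rfl : l = l' := by
      refine F.nc.eq_of_sbtw (i := k) (k := i) ?_ ?_ F.s₂.cyclic_left h3.cyclic_left
      · rw [insert_rotate]; exact F.m₂
      · rw [insert_rotate]; exact h5
    rfl
  · exact absurd h1 o

/-- The two triangles at an interior diagonal `x → y` form a quadrilateral that can be flipped. -/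
theorem IsDeveloped.isFlippable (hG : S.IsDeveloped G) {x y z w : Fin n} (h : {x, y, z} ∈ S.tri)
    (h' : {x, y, w} ∈ S.tri) (hzw : z ≠ w) (o : S.orient x y) :
    S.IsFlippable G x z y w ∨ S.IsFlippable G x w y z := by
  rcases hG.nc.opposite h h' hzw with ⟨a, b⟩ | ⟨a, b⟩
  · exact Or.inl ⟨hG, a, b, by rwa [insert_swap], h', o⟩
  · exact Or.inr ⟨hG, a, b, by rwa [insert_swap], h, o⟩

end DecoratedTriangulation

end SuperTeich

end

/-! ## Holonomy, spin equivalence, assembled triangulations -/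

noncomputable section

namespace SuperTeich

open Matrix

namespace DecoratedTriangulation

variable {K M : Type*} [Field K] [LinearOrder K] [IsStrictOrderedRing K] [AddCommGroup M]
  [Module K M] {n : ℕ}

variable {S : DecoratedTriangulation K M n} {G : Fin n → Fin n → Fin n → SuperMatrix K M}
  {i j k l : Fin n}

theorem IsDecorated.isOdd_muUp (hS : S.IsDecorated) (h : {i, j, k} ∈ S.tri) (hij : i ≠ j)
    (hik : i ≠ k) (hjk : j ≠ k) : IsOdd (S.muUp i j k) := by
  have p1 := hS.root_pos_of_mem h (by simp) (by simp) hij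
  have p2 := hS.root_pos_of_mem h (by simp) (by simp) hik
  have p3 := hS.root_pos_of_mem h (by simp) (by simp) hjk
  exact (p3.1.mul (p1.mul p2).ringInverse.1).mul_odd (hS.mu_odd _ h)

theorem IsDeveloped.step (hG : S.IsDeveloped G) {u v : Fin n × Fin n × Fin n}
    {X : SuperMatrix K M} (h : S.Step u v X) :
    G v.1 v.2.1 v.2.2 = X * G u.1 u.2.1 u.2.2 := by
  cases h with
  | angle i j k h hs => exact hG.flat.angle i j k h hs
  | angleInv i j k h hs =>
    obtain ⟨n1, n2, n3⟩ := sbtw_ne hs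
    have e := hG.flat.angle i j k h hs
    simp only
    rw [e, angle, ← mul_assoc,
      (matA_mul_matAInv _ (hG.dec.isOdd_muUp h n1 n2 n3).mul_self).2, one_mul]
  | side i j k h hs => exact hG.flat.side i j k h hs
  | sideInv i j k h hs =>
    simp only
    rw [hG.flat.side i j k h hs, ← mul_assoc,
      (matE_mul_matEInv (hG.lam_pos (by rwa [insert_swap])).isUnit).2, one_mul]
  | crossTail i j k l h h' hkl o =>
    simp only
    rw [hG.flat.cross i j k l h h' hkl, crossing, if_pos o]
  | crossHead i j k l h h' hkl o =>
    simp only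
    have := (hG.dec.orient_symm h (by simp) (by simp) (hG.nc.ne h).1.symm).1 o
    rw [hG.flat.cross i j k l h h' hkl, crossing, if_neg this]

/-- As `G` is invertible, the holonomy depends only on the end points of the path. -/
theorem IsDeveloped.holonomy (hG : S.IsDeveloped G) {u v : Fin n × Fin n × Fin n}
    {H : SuperMatrix K M} (h : S.Holonomy u v H) :
    G v.1 v.2.1 v.2.2 = H * G u.1 u.2.1 u.2.2 := by
  induction h with
  | refl => rw [one_mul]
  | step _ h ih => rw [hG.step h, ih, mul_assoc]

theorem IsDeveloped.mul_right (hG : S.IsDeveloped G) {X : SuperMatrix K M} (hX : IsOSp X) :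
    S.IsDeveloped fun x y z => G x y z * X where
  dec := hG.dec
  nc := hG.nc
  flat :=
    { angle := fun i j k h hs => by rw [hG.flat.angle i j k h hs, mul_assoc]
      side := fun i j k h hs => by rw [hG.flat.side i j k h hs, mul_assoc]
      cross := fun i j k l h h' hn => by rw [hG.flat.cross i j k l h h' hn, mul_assoc] }
  osp i j k h := (hG.osp i j k h).mul hX

theorem IsRowSystem.mul_right {T : Set (Finset (Fin n))} {V : Fin n → Fin 3 → ExteriorAlgebra K M}
    (hV : IsRowSystem T G V) (X : SuperMatrix K M) :
    IsRowSystem T (fun x y z => G x y z * X) fun x => V x ᵥ* X := by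
  intro i j k h
  simp only [Matrix.mul_apply_eq_vecMul]
  rcases hV i j k h with e | e <;> simp [e, Matrix.neg_vecMul]

/-! ### Spin equivalence -/

/-- An interior diagonal lies in exactly two triangles, so the parity of the number of reversals is
odd precisely when one of the two is in `R` and the other is not. -/
theorem reverse_orient (nc : IsNonCrossing S.tri) {R : Set (Finset (Fin n))} (hR : R ⊆ S.tri)
    (h : {i, j, k} ∈ S.tri) (h' : {i, j, l} ∈ S.tri) (hkl : k ≠ l) :
    (S.reverse R).orient i j ↔
      (({i, j, k} ∈ R ↔ {i, j, l} ∈ R) ∧ S.orient i j) ∨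
        (¬ ({i, j, k} ∈ R ↔ {i, j, l} ∈ R) ∧ S.orient j i) := by
  have hne : ({i, j, k} : Finset (Fin n)) ≠ {i, j, l} :=
    fun e => hkl (third_unique e (nc.ne h).2.1 (nc.ne h).2.2)
  have key : ∀ t, t ∈ R → i ∈ t → j ∈ t → t = {i, j, k} ∨ t = {i, j, l} := by
    intro t ht hi hj
    obtain ⟨u, hu⟩ : ∃ u, t = {i, j, u} := by
      obtain ⟨x, y, z, hs, e⟩ := nc.exists_sbtw t (hR ht)
      obtain ⟨h1, h2, h3⟩ := sbtw_ne hs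
      exact exists_triple e h1 h2 h3 hi hj (nc.ne h).1
    subst hu
    rcases nc.third_eq h h' (hR ht) hkl with rfl | rfl
    · exact Or.inl rfl
    · exact Or.inr rfl
  have hi : ∀ u, i ∈ ({i, j, u} : Finset (Fin n)) := by simp
  have hj : ∀ u, j ∈ ({i, j, u} : Finset (Fin n)) := by simp
  have aux : (Odd {t | t ∈ R ∧ i ∈ t ∧ j ∈ t}.ncard ↔ ¬ ({i, j, k} ∈ R ↔ {i, j, l} ∈ R)) := by
    by_cases a : {i, j, k} ∈ R <;> by_cases b : {i, j, l} ∈ R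
    · have : {t | t ∈ R ∧ i ∈ t ∧ j ∈ t} = {{i, j, k}, {i, j, l}} := by
        ext t; simp only [Set.mem_ofPred_eq, Set.mem_insert_iff, Set.mem_singleton_iff]
        grind
      rw [this, Set.ncard_pair hne]; simp [a, b]
    · have : {t | t ∈ R ∧ i ∈ t ∧ j ∈ t} = {{i, j, k}} := by
        ext t; simp only [Set.mem_ofPred_eq, Set.mem_singleton_iff]
        grind
      rw [this, Set.ncard_singleton]; simp [a, b]
    · have : {t | t ∈ R ∧ i ∈ t ∧ j ∈ t} = {{i, j, l}} := by
        ext t; simp only [Set.mem_ofPred_eq, Set.mem_singleton_iff]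
        grind
      rw [this, Set.ncard_singleton]; simp [a, b]
    · have : {t | t ∈ R ∧ i ∈ t ∧ j ∈ t} = ∅ := by
        ext t; simp only [Set.mem_ofPred_eq, Set.mem_empty_iff_false]
        grind
      rw [this, Set.ncard_empty]; simp [a, b]
  unfold reverse
  simp only
  split_ifs <;> tauto

open Classical in
/-- The factor by which a flat section changes on a triangle under a spin equivalence. -/
def reverseSign (R : Set (Finset (Fin n))) (t : Finset (Fin n)) : SuperMatrix K M :=
  if t ∈ R then matRho else 1

theorem reverseSign_mul_self (R : Set (Finset (Fin n))) (t : Finset (Fin n)) :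
    (reverseSign R t * reverseSign R t : SuperMatrix K M) = 1 := by
  unfold reverseSign; split_ifs
  · exact matRho_mul_self
  · exact one_mul 1

theorem isOSp_reverseSign (R : Set (Finset (Fin n))) (t : Finset (Fin n)) :
    IsOSp (reverseSign R t : SuperMatrix K M) := by
  unfold reverseSign; split_ifs
  · exact isOSp_matRho
  · exact isOSp_one

theorem IsDecorated.reverse (hS : S.IsDecorated) (R : Set (Finset (Fin n))) :
    (S.reverse R).IsDecorated := by
  refine ⟨?_, fun i j h => hS.root_pos i j h, ?_⟩
  · intro i j h
    have h1 := hS.orient_iff i j h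
    have hc : {t | t ∈ R ∧ i ∈ t ∧ j ∈ t} = {t | t ∈ R ∧ j ∈ t ∧ i ∈ t} := by
      ext t; simp only [Set.mem_ofPred_eq]; tauto
    unfold DecoratedTriangulation.reverse
    simp only [hc]
    split_ifs <;> tauto
  · intro t ht
    unfold DecoratedTriangulation.reverse
    simp only
    split_ifs
    · exact (hS.mu_odd t ht).neg
    · exact hS.mu_odd t ht

theorem reverse_angle (R : Set (Finset (Fin n))) :
    (S.reverse R).angle i j k * reverseSign R {i, j, k}
      = reverseSign R {i, j, k} * S.angle i j k := by
  have e1 : (S.reverse R).hLength i j k = S.hLength i j k := rfl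
  unfold angle reverseSign
  rw [e1]
  unfold muUp
  have e2 : (S.reverse R).root = S.root := rfl
  rw [e2]
  split_ifs with h
  · have e3 : (S.reverse R).mu {i, j, k} = -S.mu {i, j, k} := if_pos h
    rw [matRho_mul_matA, e3, mul_neg]
  · have e3 : (S.reverse R).mu {i, j, k} = S.mu {i, j, k} := if_neg h
    rw [one_mul, mul_one, e3]

theorem reverseSign_comm_matE (R : Set (Finset (Fin n))) (t : Finset (Fin n))
    (x : ExteriorAlgebra K M) : matE x * reverseSign R t = reverseSign R t * matE x := by
  unfold reverseSign; split_ifs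
  · exact (matRho_mul_matE x).symm
  · rw [one_mul, mul_one]

/-- Conjugation by `ρ` negates the odd parameter of an angle matrix and fixes `E`, which matches the
negated `μ`. A crossing matrix acquires one factor `ρ` exactly if the diagonal is reversed. -/
theorem IsDeveloped.reverse (hG : S.IsDeveloped G) {R : Set (Finset (Fin n))} (hR : R ⊆ S.tri) :
    (S.reverse R).IsDeveloped fun x y z => reverseSign R {x, y, z} * G x y z where
  dec := hG.dec.reverse R
  nc := hG.nc
  flat :=
    { angle := fun i j k h hs => by
        rw [hG.flat.angle i j k h hs, insert_swap, ← mul_assoc, ← reverse_angle, mul_assoc]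
      side := fun i j k h hs => by
        rw [hG.flat.side i j k h hs, Finset.insert_comm k i, ← mul_assoc, ← reverseSign_comm_matE, mul_assoc]; rfl
      cross := fun i j k l h h' hn => by
        have o := hG.dec.orient_symm h (by simp) (by simp) (hG.nc.ne h).1
        have key := reverse_orient hG.nc hR h h' hn
        rw [hG.flat.cross i j k l h h' hn]
        unfold crossing reverseSign
        by_cases a : {i, j, k} ∈ R <;> by_cases b : {i, j, l} ∈ R <;> by_cases c : S.orient i j <;>
          simp [a, b, c, key] <;> simp_all [matRho_mul_mul_self] }
  osp i j k h := (isOSp_reverseSign _ _).mul (hG.osp i j k h)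

theorem IsRowSystem.reverse {V : Fin n → Fin 3 → ExteriorAlgebra K M}
    (hV : IsRowSystem S.tri G V) (R : Set (Finset (Fin n))) :
    IsRowSystem S.tri (fun x y z => reverseSign R {x, y, z} * G x y z) V := by
  intro i j k h
  simp only
  unfold reverseSign
  split_ifs
  · rw [matRho_mul_row_zero]
    rcases hV i j k h with e | e <;> simp [e]
  · rw [one_mul]; exact hV i j k h

/-! ### Triangulations assembled from triangles -/

/-- `T` arises from the triangle `t₀` by successively attaching triangles along one side, with a
new opposite vertex. -/
inductive IsAssembled (t₀ : Finset (Fin n)) : Set (Finset (Fin n)) → Prop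
  | single : IsAssembled t₀ {t₀}
  | attach {T : Set (Finset (Fin n))} (i j k l : Fin n) : IsAssembled t₀ T → {i, j, k} ∈ T →
      sbtw i j k → sbtw i k l → (∀ t ∈ T, l ∉ t) → IsAssembled t₀ (insert {i, k, l} T)

/-- The flat section on the triangle `{i, j, k}` with the value `g` at `(i, j, k)`. -/
def triangleSection (S : DecoratedTriangulation K M n) (i j k : Fin n) (g : SuperMatrix K M)
    (x y : Fin n) : SuperMatrix K M :=
  if x = i then if y = j then g else S.angle i j k * g
  else if x = k then
    if y = i then matE (S.lam i k) * (S.angle i j k * g)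
    else S.angle k i j * (matE (S.lam i k) * (S.angle i j k * g))
  else if y = k then matE (S.lam k j) * (S.angle k i j * (matE (S.lam i k) * (S.angle i j k * g)))
  else S.angle j k i *
    (matE (S.lam k j) * (S.angle k i j * (matE (S.lam i k) * (S.angle i j k * g))))

/-- The value `g` is transported around the hexagon; the last edge closes up by `hexagon_angle`. -/
theorem IsDecorated.exists_triangleSection (hS : S.IsDecorated) (h : {i, j, k} ∈ S.tri)
    (hs : sbtw i j k) {g : SuperMatrix K M} (hg : IsOSp g) :
    ∃ G : Fin n → Fin n → Fin n → SuperMatrix K M, S.IsFlat {{i, j, k}} G ∧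
      (∀ x y z, {x, y, z} ∈ ({{i, j, k}} : Set (Finset (Fin n))) → IsOSp (G x y z)) ∧
      G i j k = g := by
  obtain ⟨n1, n2, n3⟩ := sbtw_ne hs
  have h' : {k, i, j} ∈ S.tri := by rwa [← insert_rotate]
  have h'' : {j, k, i} ∈ S.tri := by rwa [insert_rotate]
  have a1 := hS.isOSp_angle h n1 n2 n3
  have a2 := hS.isOSp_angle h' n2.symm n3.symm n1
  have a3 := hS.isOSp_angle h'' n3 n1.symm n2.symm
  have s1 := hS.isOSp_side h (i := i) (j := k) (by simp) (by simp) n2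
  have s2 := hS.isOSp_side h (i := k) (j := j) (by simp) (by simp) n3.symm
  have m1 := n1.symm
  have m2 := n2.symm
  have m3 := n3.symm
  have v1 : S.triangleSection i j k g i j = g := by simp [triangleSection]
  have v2 : S.triangleSection i j k g i k = S.angle i j k * g := by simp [triangleSection, *]
  have v3 : S.triangleSection i j k g k i = matE (S.lam i k) * (S.angle i j k * g) := by
    simp [triangleSection, *]
  have v4 : S.triangleSection i j k g k j
    = S.angle k i j * (matE (S.lam i k) * (S.angle i j k * g)) := by simp [triangleSection, *]
  have v5 : S.triangleSection i j k g j k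
    = matE (S.lam k j) * (S.angle k i j * (matE (S.lam i k) * (S.angle i j k * g))) := by
    simp [triangleSection, *]
  have v6 : S.triangleSection i j k g j i = S.angle j k i *
    (matE (S.lam k j) * (S.angle k i j * (matE (S.lam i k) * (S.angle i j k * g)))) := by
    simp [triangleSection, *]
  have hex := hexagon_angle n1 n2 n3 (hS.root_pos_of_mem h (by simp) (by simp) n1)
    (hS.root_pos_of_mem h (by simp) (by simp) n3) (hS.root_pos_of_mem h (by simp) (by simp) n2)
    (hS.mu_odd _ h)
  have v7 : S.triangleSection i j k g i j = matE (S.lam j i) * S.triangleSection i j k g j i := by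
    have := congrArg (· * g) hex
    simp only [one_mul, mul_assoc] at this
    rw [v1, v6, this]
  refine ⟨fun x y _ => S.triangleSection i j k g x y, ⟨?_, ?_, ?_⟩, ?_, v1⟩
  · intro x y z he hs'
    rcases triple_eq_of_sbtw hs hs' he with ⟨rfl, rfl, rfl⟩ | ⟨rfl, rfl, rfl⟩ | ⟨rfl, rfl, rfl⟩
    · rw [v1, v2]
    · rw [v5, v6]
    · rw [v3, v4]
  · intro x y z he hs'
    rcases triple_eq_of_sbtw hs hs' he with ⟨rfl, rfl, rfl⟩ | ⟨rfl, rfl, rfl⟩ | ⟨rfl, rfl, rfl⟩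
    · rw [v3, v2]
    · exact v7
    · rw [v5, v4]
  · intro x y z w he he' hzw
    have hne : x ≠ z ∧ y ≠ z := by
      rcases triple_eq hs he with e | e | e | e | e | e <;> grind
    exact absurd (third_unique (Eq.trans he (Eq.symm he')) hne.1 hne.2) hzw
  · intro x y z he
    beta_reduce
    rcases triple_eq hs he with e | e | e | e | e | e <;> obtain ⟨rfl, rfl, rfl⟩ := e
    · rw [v1]; exact hg
    · rw [v5]; exact s2.mul (a2.mul (s1.mul (a1.mul hg)))
    · rw [v3]; exact s1.mul (a1.mul hg)
    · rw [v2]; exact a1.mul hg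
    · rw [v6]; exact a3.mul (s2.mul (a2.mul (s1.mul (a1.mul hg))))
    · rw [v4]; exact a2.mul (s1.mul (a1.mul hg))

end DecoratedTriangulation

end SuperTeich

end

/-! ## Sections, spin equivalences and paths on assembled triangulations -/

noncomputable section

namespace SuperTeich

open Matrix

namespace DecoratedTriangulation

variable {K M : Type*} [Field K] [LinearOrder K] [IsStrictOrderedRing K] [AddCommGroup M]
  [Module K M] {n : ℕ}

variable {S : DecoratedTriangulation K M n} {i j k l : Fin n} {t₀ : Finset (Fin n)}
  {T : Set (Finset (Fin n))}

/-- Two triangles on the two sides of `(i, k)`. -/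
theorem shared_side (nc : IsNonCrossing S.tri) (hT : T ⊆ S.tri) (h : {i, j, k} ∈ T)
    (hs' : sbtw i k l) (hl : {i, k, l} ∈ S.tri) (hn : ∀ t ∈ T, l ∉ t) {x y z w : Fin n}
    (h1 : {x, y, z} ∈ T) (h2 : ({x, y, w} : Finset (Fin n)) = {i, k, l}) :
    z = j ∧ w = l ∧ ((x = i ∧ y = k) ∨ (x = k ∧ y = i)) := by
  have lj : l ≠ j := by rintro rfl; exact hn _ h (by simp)
  have lx : x ≠ l := by rintro rfl; exact hn _ h1 (by simp)
  have ly : y ≠ l := by rintro rfl; exact hn _ h1 (by simp)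
  have lz : z ≠ l := by rintro rfl; exact hn _ h1 (by simp)
  have key : w = l ∧ ((x = i ∧ y = k) ∨ (x = k ∧ y = i)) := by
    rcases triple_eq hs' h2 with e | e | e | e | e | e <;> grind
  refine ⟨?_, key⟩
  have h3 : {i, k, z} ∈ S.tri := by
    rcases key.2 with ⟨rfl, rfl⟩ | ⟨rfl, rfl⟩
    · exact hT h1
    · rw [Finset.insert_comm]; exact hT h1
  rcases nc.third_eq hl (by rw [insert_swap]; exact hT h) h3 lj with e | e
  · exact absurd e lz
  · exact e

theorem IsDecorated.crossing_symm (hS : S.IsDecorated) {t : Finset (Fin n)} (ht : t ∈ S.tri)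
    (hi : i ∈ t) (hk : k ∈ t) (hik : i ≠ k) : S.crossing k i = matRho * S.crossing i k := by
  have := hS.orient_symm ht hi hk hik
  unfold crossing
  by_cases a : S.orient i k <;> by_cases b : S.orient k i <;> simp_all [matRho_mul_self]

/-- An attached triangle meets the earlier ones only along `(i, k)`. Its section is normalized by
the crossing near `i`, and the crossing near `k` must then hold by itself. Its third vertex `l` is
new, so the vector `V l` can be prescribed freely. -/
theorem IsAssembled.exists_section (hS : S.IsDecorated) (nc : IsNonCrossing S.tri)
    (ht : t₀ ∈ S.tri) (hA : IsAssembled t₀ T) (hT : T ⊆ S.tri) :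
    ∃ G, S.IsFlat T G ∧ (∀ i j k, {i, j, k} ∈ T → IsOSp (G i j k)) ∧
      ∃ V : Fin n → Fin 3 → ExteriorAlgebra K M, IsRowSystem T G V := by
  have rows : ∀ {i j k : Fin n} {G : Fin n → Fin n → Fin n → SuperMatrix K M}, sbtw i j k →
      S.IsFlat {{i, j, k}} G → ∀ (V : Fin n → Fin 3 → ExteriorAlgebra K M),
      (∀ x y z, ({x, y, z} : Finset (Fin n)) = {i, j, k} → sbtw x y z →
        G x y z 0 = V x ∨ G x y z 0 = -V x) → IsRowSystem {{i, j, k}} G V := by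
    intro i j k G hs hG V hV x y z h
    by_cases hxyz : sbtw x y z
    · exact hV x y z h hxyz
    · have hxzy : sbtw x z y := by
        rcases triple_eq hs h with e | e | e | e | e | e <;> obtain ⟨rfl, rfl, rfl⟩ := e
        · exact absurd hs hxyz
        · exact absurd hs.cyclic_left hxyz
        · exact absurd hs.cyclic_right hxyz
        · exact hs
        · exact hs.cyclic_left
        · exact hs.cyclic_right
      rw [hG.row_zero_swap h (Or.inr hxzy)]
      exact hV x z y (by rw [insert_swap]; exact h) hxzy
  induction hA with
  | single =>
    obtain ⟨i, j, k, hs, rfl⟩ := nc.exists_sbtw t₀ ht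
    obtain ⟨G, h1, h2, -⟩ := hS.exists_triangleSection ht hs isOSp_one
    obtain ⟨n1, n2, n3⟩ := sbtw_ne hs
    refine ⟨G, h1, h2, fun x => if x = i then G i j k 0 else if x = j then G j k i 0 else G k i j 0,
      rows hs h1 _ ?_⟩
    intro x y z h hs'
    left
    rcases triple_eq_of_sbtw hs hs' h with ⟨rfl, rfl, rfl⟩ | ⟨rfl, rfl, rfl⟩ | ⟨rfl, rfl, rfl⟩
    · simp
    · simp [n1.symm]
    · simp [n2.symm, n3.symm]
  | @attach T i j k l hA h hs hs' hn ih =>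
    have hT' : T ⊆ S.tri := fun t h => hT (Set.mem_insert_of_mem _ h)
    obtain ⟨G, hG, hO, V, hV⟩ := ih hT'
    have hl : {i, k, l} ∈ S.tri := hT (Set.mem_insert _ _)
    have hnT : ({i, k, l} : Finset (Fin n)) ∉ T := fun h => hn _ h (by simp)
    obtain ⟨n1, n2, n3⟩ := sbtw_ne hs
    obtain ⟨-, n4, n5⟩ := sbtw_ne hs'
    have hikj : {i, k, j} ∈ T := by rwa [insert_swap]
    have hkij : {k, i, j} ∈ T := by rwa [← insert_rotate]
    have hc : IsOSp (S.crossing i k * G i k j) := by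
      refine IsOSp.mul ?_ (hO _ _ _ hikj)
      unfold crossing; split_ifs
      exacts [isOSp_one, isOSp_matRho]
    obtain ⟨G', hG', hO', hv⟩ := hS.exists_triangleSection hl hs' hc
    have hv' : G' k i l = S.crossing k i * G k i j := by
      have e1 : G' i k l = matE (S.lam k i) * G' k i l :=
        hG'.side k l i (insert_rotate _ _ _) hs'.cyclic_left
      have e2 := hG.side i j k h hs
      apply IsOSp.mul_left_cancel (hS.isOSp_side hl (i := k) (j := i) (by simp) (by simp) n2.symm)
      rw [← e1, hv, e2, hS.crossing_symm hl (by simp) (by simp) n2, lam_comm S k i]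
      have hE := hG.side i j k h hs
      -- Triviality of the holonomy around the four-cycle at a diagonal: `ρ E(λ)` is the inverse of
      -- `E(λ)`.
      have : (matE (S.lam i k) * (matRho * matE (S.lam i k)) : SuperMatrix K M) = 1 := by
        have hu := (matE_mul_matEInv (IsPosEven.lam n2 (hS.root_pos_of_mem hl (i := i) (j := k)
          (by simp) (by simp) n2)).isUnit).1
        have : (matRho * matE (S.lam i k) : SuperMatrix K M) = matEInv (S.lam i k) := by
          ext a b; fin_cases a <;> fin_cases b <;>
            simp [matRho, matE, matEInv, Matrix.mul_apply, Fin.sum_univ_three]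
        rw [this, hu]
      have hcm : (S.crossing i k * matE (S.lam i k) : SuperMatrix K M)
          = matE (S.lam i k) * S.crossing i k := by
        unfold crossing; split_ifs
        · rw [one_mul, mul_one]
        · exact matRho_mul_matE _
      rw [mul_assoc, ← mul_assoc (S.crossing i k), hcm, mul_assoc, ← mul_assoc matRho,
        ← mul_assoc (matE (S.lam i k)), this, one_mul]
    classical
    refine ⟨fun x y z => if ({x, y, z} : Finset (Fin n)) = {i, k, l} then G' x y z else G x y z,
      ⟨?_, ?_, ?_⟩, ?_, fun x => if x = l then G' l i k 0 else V x, ?_⟩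
    · intro x y z hm hxyz
      rcases hm with hm | hm
      · rw [if_pos hm, if_pos (by rw [insert_swap]; exact hm)]; exact hG'.angle x y z hm hxyz
      · have : ({x, y, z} : Finset (Fin n)) ≠ {i, k, l} := by intro e; exact hnT (e ▸ hm)
        rw [if_neg this, if_neg (by rw [insert_swap]; exact this)]; exact hG.angle x y z hm hxyz
    · intro x y z hm hxyz
      have e1 : ({z, x, y} : Finset (Fin n)) = {x, y, z} := (insert_rotate z x y).symm
      rcases hm with hm | hm
      · rw [if_pos (e1.trans hm), if_pos ((insert_swap _ _ _).trans hm)]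
        exact hG'.side x y z hm hxyz
      · have : ({x, y, z} : Finset (Fin n)) ≠ {i, k, l} := by intro e; exact hnT (e ▸ hm)
        rw [if_neg (by rw [e1]; exact this), if_neg (by rw [insert_swap]; exact this)]
        exact hG.side x y z hm hxyz
    · intro x y z w h1 h2 hzw
      have ncz := nc.ne (hT h1)
      rcases h1 with h1 | h1 <;> rcases h2 with h2 | h2
      · exact absurd (third_unique (Eq.trans h1 (Eq.symm h2)) ncz.2.1 ncz.2.2) hzw
      · have : ({x, y, w} : Finset (Fin n)) ≠ {i, k, l} := by intro e; exact hnT (e ▸ h2)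
        rw [if_pos h1, if_neg this]
        obtain ⟨rfl, rfl, ⟨rfl, rfl⟩ | ⟨rfl, rfl⟩⟩ := shared_side nc hT' h hs' hl hn h2 h1
        · rw [hv, ← mul_assoc, crossing_mul_self, one_mul]
        · rw [hv', ← mul_assoc, crossing_mul_self, one_mul]
      · have : ({x, y, z} : Finset (Fin n)) ≠ {i, k, l} := by intro e; exact hnT (e ▸ h1)
        rw [if_pos h2, if_neg this]
        obtain ⟨rfl, rfl, ⟨rfl, rfl⟩ | ⟨rfl, rfl⟩⟩ := shared_side nc hT' h hs' hl hn h1 h2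
        · exact hv
        · exact hv'
      · have e1 : ({x, y, z} : Finset (Fin n)) ≠ {i, k, l} := by intro e; exact hnT (e ▸ h1)
        have e2 : ({x, y, w} : Finset (Fin n)) ≠ {i, k, l} := by intro e; exact hnT (e ▸ h2)
        rw [if_neg e1, if_neg e2]
        exact hG.cross x y z w h1 h2 hzw
    · intro x y z hm
      beta_reduce
      rcases hm with hm | hm
      · rw [if_pos hm]; exact hO' _ _ _ hm
      · have : ({x, y, z} : Finset (Fin n)) ≠ {i, k, l} := by intro e; exact hnT (e ▸ hm)
        rw [if_neg this]; exact hO _ _ _ hm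
    · intro x y z hm
      beta_reduce
      rcases hm with hm | hm
      · rw [if_pos hm]
        refine rows hs' hG' (fun x => if x = l then G' l i k 0 else V x) ?_ x y z hm
        intro x y z hm hxyz
        rcases triple_eq_of_sbtw hs' hxyz hm with
          ⟨rfl, rfl, rfl⟩ | ⟨rfl, rfl, rfl⟩ | ⟨rfl, rfl, rfl⟩
        · rw [if_neg n4, hv]
          rcases crossing_mul_row_zero S x y (G x y j) with e | e <;> rw [e] <;>
            rcases hV _ _ _ hikj with e' | e' <;> simp [e']
        · rw [if_neg n5, hG'.row_zero_swap hm (Or.inl hxyz), hv']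
          rcases crossing_mul_row_zero S x z (G x z j) with e | e <;> rw [e] <;>
            rcases hV _ _ _ hkij with e' | e' <;> simp [e']
        · rw [if_pos rfl]; exact Or.inl rfl
      · have : ({x, y, z} : Finset (Fin n)) ≠ {i, k, l} := by intro e; exact hnT (e ▸ hm)
        have hxl : x ≠ l := by rintro rfl; exact hn _ hm (by simp)
        rw [if_neg this, if_neg hxl]
        exact hV _ _ _ hm

/-- Spin equivalences realize every change of orientation of the interior diagonals. -/
theorem IsAssembled.exists_reverse (nc : IsNonCrossing S.tri)
    (hA : IsAssembled t₀ T) (hT : T ⊆ S.tri) (W : Fin n → Fin n → Prop)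
    (hW : ∀ x y, W x y ↔ W y x) :
    ∃ R ⊆ T, ∀ x y z w, {x, y, z} ∈ T → {x, y, w} ∈ T → z ≠ w →
      (({x, y, z} ∈ R ↔ {x, y, w} ∈ R) ↔ ¬ W x y) := by
  have aux₁ : ∀ p q : Prop, ((p ↔ ¬ q) ↔ p) ↔ ¬ q := by tauto
  have aux₂ : ∀ p q : Prop, (p ↔ (p ↔ ¬ q)) ↔ ¬ q := by tauto
  induction hA with
  | single =>
    refine ⟨∅, Set.empty_subset _, ?_⟩
    intro x y z w h1 h2 hzw
    have hne := nc.ne (hT h1)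
    exact absurd (third_unique (Eq.trans h1 (Eq.symm h2)) hne.2.1 hne.2.2) hzw
  | @attach T i j k l hA h hs hs' hn ih =>
    have hT' : T ⊆ S.tri := fun t h => hT (Set.mem_insert_of_mem _ h)
    obtain ⟨R, hR, key⟩ := ih hT'
    have hl : {i, k, l} ∈ S.tri := hT (Set.mem_insert _ _)
    have hnT : ({i, k, l} : Finset (Fin n)) ∉ T := fun h => hn _ h (by simp)
    -- The attached triangle has only one old neighbour across a side, so its membership in `R'` is
    -- dictated by that of `{i, j, k}` and no other condition interferes.
    obtain ⟨R', hR', new, old⟩ : ∃ R' ⊆ insert {i, k, l} T,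
        ({i, k, l} ∈ R' ↔ ({i, j, k} ∈ R ↔ ¬ W i k)) ∧ ∀ t ∈ T, t ∈ R' ↔ t ∈ R := by
      by_cases c : ({i, j, k} ∈ R ↔ ¬ W i k)
      · refine ⟨insert {i, k, l} R, Set.insert_subset_insert hR, by simp [c], ?_⟩
        intro t ht
        have : t ≠ {i, k, l} := by rintro rfl; exact hnT ht
        simp [this]
      · refine ⟨R, hR.trans (Set.subset_insert _ _), ?_, fun t _ => Iff.rfl⟩
        have : ({i, k, l} : Finset (Fin n)) ∉ R := fun h => hnT (hR h)
        tauto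
    refine ⟨R', hR', ?_⟩
    have e0 : ∀ x y : Fin n, ((x = i ∧ y = k) ∨ (x = k ∧ y = i)) → (W x y ↔ W i k) ∧
        ({x, y, j} : Finset (Fin n)) = {i, j, k} := by
      rintro x y (⟨rfl, rfl⟩ | ⟨rfl, rfl⟩)
      · exact ⟨Iff.rfl, insert_swap _ _ _⟩
      · exact ⟨hW _ _, (insert_rotate _ _ _).symm⟩
    intro x y z w h1 h2 hzw
    have ncz := nc.ne (hT h1)
    rcases h1 with h1 | h1 <;> rcases h2 with h2 | h2
    · exact absurd (third_unique (Eq.trans h1 (Eq.symm h2)) ncz.2.1 ncz.2.2) hzw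
    · obtain ⟨e1, -, hxy⟩ := shared_side nc hT' h hs' hl hn h2 h1
      obtain ⟨a, b⟩ := e0 x y hxy
      have := old _ h2
      have p1 : {x, y, z} ∈ R' ↔ ({i, j, k} ∈ R ↔ ¬ W i k) := by rw [h1]; exact new
      rw [e1, b] at this
      rw [p1, e1, b, this, a]; exact aux₁ _ _
    · obtain ⟨e1, -, hxy⟩ := shared_side nc hT' h hs' hl hn h1 h2
      obtain ⟨a, b⟩ := e0 x y hxy
      have := old _ h1
      have p1 : {x, y, w} ∈ R' ↔ ({i, j, k} ∈ R ↔ ¬ W i k) := by rw [h2]; exact new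
      rw [e1, b] at this
      rw [p1, e1, b, this, a]; exact aux₂ _ _
    · rw [old _ h1, old _ h2]; exact key x y z w h1 h2 hzw

/-- A clockwise walk around the hexagon reaches all of its six vertices from any one of them. -/
theorem exists_holonomy_of_triangle (nc : IsNonCrossing S.tri) {u : Fin n × Fin n × Fin n}
    {x y z x' y' z' : Fin n} (h : {x, y, z} ∈ S.tri)
    (he : ({x', y', z'} : Finset (Fin n)) = {x, y, z}) (hu : ∃ H, S.Holonomy u (x, y, z) H) :
    ∃ H, S.Holonomy u (x', y', z') H := by
  have st : ∀ {v w : Fin n × Fin n × Fin n} {X : SuperMatrix K M}, S.Step v w X →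
      (∃ H, S.Holonomy u v H) → ∃ H, S.Holonomy u w H :=
    fun h ⟨H, hH⟩ => ⟨_, hH.step h⟩
  obtain ⟨i, j, k, hs, e⟩ := nc.exists_sbtw _ h
  have m1 : {i, j, k} ∈ S.tri := e ▸ h
  have m2 : {j, k, i} ∈ S.tri := by rwa [insert_rotate]
  have m3 : {k, i, j} ∈ S.tri := by rwa [← insert_rotate]
  have a1 := st (Step.angle i j k m1 hs)
  have a2 := st (Step.side i j k m1 hs)
  have a3 := st (Step.angle k i j m3 hs.cyclic_right)
  have a4 := st (Step.side k i j m3 hs.cyclic_right)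
  have a5 := st (Step.angle j k i m2 hs.cyclic_left)
  have a6 := st (Step.side j k i m2 hs.cyclic_left)
  have hi : ∃ H, S.Holonomy u (i, j, k) H := by
    rcases triple_eq hs e with e | e | e | e | e | e <;> obtain ⟨rfl, rfl, rfl⟩ := e
    · exact hu
    · exact a6 (a5 hu)
    · exact a6 (a5 (a4 (a3 hu)))
    · exact a6 (a5 (a4 (a3 (a2 hu))))
    · exact a6 hu
    · exact a6 (a5 (a4 hu))
  rcases triple_eq hs (he.trans e) with e | e | e | e | e | e <;> obtain ⟨rfl, rfl, rfl⟩ := e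
  · exact hi
  · exact a4 (a3 (a2 (a1 hi)))
  · exact a2 (a1 hi)
  · exact a1 hi
  · exact a5 (a4 (a3 (a2 (a1 hi))))
  · exact a3 (a2 (a1 hi))

theorem IsAssembled.exists_holonomy (hS : S.IsDecorated) (nc : IsNonCrossing S.tri)
    {a b c : Fin n} (ht : {a, b, c} ∈ S.tri) (hA : IsAssembled {a, b, c} T) (hT : T ⊆ S.tri) :
    ∀ x y z, {x, y, z} ∈ T → ∃ H, S.Holonomy (a, b, c) (x, y, z) H := by
  induction hA with
  | single =>
    intro x y z h
    exact exists_holonomy_of_triangle nc ht h ⟨1, Holonomy.refl⟩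
  | @attach T i j k l hA h hs hs' hn ih =>
    have hT' : T ⊆ S.tri := fun t h => hT (Set.mem_insert_of_mem _ h)
    have hl : {i, k, l} ∈ S.tri := hT (Set.mem_insert _ _)
    intro x y z hm
    rcases hm with hm | hm
    · refine exists_holonomy_of_triangle nc hl hm ?_
      have hikj : {i, k, j} ∈ T := by rwa [insert_swap]
      obtain ⟨H, hH⟩ := ih hT' i k j hikj
      have hjl : j ≠ l := by rintro rfl; exact hn _ h (by simp)
      have o := hS.orient_symm hl (i := i) (j := k) (by simp) (by simp) (sbtw_ne hs').1
      by_cases c : S.orient i k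
      · exact ⟨_, hH.step (Step.crossTail i k j l (hT' hikj) hl hjl c)⟩
      · exact ⟨_, hH.step (Step.crossHead i k j l (hT' hikj) hl hjl (by tauto))⟩
    · exact ih hT' x y z hm

end DecoratedTriangulation

end SuperTeich

end

/-! ## Numberings of the vertices -/

noncomputable section

namespace SuperTeich

variable {n N : ℕ} {c : ℕ → Fin n} {pos : Fin n → ℕ}

/-- `x` lies strictly between `a` and `b`. -/
def Btw (a b x : ℕ) : Prop := (a < x ∧ x < b) ∨ (b < x ∧ x < a)

/-- `x` lies weakly between `a` and `b`. -/
def Wbtw (a b x : ℕ) : Prop := (a ≤ x ∧ x ≤ b) ∨ (b ≤ x ∧ x ≤ a)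

/-- The cyclic order of natural numbers. -/
def Cyc (x y z : ℕ) : Prop := (x < y ∧ y < z) ∨ (y < z ∧ z < x) ∨ (z < x ∧ x < y)

/-- A numbering of the vertices of the polygon by `1, …, n` along its boundary, in one of the two
directions. -/
structure IsNumbering (pos : Fin n → ℕ) : Prop where
  inj : Function.Injective pos
  one_le : ∀ v, 1 ≤ pos v
  le : ∀ v, pos v ≤ n
  surj : ∀ k, 1 ≤ k → k ≤ n → ∃ v, pos v = k
  cyc : (∀ x y z, sbtw x y z ↔ Cyc (pos x) (pos y) (pos z)) ∨
    (∀ x y z, sbtw x y z ↔ Cyc (pos z) (pos y) (pos x))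

theorem exists_numbering_ccw (v : Fin n) : ∃ pos : Fin n → ℕ, IsNumbering pos ∧ pos v = 1 ∧
    ∀ x y z, sbtw x y z ↔ Cyc (pos x) (pos y) (pos z) := by
  have hc : ∀ x y z : Fin n, sbtw x y z ↔
      Cyc (if v.1 ≤ x.1 then x.1 - v.1 + 1 else x.1 + n - v.1 + 1)
        (if v.1 ≤ y.1 then y.1 - v.1 + 1 else y.1 + n - v.1 + 1)
        (if v.1 ≤ z.1 then z.1 - v.1 + 1 else z.1 + n - v.1 + 1) := by
    intro x y z
    have := x.2; have := y.2; have := z.2; have := v.2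
    rw [sbtw_iff_lt]
    simp only [Fin.lt_def, Cyc]
    split_ifs <;> omega
  refine ⟨fun x => if v.1 ≤ x.1 then x.1 - v.1 + 1 else x.1 + n - v.1 + 1,
    ⟨?_, ?_, ?_, ?_, Or.inl hc⟩, by simp, hc⟩
  · intro x y h
    have := x.2; have := y.2
    simp only at h
    ext
    split_ifs at h <;> omega
  · intro x; split_ifs <;> omega
  · intro x; have := x.2; split_ifs <;> omega
  · intro k h1 h2
    have := v.2
    by_cases h : k + v.1 ≤ n
    · exact ⟨⟨k + v.1 - 1, by omega⟩, by simp only; split_ifs <;> omega⟩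
    · exact ⟨⟨k + v.1 - 1 - n, by omega⟩, by simp only; split_ifs <;> omega⟩

theorem exists_numbering_cw (v : Fin n) : ∃ pos : Fin n → ℕ, IsNumbering pos ∧ pos v = 1 ∧
    ∀ x y z, sbtw x y z ↔ Cyc (pos z) (pos y) (pos x) := by
  have hc : ∀ x y z : Fin n, sbtw x y z ↔
      Cyc (if z.1 ≤ v.1 then v.1 - z.1 + 1 else v.1 + n - z.1 + 1)
        (if y.1 ≤ v.1 then v.1 - y.1 + 1 else v.1 + n - y.1 + 1)
        (if x.1 ≤ v.1 then v.1 - x.1 + 1 else v.1 + n - x.1 + 1) := by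
    intro x y z
    have := x.2; have := y.2; have := z.2; have := v.2
    rw [sbtw_iff_lt]
    simp only [Fin.lt_def, Cyc]
    split_ifs <;> omega
  refine ⟨fun x => if x.1 ≤ v.1 then v.1 - x.1 + 1 else v.1 + n - x.1 + 1,
    ⟨?_, ?_, ?_, ?_, Or.inr hc⟩, by simp, hc⟩
  · intro x y h
    have := x.2; have := y.2
    simp only at h
    ext
    split_ifs at h <;> omega
  · intro x; have := x.2; split_ifs <;> omega
  · intro x; have := x.2; have := v.2; split_ifs <;> omega
  · intro k h1 h2
    have := v.2
    by_cases h : k ≤ v.1 + 1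
    · exact ⟨⟨v.1 + 1 - k, by omega⟩, by simp only; split_ifs <;> omega⟩
    · exact ⟨⟨v.1 + n + 1 - k, by omega⟩, by simp only; split_ifs <;> omega⟩

theorem IsNumbering.crosses_iff (hp : IsNumbering pos) (p q x y : Fin n) : Crosses p q x y ↔
    (Btw (pos p) (pos q) (pos x) ∧ ¬ Wbtw (pos p) (pos q) (pos y)) ∨
      (Btw (pos p) (pos q) (pos y) ∧ ¬ Wbtw (pos p) (pos q) (pos x)) := by
  unfold Crosses
  rcases hp.cyc with h | h <;> simp only [h, Cyc, Btw, Wbtw] <;> omega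

theorem IsNumbering.isNext_iff (hp : IsNumbering pos) (u v : Fin n) :
    (IsNext u v ∨ IsNext v u) ↔ (pos u + 1 = pos v ∨ pos v + 1 = pos u ∨
      (pos u = 1 ∧ pos v = n ∧ u ≠ v) ∨ (pos v = 1 ∧ pos u = n ∧ u ≠ v)) := by
  have hu := hp.one_le u
  have hv := hp.one_le v
  have hu' := hp.le u
  have hv' := hp.le v
  have hne : u = v ↔ pos u = pos v := hp.inj.eq_iff.symm
  have key : ∀ a b : Fin n, (∀ w, ¬ Cyc (pos a) (pos w) (pos b)) ∧ a ≠ b →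
      (pos a + 1 = pos b ∨ (pos b = 1 ∧ pos a = n ∧ a ≠ b)) := by
    intro a b ⟨h, hab⟩
    have h1 := hp.le a
    have h2 := hp.one_le b
    have h3 : pos a ≠ pos b := fun e => hab (hp.inj e)
    by_cases hn : pos a = n
    · obtain ⟨w, hw⟩ := hp.surj 1 le_rfl (by omega)
      have := h w
      simp only [Cyc, hw] at this
      refine Or.inr ⟨?_, hn, hab⟩
      have := hp.le b
      omega
    · obtain ⟨w, hw⟩ := hp.surj (pos a + 1) (by omega) (by omega)
      have := h w
      simp only [Cyc, hw] at this
      omega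
  have key' : ∀ a b : Fin n, (pos a + 1 = pos b ∨ (pos b = 1 ∧ pos a = n ∧ a ≠ b)) →
      (∀ w, ¬ Cyc (pos a) (pos w) (pos b)) ∧ a ≠ b := by
    intro a b h
    refine ⟨fun w => ?_, ?_⟩
    · have := hp.one_le w
      have := hp.le w
      simp only [Cyc]; omega
    · rintro rfl; rcases h with h | h
      · omega
      · exact h.2.2 rfl
  have k1 := key u v
  have k2 := key v u
  have k3 := key' u v
  have k4 := key' v u
  unfold IsNext
  rcases hp.cyc with h | h <;> simp only [h]
  · have : (v ≠ u) = (u ≠ v) := by rw [ne_comm]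
    rw [this] at *
    grind
  · have : (v ≠ u) = (u ≠ v) := by rw [ne_comm]
    rw [this] at *
    grind

/-- A numbering of the vertices of the polygon that is adapted to a sequence of fan centers. -/
structure IsLayout (c : ℕ → Fin n) (N : ℕ) (pos : Fin n → ℕ) : Prop extends IsNumbering pos where
  one_le_N : 1 ≤ N
  zero : pos (c 0) = n
  one : pos (c 1) = 1
  -- The zigzag condition: alternate turns become nested intervals of integers.
  btw : ∀ i, i + 1 ≤ N → Btw (pos (c i)) (pos (c (i + 1))) (pos (c (i + 2)))
  last : pos (c N) + 1 = pos (c (N + 1)) ∨ pos (c (N + 1)) + 1 = pos (c N)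

/-- The direction of the numbering is chosen so that `c 1` gets `1` and its neighbour `c 0` gets
`n`. Cyclic statements about the path then become linear ones, accessible to integer arithmetic. -/
theorem IsFanCenters.exists_layout (hc : IsFanCenters c N) : ∃ pos, IsLayout c N pos := by
  obtain ⟨pos, hp, hz, h1⟩ : ∃ pos, IsNumbering pos ∧ pos (c 0) = n ∧ pos (c 1) = 1 := by
    rcases hc.first_side with h | h
    · obtain ⟨pos, hp, h1, hcyc⟩ := exists_numbering_ccw (c 1)
      refine ⟨pos, hp, ?_, h1⟩
      by_contra hn
      have a := hp.le (c 0)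
      have b := hp.one_le (c 0)
      have d : pos (c 0) ≠ 1 := fun e => h.1 (hp.inj (e.trans h1.symm))
      obtain ⟨w, hw⟩ := hp.surj n (by omega) le_rfl
      apply h.2 w
      rw [hcyc, hw, h1]; simp only [Cyc]; omega
    · obtain ⟨pos, hp, h1, hcyc⟩ := exists_numbering_cw (c 1)
      refine ⟨pos, hp, ?_, h1⟩
      by_contra hn
      have a := hp.le (c 0)
      have b := hp.one_le (c 0)
      have d : pos (c 0) ≠ 1 := fun e => h.1.symm (hp.inj (e.trans h1.symm))
      obtain ⟨w, hw⟩ := hp.surj n (by omega) le_rfl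
      apply h.2 w
      rw [hcyc, hw, h1]; simp only [Cyc]; omega
  have hturn : ∀ i, i + 1 ≤ N → Cyc (pos (c i)) (pos (c (i + 1))) (pos (c (i + 2))) ∨
      Cyc (pos (c (i + 2))) (pos (c (i + 1))) (pos (c i)) := by
    intro i hi
    have := hc.turn (i + 1) (by omega) hi
    rw [Nat.add_sub_cancel] at this
    rcases hp.cyc with h | h <;> simp only [h] at this
    · exact this
    · exact this.symm
  have halt : ∀ i, i + 2 ≤ N → (Cyc (pos (c i)) (pos (c (i + 1))) (pos (c (i + 2))) ↔
      Cyc (pos (c (i + 3))) (pos (c (i + 2))) (pos (c (i + 1)))) := by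
    intro i hi
    have : (sbtw (c i) (c (i + 1)) (c (i + 2)) ↔ sbtw (c (i + 3)) (c (i + 2)) (c (i + 1))) :=
      hc.alternate (i + 1) (by omega) (by omega)
    have t1 := hturn i (by omega)
    have t2 : Cyc (pos (c (i + 1))) (pos (c (i + 2))) (pos (c (i + 3))) ∨
        Cyc (pos (c (i + 3))) (pos (c (i + 2))) (pos (c (i + 1))) := hturn (i + 1) hi
    rcases hp.cyc with h | h <;> simp only [h] at this
    · exact this
    · simp only [Cyc] at *
      omega
  have hbtw : ∀ i, i + 1 ≤ N → Btw (pos (c i)) (pos (c (i + 1))) (pos (c (i + 2))) := by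
    intro i
    induction i with
    | zero =>
      intro h0
      have t1 := hturn 0 h0
      have b1 := hp.le (c 2)
      have b2 := hp.one_le (c 2)
      simp only [Cyc, Btw, zero_add] at *
      omega
    | succ i ih =>
      intro hi
      have t1 : Cyc (pos (c (i + 1))) (pos (c (i + 2))) (pos (c (i + 3))) ∨
        Cyc (pos (c (i + 3))) (pos (c (i + 2))) (pos (c (i + 1))) := hturn (i + 1) hi
      have t2 := halt i hi
      have t3 := ih (by omega)
      change Btw (pos (c (i + 1))) (pos (c (i + 2))) (pos (c (i + 3)))
      clear hturn halt ih
      simp only [Cyc, Btw] at *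
      omega
  refine ⟨pos, hp, hc.one_le, hz, h1, hbtw, ?_⟩
  have hl := (hp.isNext_iff _ _).1 hc.last_side
  rcases hl with h | h | h | h
  · exact Or.inl h
  · exact Or.inr h
  -- The pair `1, n` is also adjacent on the polygon, but `c (N + 1)` lies strictly between two
  -- numbers of the range and is neither of them.
  all_goals
    exfalso
    obtain ⟨m, rfl⟩ : ∃ m, N = m + 1 := ⟨N - 1, by have := hc.one_le; omega⟩
    have b := hbtw m le_rfl
    have b1 := hp.le (c m)
    have b2 := hp.one_le (c m)
    have b3 := hp.le (c (m + 1))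
    have b4 := hp.one_le (c (m + 1))
    simp only [Btw] at b
    rw [show m + 1 + 1 = m + 2 from rfl] at *
    omega

end SuperTeich

end

/-! ## The generic triangulation -/

noncomputable section

namespace SuperTeich

open DecoratedTriangulation

variable {n N : ℕ} {c : ℕ → Fin n} {pos : Fin n → ℕ}

namespace IsLayout

/-- The intervals between consecutive centers are nested, so all later centers stay inside. -/
theorem btw_of_le (hL : IsLayout c N pos) {j : ℕ} (hj : j ≤ N + 1) : ∀ d i, i + 2 + d = j →
    Btw (pos (c i)) (pos (c (i + 1))) (pos (c j)) := by
  intro d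
  induction d with
  | zero =>
    intro i hi
    subst hi
    exact hL.btw i (by omega)
  | succ d ih =>
    intro i hi
    have h1 := ih (i + 1) (by omega)
    have h2 := hL.btw i (by omega)
    rw [show i + 1 + 1 = i + 2 from rfl] at h1
    simp only [Btw] at *
    omega

theorem wbtw_of_le (hL : IsLayout c N pos) {i j : ℕ} (hi : i ≤ j) (hj : j ≤ N + 1) :
    Wbtw (pos (c i)) (pos (c (i + 1))) (pos (c j)) := by
  obtain rfl | rfl | h : j = i ∨ j = i + 1 ∨ i + 2 ≤ j := by omega
  · simp only [Wbtw]; omega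
  · simp only [Wbtw]; omega
  · have := hL.btw_of_le hj (j - (i + 2)) i (by omega)
    simp only [Btw, Wbtw] at *; omega

theorem crosses_iff' (hL : IsLayout c N pos) {i : ℕ} (hi : i + 1 ≤ N) (v : Fin n) :
    Crosses (c i) (c (i + 2)) (c (i + 1)) v ↔ Btw (pos (c i)) (pos (c (i + 2))) (pos v) := by
  rw [hL.crosses_iff]
  have := hL.btw i hi
  simp only [Btw, Wbtw] at *; omega

theorem mem_fanSegment (hL : IsLayout c N pos) {i : ℕ} (hi : i + 1 ≤ N) (t : Finset (Fin n)) :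
    t ∈ fanSegment c (i + 1) ↔ ∃ u v, t = {c (i + 1), u, v} ∧
      Wbtw (pos (c i)) (pos (c (i + 2))) (pos u) ∧ Wbtw (pos (c i)) (pos (c (i + 2))) (pos v) ∧
      pos u + 1 = pos v := by
  have arc : ∀ u, (u = c i ∨ u = c (i + 2) ∨ Crosses (c i) (c (i + 2)) (c (i + 1)) u) ↔
      Wbtw (pos (c i)) (pos (c (i + 2))) (pos u) := by
    intro u
    rw [hL.crosses_iff' hi, ← hL.inj.eq_iff, ← hL.inj.eq_iff (b := c (i + 2))]
    simp only [Btw, Wbtw]; omega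
  have e : t ∈ fanSegment c (i + 1) ↔ ∃ u v, IsNext u v ∧ t = {c (i + 1), u, v} ∧
      (u = c i ∨ u = c (i + 2) ∨ Crosses (c i) (c (i + 2)) (c (i + 1)) u) ∧
      (v = c i ∨ v = c (i + 2) ∨ Crosses (c i) (c (i + 2)) (c (i + 1)) v) := Iff.rfl
  rw [e]
  clear e
  simp only [arc]
  have hb := hL.btw i hi
  have l1 := hL.one_le (c i)
  have l2 := hL.le (c i)
  have l3 := hL.one_le (c (i + 1))
  have l4 := hL.le (c (i + 1))
  constructor
  · rintro ⟨u, v, h, rfl, hu, hv⟩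
    rcases (hL.isNext_iff u v).1 (Or.inl h) with h | h | h | h
    · exact ⟨u, v, rfl, hu, hv, h⟩
    · exact ⟨v, u, (insert_swap _ _ _).symm, hv, hu, h⟩
    -- The boundary edge joining the numbers `1` and `n` would force the arc to be the whole range,
    -- whereas `c (i + 1)` lies outside the arc.
    all_goals
      exfalso
      obtain ⟨h1, h2, -⟩ := h
      simp only [Btw, Wbtw] at *
      omega
  · rintro ⟨u, v, rfl, hu, hv, h⟩
    rcases (hL.isNext_iff u v).2 (Or.inl h) with h | h
    · exact ⟨u, v, h, rfl, hu, hv⟩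
    · exact ⟨v, u, h, (insert_swap _ _ _).symm, hv, hu⟩

theorem mem_genericTriangulation {t : Finset (Fin n)} :
    t ∈ genericTriangulation c N ↔ ∃ i, i + 1 ≤ N ∧ t ∈ fanSegment c (i + 1) := by
  constructor
  · rintro ⟨i, h1, h2, h⟩
    obtain ⟨m, rfl⟩ : ∃ m, i = m + 1 := ⟨i - 1, by omega⟩
    exact ⟨m, h2, h⟩
  · rintro ⟨i, h1, h⟩
    exact ⟨i + 1, by omega, h1, h⟩

/-- The later triangles lie on one side of the path. -/
theorem wbtw_of_mem (hL : IsLayout c N pos) {i j : ℕ} (hij : i ≤ j) (hj : j + 1 ≤ N)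
    {t : Finset (Fin n)} (ht : t ∈ fanSegment c (j + 1)) {v : Fin n} (hv : v ∈ t) :
    Wbtw (pos (c i)) (pos (c (i + 1))) (pos v) := by
  obtain ⟨a, b, rfl, ha, hb, -⟩ := (hL.mem_fanSegment hj t).1 ht
  have h1 := hL.wbtw_of_le hij (by omega)
  have h2 := hL.wbtw_of_le (i := i) (j := j + 1) (by omega) (by omega)
  have h3 := hL.wbtw_of_le (i := i) (j := j + 2) (by omega) (by omega)
  simp only [Finset.mem_insert, Finset.mem_singleton] at hv
  rcases hv with rfl | rfl | rfl
  · exact h2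
  all_goals simp only [Wbtw] at *; omega

/-- The earlier triangles lie on the other side of the path. -/
theorem not_btw_of_mem (hL : IsLayout c N pos) {i j : ℕ} (hij : j < i) (hi : i ≤ N)
    {t : Finset (Fin n)} (ht : t ∈ fanSegment c (j + 1)) {v : Fin n} (hv : v ∈ t) :
    ¬ Btw (pos (c i)) (pos (c (i + 1))) (pos v) := by
  obtain ⟨a, b, rfl, ha, hb, -⟩ := (hL.mem_fanSegment (by omega) t).1 ht
  have h0 := hL.btw j (by omega)
  have h1 := hL.wbtw_of_le (i := j + 1) (j := i) (by omega) (by omega)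
  have h2 := hL.wbtw_of_le (i := j + 1) (j := i + 1) (by omega) (by omega)
  rw [show j + 1 + 1 = j + 2 from rfl] at *
  simp only [Finset.mem_insert, Finset.mem_singleton] at hv
  rcases hv with rfl | rfl | rfl
  all_goals simp only [Btw, Wbtw] at *; omega

/-- The reason why nothing crosses: a later triangle lies entirely on one side of each edge of an
earlier one. In the same fan this is a comparison of consecutive integers, otherwise it follows from
the nesting. -/
theorem side_of_le (hL : IsLayout c N pos) {i j : ℕ} (hij : i ≤ j) (hj : j + 1 ≤ N)
    {t t' : Finset (Fin n)} (ht : t ∈ fanSegment c (i + 1)) (ht' : t' ∈ fanSegment c (j + 1))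
    {p q : Fin n} (hp : p ∈ t) (hq : q ∈ t) :
    (∀ x ∈ t', Wbtw (pos p) (pos q) (pos x)) ∨ (∀ x ∈ t', ¬ Btw (pos p) (pos q) (pos x)) := by
  obtain ⟨a, b, rfl, ha, hb, hab⟩ := (hL.mem_fanSegment (by omega) t).1 ht
  have h0 := hL.btw i (by omega)
  have key : ∀ u, u = a ∨ u = b → (∀ x ∈ t', Wbtw (pos (c (i + 1))) (pos u) (pos x)) ∨
      (∀ x ∈ t', ¬ Btw (pos (c (i + 1))) (pos u) (pos x)) := by
    intro u hu
    have hu' : Wbtw (pos (c i)) (pos (c (i + 2))) (pos u) := by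
      rcases hu with rfl | rfl
      exacts [ha, hb]
    obtain rfl | hlt : i = j ∨ i + 1 ≤ j := by omega
    · obtain ⟨a', b', rfl, ha', hb', hab'⟩ := (hL.mem_fanSegment (by omega) t').1 ht'
      simp only [Finset.mem_insert, Finset.mem_singleton, forall_eq_or_imp, forall_eq]
      simp only [Btw, Wbtw] at *
      omega
    · left
      intro x hx
      have := hL.wbtw_of_mem hlt hj ht' hx
      rw [show i + 1 + 1 = i + 2 from rfl] at *
      simp only [Btw, Wbtw] at *
      omega
  have sym1 : ∀ x y z, Wbtw x y z ↔ Wbtw y x z := by intro x y z; simp only [Wbtw]; omega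
  have sym2 : ∀ x y z, Btw x y z ↔ Btw y x z := by intro x y z; simp only [Btw]; omega
  simp only [Finset.mem_insert, Finset.mem_singleton] at hp hq
  rcases hp with rfl | hp
  · rcases hq with rfl | hq
    · right; intro x _; simp only [Btw]; omega
    · exact key q hq
  · rcases hq with rfl | hq
    · have := key p hp
      simpa only [sym1 (pos p), sym2 (pos p)] using this
    · right
      intro x _
      rcases hp with rfl | rfl <;> rcases hq with rfl | rfl <;> simp only [Btw] <;> omega

/-- The generic triangulation is a set of pairwise non-crossing triangles. -/
theorem isNonCrossing (hL : IsLayout c N pos) : IsNonCrossing (genericTriangulation c N) := by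
  constructor
  · intro t ht
    obtain ⟨i, hi, ht⟩ := mem_genericTriangulation.1 ht
    obtain ⟨a, b, rfl, ha, hb, hab⟩ := (hL.mem_fanSegment hi t).1 ht
    have h0 := hL.btw i hi
    have n1 : c (i + 1) ≠ a := by rintro rfl; simp only [Btw, Wbtw] at *; omega
    have n2 : c (i + 1) ≠ b := by rintro rfl; simp only [Btw, Wbtw] at *; omega
    have n3 : a ≠ b := by rintro rfl; omega
    rcases sbtw_or_sbtw n1 n2 n3 with h | h
    · exact ⟨_, _, _, h, rfl⟩
    · exact ⟨_, _, _, h, (insert_swap _ _ _).symm⟩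
  · intro t ht t' ht' p hp q hq x hx y hy ⟨h1, h2⟩
    obtain ⟨i, hi, ht⟩ := mem_genericTriangulation.1 ht
    obtain ⟨j, hj, ht'⟩ := mem_genericTriangulation.1 ht'
    rcases le_total i j with hij | hij
    · have h := (hL.crosses_iff p q x y).1 (Or.inl ⟨h1, h2⟩)
      rcases hL.side_of_le hij hj ht ht' hp hq with h' | h'
      · have := h' x hx; have := h' y hy; tauto
      · have := h' x hx; have := h' y hy; tauto
    · have h : Crosses x y q p := by
        left
        simp only [sbtw_iff_lt] at *; grind
      have h := (hL.crosses_iff x y q p).1 h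
      rcases hL.side_of_le hij hi ht' ht hx hy with h' | h'
      · have := h' p hp; have := h' q hq; tauto
      · have := h' p hp; have := h' q hq; tauto

end IsLayout

/-- There are no vertices beyond a boundary edge, so only one triangle can contain it. Hence the
apexes at the first and last side are determined. -/
theorem IsNonCrossing.eq_of_isNext {T : Set (Finset (Fin n))} (nc : IsNonCrossing T)
    {x y z w : Fin n} (hxy : IsNext x y ∨ IsNext y x) (h : {x, y, z} ∈ T) (h' : {x, y, w} ∈ T) :
    z = w := by
  by_contra hzw
  rcases nc.opposite h h' hzw with ⟨h1, h2⟩ | ⟨h1, h2⟩ <;> rcases hxy with e | e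
  · exact e.2 _ h1
  · exact e.2 _ h2.cyclic_left
  · exact e.2 _ h1
  · exact e.2 _ h2.cyclic_left

theorem IsAssembled.attach_of_isNonCrossing {T₀ T : Set (Finset (Fin n))} (nc : IsNonCrossing T₀)
    {t₀ : Finset (Fin n)} (hA : IsAssembled t₀ T) (hT : T ⊆ T₀) {x y z w : Fin n}
    (h : {x, y, z} ∈ T) (hw : {x, y, w} ∈ T₀) (hn : ∀ t ∈ T, w ∉ t) :
    IsAssembled t₀ (insert {x, y, w} T) := by
  have hzw : z ≠ w := by rintro rfl; exact hn _ h (by simp)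
  rcases nc.opposite (hT h) hw hzw with ⟨h1, h2⟩ | ⟨h1, h2⟩
  · exact IsAssembled.attach x z y w hA (by rwa [insert_swap]) h1 h2 hn
  · rw [Finset.insert_comm]
    exact IsAssembled.attach y z x w hA (by rwa [insert_rotate]) h2.cyclic_left h1.cyclic_right hn

namespace IsLayout

/-- The first triangles of the generic triangulation: all those in the first `i` fan segments, and
those in the next one that are within distance `r` of its beginning. -/
def initialPart (c : ℕ → Fin n) (pos : Fin n → ℕ) (i r : ℕ) : Set (Finset (Fin n)) :=
  {t | (∃ j < i, t ∈ fanSegment c (j + 1)) ∨ ∃ u v, t = {c (i + 1), u, v} ∧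
      (Wbtw (pos (c i)) (pos (c (i + 2))) (pos u) ∧ pos u ≤ pos (c i) + r ∧
        pos (c i) ≤ pos u + r) ∧
      (Wbtw (pos (c i)) (pos (c (i + 2))) (pos v) ∧ pos v ≤ pos (c i) + r ∧
        pos (c i) ≤ pos v + r) ∧ pos u + 1 = pos v}

theorem initialPart_subset (hL : IsLayout c N pos) {i r : ℕ} (hi : i + 1 ≤ N) :
    initialPart c pos i r ⊆ genericTriangulation c N := by
  rintro t (⟨j, hj, h⟩ | ⟨u, v, rfl, hu, hv, h⟩)
  · exact mem_genericTriangulation.2 ⟨j, by omega, h⟩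
  · exact mem_genericTriangulation.2 ⟨i, hi, (hL.mem_fanSegment hi _).2 ⟨u, v, rfl, hu.1, hv.1, h⟩⟩

/-- The vertices of the arc opposite to a fan center. -/
theorem exists_arc (hL : IsLayout c N pos) {i r : ℕ}
    (hr : pos (c i) + r ≤ pos (c (i + 2)) ∨ pos (c (i + 2)) + r ≤ pos (c i)) :
    ∃ u, (pos u = pos (c i) + r ∧ pos (c i) + r ≤ pos (c (i + 2))) ∨
      (pos u + r = pos (c i) ∧ pos (c (i + 2)) + r ≤ pos (c i)) := by
  have l1 := hL.one_le (c i)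
  have l2 := hL.le (c i)
  have l3 := hL.one_le (c (i + 2))
  have l4 := hL.le (c (i + 2))
  rcases hr with h | h
  · obtain ⟨u, hu⟩ := hL.surj (pos (c i) + r) (by omega) (by omega)
    exact ⟨u, Or.inl ⟨hu, h⟩⟩
  · obtain ⟨u, hu⟩ := hL.surj (pos (c i) - r) (by omega) (by omega)
    exact ⟨u, Or.inr ⟨by omega, h⟩⟩

theorem initialPart_one (hL : IsLayout c N pos) {i : ℕ} (hi : i + 1 ≤ N) :
    ∃ u, {c (i + 1), c i, u} ∈ genericTriangulation c N ∧
      (pos u = pos (c i) + 1 ∨ pos u + 1 = pos (c i)) ∧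
      Wbtw (pos (c i)) (pos (c (i + 2))) (pos u) ∧
      initialPart c pos i 1 =
        insert {c (i + 1), c i, u} {t | ∃ j < i, t ∈ fanSegment c (j + 1)} := by
  have hb := hL.btw i hi
  obtain ⟨u, hu⟩ := hL.exists_arc (i := i) (r := 1) (by simp only [Btw] at *; omega)
  have hw : Wbtw (pos (c i)) (pos (c (i + 2))) (pos u) := by simp only [Btw, Wbtw] at *; omega
  refine ⟨u, ?_, by omega, hw, ?_⟩
  · refine mem_genericTriangulation.2 ⟨i, hi, (hL.mem_fanSegment hi _).2 ?_⟩
    rcases hu with h | h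
    · exact ⟨c i, u, rfl, by simp only [Wbtw]; omega, hw, h.1.symm⟩
    · exact ⟨u, c i, (insert_swap _ _ _).symm, hw, by simp only [Wbtw]; omega, h.1⟩
  · ext t
    constructor
    · rintro (h | ⟨a, b, rfl, ⟨ha, ha'⟩, ⟨hb, hb'⟩, hab⟩)
      · exact Or.inr h
      · left
        have : (pos a = pos (c i) ∧ pos b = pos u) ∨ (pos b = pos (c i) ∧ pos a = pos u) := by
          simp only [Btw, Wbtw] at *; omega
        rcases this with ⟨e1, e2⟩ | ⟨e1, e2⟩
        · rw [hL.inj e1, hL.inj e2]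
        · rw [hL.inj e1, hL.inj e2, insert_swap]
    · rintro (h | h)
      · right
        rcases hu with h' | h'
        · exact ⟨c i, u, h, ⟨by simp only [Wbtw]; omega, by omega, by omega⟩,
            ⟨hw, by omega, by omega⟩, h'.1.symm⟩
        · exact ⟨u, c i, h.trans (insert_swap _ _ _).symm, ⟨hw, by omega, by omega⟩,
            ⟨by simp only [Wbtw]; omega, by omega, by omega⟩, h'.1⟩
      · exact Or.inl h

theorem initialPart_last (hL : IsLayout c N pos) {i r : ℕ} (hi : i + 1 ≤ N)
    (hr : pos (c i) + r = pos (c (i + 2)) ∨ pos (c (i + 2)) + r = pos (c i)) :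
    initialPart c pos i r = {t | ∃ j < i + 1, t ∈ fanSegment c (j + 1)} := by
  ext t
  constructor
  · rintro (⟨j, hj, h⟩ | ⟨a, b, rfl, ⟨ha, ha'⟩, ⟨hb, hb'⟩, hab⟩)
    · exact ⟨j, by omega, h⟩
    · exact ⟨i, by omega, (hL.mem_fanSegment hi _).2 ⟨a, b, rfl, ha, hb, hab⟩⟩
  · rintro ⟨j, hj, h⟩
    obtain hj | rfl : j < i ∨ j = i := by omega
    · exact Or.inl ⟨j, hj, h⟩
    · obtain ⟨a, b, rfl, ha, hb, hab⟩ := (hL.mem_fanSegment hi _).1 h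
      refine Or.inr ⟨a, b, rfl, ⟨ha, ?_⟩, ⟨hb, ?_⟩, hab⟩ <;> simp only [Wbtw] at * <;> omega

/-- Within a fan the next triangle is glued along the segment from the center to the vertex `u` at
distance `r`; the vertex `v` at distance `r + 1` has not occurred before. -/
theorem isAssembled_initialPart_succ (hL : IsLayout c N pos) {t₀ : Finset (Fin n)} {i r : ℕ}
    (hi : i + 1 ≤ N) (hr0 : 1 ≤ r)
    (hr : pos (c i) + (r + 1) ≤ pos (c (i + 2)) ∨ pos (c (i + 2)) + (r + 1) ≤ pos (c i))
    (hA : IsAssembled t₀ (initialPart c pos i r)) :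
    IsAssembled t₀ (initialPart c pos i (r + 1)) := by
  have hb := hL.btw i hi
  obtain ⟨a, ha⟩ := hL.exists_arc (i := i) (r := r - 1) (by omega)
  obtain ⟨u, hu⟩ := hL.exists_arc (i := i) (r := r) (by omega)
  obtain ⟨v, hv⟩ := hL.exists_arc (i := i) (r := r + 1) (by omega)
  have wa : Wbtw (pos (c i)) (pos (c (i + 2))) (pos a) := by simp only [Btw, Wbtw] at *; omega
  have wu : Wbtw (pos (c i)) (pos (c (i + 2))) (pos u) := by simp only [Btw, Wbtw] at *; omega
  have wv : Wbtw (pos (c i)) (pos (c (i + 2))) (pos v) := by simp only [Btw, Wbtw] at *; omega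
  have m1 : {c (i + 1), u, a} ∈ initialPart c pos i r := by
    have : pos a + 1 = pos u ∨ pos u + 1 = pos a := by omega
    right
    rcases this with h | h
    · exact ⟨a, u, insert_swap _ _ _, ⟨wa, by omega, by omega⟩, ⟨wu, by omega, by omega⟩, h⟩
    · exact ⟨u, a, rfl, ⟨wu, by omega, by omega⟩, ⟨wa, by omega, by omega⟩, h⟩
  have m2 : {c (i + 1), u, v} ∈ initialPart c pos i (r + 1) := by
    have : pos v + 1 = pos u ∨ pos u + 1 = pos v := by omega
    right
    rcases this with h | h
    · exact ⟨v, u, insert_swap _ _ _, ⟨wv, by omega, by omega⟩, ⟨wu, by omega, by omega⟩, h⟩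
    · exact ⟨u, v, rfl, ⟨wu, by omega, by omega⟩, ⟨wv, by omega, by omega⟩, h⟩
  have e : initialPart c pos i (r + 1) = insert {c (i + 1), u, v} (initialPart c pos i r) := by
    ext t
    constructor
    · rintro (h | ⟨x, y, rfl, ⟨hx, hx'⟩, ⟨hy, hy'⟩, hxy⟩)
      · exact Or.inr (Or.inl h)
      · by_cases hc : (pos x ≤ pos (c i) + r ∧ pos (c i) ≤ pos x + r) ∧
          (pos y ≤ pos (c i) + r ∧ pos (c i) ≤ pos y + r)
        · exact Or.inr (Or.inr ⟨x, y, rfl, ⟨hx, hc.1⟩, ⟨hy, hc.2⟩, hxy⟩)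
        · left
          have : (pos x = pos u ∧ pos y = pos v) ∨ (pos y = pos u ∧ pos x = pos v) := by
            simp only [Btw, Wbtw] at *; omega
          rcases this with ⟨e1, e2⟩ | ⟨e1, e2⟩
          · rw [hL.inj e1, hL.inj e2]
          · rw [hL.inj e1, hL.inj e2, insert_swap]
    · rintro (rfl | h | ⟨x, y, rfl, ⟨hx, hx'⟩, ⟨hy, hy'⟩, hxy⟩)
      · exact m2
      · exact Or.inl h
      · exact Or.inr ⟨x, y, rfl, ⟨hx, by omega, by omega⟩, ⟨hy, by omega, by omega⟩, hxy⟩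
  rw [e]
  refine IsAssembled.attach_of_isNonCrossing hL.isNonCrossing hA (hL.initialPart_subset hi) m1
    (hL.initialPart_subset hi m2) ?_
  rintro t (⟨j, hj, h⟩ | ⟨x, y, rfl, ⟨hx, hx'⟩, ⟨hy, hy'⟩, hxy⟩) hvt
  · have := hL.not_btw_of_mem hj (by omega) h hvt
    simp only [Btw, Wbtw] at *; omega
  · simp only [Finset.mem_insert, Finset.mem_singleton] at hvt
    rcases hvt with rfl | rfl | rfl <;> simp only [Btw, Wbtw] at * <;> omega

theorem isAssembled_initialPart (hL : IsLayout c N pos) {t₀ : Finset (Fin n)} {i : ℕ}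
    (hi : i + 1 ≤ N) (hA : IsAssembled t₀ (initialPart c pos i 1)) :
    IsAssembled t₀ {t | ∃ j < i + 1, t ∈ fanSegment c (j + 1)} := by
  have hb := hL.btw i hi
  obtain ⟨r, hr⟩ : ∃ r, pos (c i) + (r + 1) = pos (c (i + 2)) ∨
      pos (c (i + 2)) + (r + 1) = pos (c i) := by
    rcases Nat.lt_or_ge (pos (c i)) (pos (c (i + 2))) with h | h
    · exact ⟨pos (c (i + 2)) - pos (c i) - 1, by omega⟩
    · exact ⟨pos (c i) - pos (c (i + 2)) - 1, by simp only [Btw] at *; omega⟩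
  rw [← hL.initialPart_last hi hr]
  have : ∀ s, s ≤ r → IsAssembled t₀ (initialPart c pos i (s + 1)) := by
    intro s
    induction s with
    | zero => intro _; exact hA
    | succ s ih =>
      intro hs
      exact hL.isAssembled_initialPart_succ hi (by omega) (by omega) (ih (by omega))
  exact this r le_rfl

/-- The generic triangulation can be assembled starting with the triangle at its first side. -/
theorem isAssembled (hL : IsLayout c N pos) {p : Fin n}
    (hc : IsNext (c 0) (c 1) ∨ IsNext (c 1) (c 0)) (hp : {c 0, c 1, p} ∈ genericTriangulation c N) :
    IsAssembled {c 0, c 1, p} (genericTriangulation c N) := by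
  have key : ∀ i, i + 1 ≤ N → IsAssembled {c 0, c 1, p} (initialPart c pos i 1) := by
    intro i
    induction i with
    | zero =>
      intro h0
      obtain ⟨u, h1, -, -, h2⟩ := hL.initialPart_one h0
      rw [Finset.insert_comm] at h1 h2
      obtain rfl := hL.isNonCrossing.eq_of_isNext hc hp h1
      rw [h2]
      have : {t | ∃ j < 0, t ∈ fanSegment c (j + 1)} = (∅ : Set (Finset (Fin n))) := by
        ext t; simp
      rw [this]
      simpa using IsAssembled.single
    | succ i ih =>
      intro hi
      have hA := hL.isAssembled_initialPart (by omega) (ih (by omega))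
      obtain ⟨u, h1, hu, hw, h2⟩ := hL.initialPart_one hi
      rw [h2]
      have hb := hL.btw i (by omega)
      have hb' := hL.btw (i + 1) hi
      -- Consecutive fans share the side between their centers; this finds the triangle of the old
      -- fan to which the first triangle of the new one is glued.
      obtain ⟨v, hv⟩ : ∃ v, {c (i + 1 + 1), c (i + 1), v} ∈ fanSegment c (i + 1) := by
        have l1 := hL.one_le (c i)
        have l2 := hL.le (c i)
        have l3 := hL.one_le (c (i + 2))
        have l4 := hL.le (c (i + 2))
        rcases Nat.lt_or_ge (pos (c i)) (pos (c (i + 2))) with h | h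
        · obtain ⟨v, hv⟩ := hL.surj (pos (c (i + 2)) - 1) (by omega) (by omega)
          refine ⟨v, (hL.mem_fanSegment (by omega) _).2 ⟨v, c (i + 2), ?_, ?_, ?_, by omega⟩⟩
          · ext; simp; tauto
          · simp only [Wbtw]; omega
          · simp only [Wbtw]; omega
        · have : pos (c (i + 2)) < pos (c i) := by simp only [Btw] at hb; omega
          obtain ⟨v, hv⟩ := hL.surj (pos (c (i + 2)) + 1) (by omega) (by omega)
          refine ⟨v, (hL.mem_fanSegment (by omega) _).2 ⟨c (i + 2), v, ?_, ?_, ?_, by omega⟩⟩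
          · ext; simp; tauto
          · simp only [Wbtw]; omega
          · simp only [Wbtw]; omega
      refine IsAssembled.attach_of_isNonCrossing hL.isNonCrossing hA ?_ ⟨i, by omega, hv⟩ h1 ?_
      · rintro t ⟨j, hj, h⟩
        exact mem_genericTriangulation.2 ⟨j, by omega, h⟩
      · rintro t ⟨j, hj, h⟩ ht
        have := hL.not_btw_of_mem (i := i + 1) hj (by omega) h ht
        rw [show i + 1 + 1 = i + 2 from rfl, show i + 1 + 2 = i + 3 from rfl] at *
        simp only [Btw, Wbtw] at *
        omega
  obtain ⟨m, rfl⟩ : ∃ m, N = m + 1 := ⟨N - 1, by have := hL.one_le_N; omega⟩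
  have h := hL.isAssembled_initialPart le_rfl (key m le_rfl)
  convert h using 1
  ext t
  rw [mem_genericTriangulation]
  exact exists_congr fun i => and_congr_left fun _ => by omega

end IsLayout

end SuperTeich

end

/-! ## The effect of a single flip -/

noncomputable section

namespace SuperTeich

open Matrix

namespace DecoratedTriangulation

variable {K M : Type*} [Field K] [LinearOrder K] [IsStrictOrderedRing K] [AddCommGroup M]
  [Module K M] {n : ℕ}

variable {S S' : DecoratedTriangulation K M n} {G G' : Fin n → Fin n → Fin n → SuperMatrix K M}
  {i j k l x y z w : Fin n}

/-- `(i, j)` is an edge with the orientation `i → j`. -/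
def IsArrow (S : DecoratedTriangulation K M n) (i j : Fin n) : Prop := S.IsEdge i j ∧ S.orient i j

/-- The developed triangulation `(S', G')` is obtained from `(S, G)` by flipping the diagonal
`(x, y)` between the triangles `{x, y, z}` and `{x, y, w}`. -/
structure IsFlipResult (S : DecoratedTriangulation K M n)
    (G : Fin n → Fin n → Fin n → SuperMatrix K M) (x y z w : Fin n)
    (S' : DecoratedTriangulation K M n) (G' : Fin n → Fin n → Fin n → SuperMatrix K M) : Prop where
  dev : S'.IsDeveloped G'
  rows : ∀ V, IsRowSystem S.tri G V → IsRowSystem S'.tri G' V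
  mem_tri : ∀ t, t ∈ S'.tri ↔
    (t ∈ S.tri ∧ t ≠ {x, y, z} ∧ t ≠ {x, y, w}) ∨ t = {x, z, w} ∨ t = {y, z, w}
  -- The only side reversed by the flip ends at the head `y`, so everything away from `y` keeps its
  -- orientation and its values.
  arrow : S.orient x y → ∀ a b, S.IsArrow a b → a ≠ y → b ≠ y → S'.IsArrow a b
  boundary : S.orient x y → ∀ a b d d', {a, b, d} ∈ S.tri → {a, b, d'} ∈ S'.tri →
    (IsNext a b ∨ IsNext b a) → a ≠ y → b ≠ y → G' a b d' = G a b d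
  corner : S.orient x y → G' z x w 0 = G z x y 0

theorem IsFlipResult.edge (nc : IsNonCrossing S.tri) (h : S.IsFlipResult G x y z w S' G')
    {a b d : Fin n} (hd : {a, b, d} ∈ S.tri) (hab : s(a, b) ≠ s(x, y)) :
    ∃ d', {a, b, d'} ∈ S'.tri := by
  have hne := nc.ne hd
  by_cases h1 : ({a, b, d} : Finset (Fin n)) = {x, y, z}
  · have ha : a ∈ ({x, y, z} : Finset (Fin n)) := by rw [← h1]; simp
    have hb : b ∈ ({x, y, z} : Finset (Fin n)) := by rw [← h1]; simp
    simp only [Finset.mem_insert, Finset.mem_singleton] at ha hb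
    have m1 := (h.mem_tri {x, z, w}).2 (Or.inr (Or.inl rfl))
    have m2 := (h.mem_tri {y, z, w}).2 (Or.inr (Or.inr rfl))
    have : (a = x ∧ b = z) ∨ (a = z ∧ b = x) ∨ (a = y ∧ b = z) ∨ (a = z ∧ b = y) := by
      have h3 : ¬ (a = x ∧ b = y) := by rintro ⟨rfl, rfl⟩; exact hab rfl
      have h4 : ¬ (a = y ∧ b = x) := by rintro ⟨rfl, rfl⟩; exact hab Sym2.eq_swap
      grind
    rcases this with ⟨rfl, rfl⟩ | ⟨rfl, rfl⟩ | ⟨rfl, rfl⟩ | ⟨rfl, rfl⟩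
    · exact ⟨w, m1⟩
    · exact ⟨w, by rwa [Finset.insert_comm]⟩
    · exact ⟨w, m2⟩
    · exact ⟨w, by rwa [Finset.insert_comm]⟩
  · by_cases h2 : ({a, b, d} : Finset (Fin n)) = {x, y, w}
    · have ha : a ∈ ({x, y, w} : Finset (Fin n)) := by rw [← h2]; simp
      have hb : b ∈ ({x, y, w} : Finset (Fin n)) := by rw [← h2]; simp
      simp only [Finset.mem_insert, Finset.mem_singleton] at ha hb
      have m1 := (h.mem_tri {x, w, z}).2 (Or.inr (Or.inl (insert_swap _ _ _)))
      have m2 := (h.mem_tri {y, w, z}).2 (Or.inr (Or.inr (insert_swap _ _ _)))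
      have : (a = x ∧ b = w) ∨ (a = w ∧ b = x) ∨ (a = y ∧ b = w) ∨ (a = w ∧ b = y) := by
        have h3 : ¬ (a = x ∧ b = y) := by rintro ⟨rfl, rfl⟩; exact hab rfl
        have h4 : ¬ (a = y ∧ b = x) := by rintro ⟨rfl, rfl⟩; exact hab Sym2.eq_swap
        grind
      rcases this with ⟨rfl, rfl⟩ | ⟨rfl, rfl⟩ | ⟨rfl, rfl⟩ | ⟨rfl, rfl⟩
      · exact ⟨z, m1⟩
      · exact ⟨z, by rwa [Finset.insert_comm]⟩
      · exact ⟨z, m2⟩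
      · exact ⟨z, by rwa [Finset.insert_comm]⟩
    · exact ⟨d, (h.mem_tri _).2 (Or.inl ⟨hd, h1, h2⟩)⟩

theorem IsFlippable.boundary_flip
    (F : S.IsFlippable G i j k l) {a b d d' : Fin n} (hd : {a, b, d} ∈ S.tri)
    (hd' : {a, b, d'} ∈ (S.flip i j k l).tri) (hab : IsNext a b ∨ IsNext b a) (ha : a ≠ k)
    (hb : b ≠ k) : S.flipSection G i j k l a b d' = G a b d := by
  have split := sbtw_trans_split F.s₁ F.s₂
  have n1 : ¬ (a = j ∧ b = l) := by
    rintro ⟨rfl, rfl⟩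
    rcases hab with h | h
    · exact h.2 _ split.2
    · exact h.2 _ split.1.cyclic_right
  have n2 : ¬ (a = l ∧ b = j) := by
    rintro ⟨rfl, rfl⟩
    rcases hab with h | h
    · exact h.2 _ split.1.cyclic_right
    · exact h.2 _ split.2
  rcases mem_flipTri.1 hd' with ⟨h1, -, -⟩ | h1
  · rw [F.value_flip_of_mem h1, F.nc.eq_of_isNext hab hd h1]
  · obtain ⟨u, hu, e⟩ := F.new_value h1 n1 n2
    have hm : {a, b, u} ∈ S.tri := by
      rcases hu with hu | hu <;> rw [hu]
      exacts [F.m₁, F.m₂]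
    rw [e, F.nc.eq_of_isNext hab hd hm, sideSign, if_neg (by tauto), one_mul]

theorem IsFlippable.arrow_flip (F : S.IsFlippable G i j k l) {a b : Fin n} (h : S.IsArrow a b)
    (ha : a ≠ k) (hb : b ≠ k) : (S.flip i j k l).IsArrow a b := by
  obtain ⟨⟨hab, t, ht, hat, hbt⟩, o⟩ := h
  have hn := F.nc.not_mem_flip F.s₁ F.s₂ F.m₁ ht
  refine ⟨⟨hab, ?_⟩, ?_⟩
  · by_cases h1 : t = {i, j, k}
    · subst h1
      refine ⟨{i, j, l}, mem_flipTri.2 (Or.inr (Or.inr rfl)), ?_⟩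
      simp only [Finset.mem_insert, Finset.mem_singleton] at *
      tauto
    · by_cases h2 : t = {i, k, l}
      · subst h2
        refine ⟨{i, j, l}, mem_flipTri.2 (Or.inr (Or.inr rfl)), ?_⟩
        simp only [Finset.mem_insert, Finset.mem_singleton] at *
        tauto
      · exact ⟨t, mem_flipTri.2 (Or.inl ⟨ht, h1, h2⟩), hat, hbt⟩
  · rw [flip_orient_iff]
    right
    refine ⟨?_, Or.inr ⟨by tauto, o⟩⟩
    rintro ⟨rfl, rfl⟩
    exact hn hbt hat

theorem IsFlippable.corner_flip (F : S.IsFlippable G i j k l) :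
    S.flipSection G i j k l j i l = G j i k ∧ S.flipSection G i j k l l i j = G l i k := by
  obtain ⟨-, -, v3, v4, -⟩ := flipTail_values F
  rw [flipSection_tail (Finset.insert_comm _ _ _), flipSection_tail (insert_rotate _ _ _).symm]
  exact ⟨v3, v4⟩

/-- `IsFlipResult` does not record which apex comes first in the cyclic order nor the direction of
the diagonal, whence four versions. In the last two the orientation hypotheses of the fields fail
and the claims are vacuous. -/
theorem IsFlippable.isFlipResult (hK : ∀ x : K, 0 < x → IsSquare x)
    (F : S.IsFlippable G i j k l) :
    S.IsFlipResult G i k j l (S.flip i j k l) (S.flipSection G i j k l) ∧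
    S.IsFlipResult G i k l j (S.flip i j k l) (S.flipSection G i j k l) ∧
    S.IsFlipResult G k i j l (S.flip i j k l) (S.flipSection G i j k l) ∧
    S.IsFlipResult G k i l j (S.flip i j k l) (S.flipSection G i j k l) := by
  have dev := F.isDeveloped_flip hK
  have rows := fun V => F.isRowSystem_flip hK (V := V)
  have o := (F.dec.orient_symm F.m₁ (by simp) (by simp) F.isQuad.ik).1 F.or
  have e1 : ({i, k, j} : Finset (Fin n)) = {i, j, k} := insert_swap _ _ _
  have e2 : ({k, i, j} : Finset (Fin n)) = {i, j, k} := (insert_rotate _ _ _).symm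
  have e3 : ({k, i, l} : Finset (Fin n)) = {i, k, l} := Finset.insert_comm _ _ _
  have e4 : ({k, j, l} : Finset (Fin n)) = {j, k, l} := Finset.insert_comm _ _ _
  have e5 : ({i, l, j} : Finset (Fin n)) = {i, j, l} := insert_swap _ _ _
  have e6 : ({k, l, j} : Finset (Fin n)) = {j, k, l} := insert_rotate _ _ _
  have mem : ∀ t, t ∈ (S.flip i j k l).tri ↔
      (t ∈ S.tri ∧ t ≠ {i, j, k} ∧ t ≠ {i, k, l}) ∨ t = {i, j, l} ∨ t = {j, k, l} := by
    intro t; rw [flip_tri, mem_flipTri, or_comm (a := t = {i, j, l})]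
  have arrow : ∀ a b, S.IsArrow a b → a ≠ k → b ≠ k → (S.flip i j k l).IsArrow a b :=
    fun a b h => F.arrow_flip h
  have bd : ∀ a b d d', {a, b, d} ∈ S.tri → {a, b, d'} ∈ (S.flip i j k l).tri →
    (IsNext a b ∨ IsNext b a) → a ≠ k → b ≠ k → S.flipSection G i j k l a b d' = G a b d :=
    fun a b d d' h h' => F.boundary_flip h h'
  obtain ⟨c1, c2⟩ := F.corner_flip
  refine ⟨⟨dev, rows, ?_, fun _ => arrow, fun _ => bd, fun _ => congrFun c1 0⟩,
    ⟨dev, rows, ?_, fun _ => arrow, fun _ => bd, fun _ => congrFun c2 0⟩,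
    ⟨dev, rows, ?_, fun h => absurd h o, fun h => absurd h o, fun h => absurd h o⟩,
    ⟨dev, rows, ?_, fun h => absurd h o, fun h => absurd h o, fun h => absurd h o⟩⟩ <;>
    intro t <;> rw [mem] <;> simp only [e1, e2, e3, e4, e5, e6] <;> tauto

/-- The result of flipping an interior diagonal of a developed triangulation. -/
theorem IsDeveloped.exists_flipResult (hK : ∀ x : K, 0 < x → IsSquare x) (hG : S.IsDeveloped G)
    (h : {x, y, z} ∈ S.tri) (h' : {x, y, w} ∈ S.tri) (hzw : z ≠ w) :
    ∃ G', S.IsFlipResult G x y z w (S.flipEdge s(x, y)) G' := by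
  have hxy := (hG.nc.ne h).1
  by_cases o : S.orient x y
  · rcases hG.isFlippable h h' hzw o with F | F <;> rw [F.flipEdge_eq] <;>
      have := F.isFlipResult hK
    · exact ⟨_, this.1⟩
    · exact ⟨_, this.2.1⟩
  · have o' : S.orient y x := by
      have := hG.dec.orient_symm h (i := y) (j := x) (by simp) (by simp) hxy.symm
      tauto
    rw [Sym2.eq_swap]
    rcases hG.isFlippable (by rwa [Finset.insert_comm]) (by rwa [Finset.insert_comm]) hzw o'
      with F | F <;> rw [F.flipEdge_eq] <;> have := F.isFlipResult hK
    · exact ⟨_, this.2.2.1⟩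
    · exact ⟨_, this.2.2.2⟩

end DecoratedTriangulation

end SuperTeich

end

/-! ## Fans during the flips of inner diagonals -/

noncomputable section

namespace SuperTeich

open Matrix DecoratedTriangulation

section Fans

variable {n N : ℕ} {c : ℕ → Fin n} {pos : Fin n → ℕ}

namespace IsLayout

theorem center_ne_of_lt (hL : IsLayout c N pos) {i j : ℕ} (hij : i < j) (hj : j ≤ N + 1) :
    c i ≠ c j := by
  intro e
  have e' : pos (c i) = pos (c j) := by rw [e]
  obtain rfl | h : j = i + 1 ∨ i + 2 ≤ j := by omega
  · obtain h | rfl : i + 1 ≤ N ∨ i = N := by omega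
    · have := hL.btw i h
      simp only [Btw] at this; omega
    · have := hL.last; omega
  · have := hL.btw_of_le hj (j - (i + 2)) i (by omega)
    simp only [Btw] at this; omega

theorem center_inj (hL : IsLayout c N pos) {i j : ℕ} (hi : i ≤ N + 1) (hj : j ≤ N + 1)
    (e : c i = c j) : i = j := by
  rcases lt_trichotomy i j with h | h | h
  · exact absurd e (hL.center_ne_of_lt h hj)
  · exact h
  · exact absurd e.symm (hL.center_ne_of_lt h hi)

/-- Interior vertices of an arc belong to one fan only; therefore flips of inner diagonals in
different fans do not interact. -/
theorem arc_disjoint (hL : IsLayout c N pos) {i j : ℕ} (hi : i + 1 ≤ N) (hj : j + 1 ≤ N)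
    {v : ℕ} (hv : Btw (pos (c i)) (pos (c (i + 2))) v)
    (hv' : Wbtw (pos (c j)) (pos (c (j + 2))) v) : i = j := by
  have b1 := hL.btw i hi
  have b2 := hL.btw j hj
  rcases lt_trichotomy i j with h | h | h
  · have h1 := hL.wbtw_of_le (i := i + 1) (j := j) (by omega) (by omega)
    have h2 := hL.wbtw_of_le (i := i + 1) (j := j + 2) (by omega) (by omega)
    rw [show i + 1 + 1 = i + 2 from rfl] at *
    simp only [Btw, Wbtw] at *; omega
  · exact h
  · have h1 := hL.wbtw_of_le (i := j + 1) (j := i) (by omega) (by omega)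
    have h2 := hL.wbtw_of_le (i := j + 1) (j := i + 2) (by omega) (by omega)
    rw [show j + 1 + 1 = j + 2 from rfl] at *
    simp only [Btw, Wbtw] at *; omega

theorem arc_ne_center (hL : IsLayout c N pos) {i j : ℕ} (hi : i + 1 ≤ N) (hj : j ≤ N + 1)
    {v : Fin n} (hv : Btw (pos (c i)) (pos (c (i + 2))) (pos v)) : v ≠ c j := by
  rintro rfl
  have b1 := hL.btw i hi
  rcases Nat.lt_or_ge i j with h | h
  · have h1 := hL.wbtw_of_le (i := i + 1) (j := j) (by omega) (by omega)
    rw [show i + 1 + 1 = i + 2 from rfl] at *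
    simp only [Btw, Wbtw] at *; omega
  · have h1 := hL.wbtw_of_le (i := j) (j := i) (by omega) (by omega)
    have h2 := hL.wbtw_of_le (i := j) (j := i + 2) (by omega) (by omega)
    simp only [Btw, Wbtw] at *; omega

end IsLayout

/-- The vertices of the arc opposite to `c (i + 1)` that are still joined to it when `X` is the set
of remaining inner diagonals. -/
def IsFanVertex (c : ℕ → Fin n) (pos : Fin n → ℕ) (X : Set (Sym2 (Fin n))) (i : ℕ) (v : Fin n) :
    Prop :=
  v = c i ∨ v = c (i + 2) ∨ (Btw (pos (c i)) (pos (c (i + 2))) (pos v) ∧ s(c (i + 1), v) ∈ X)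

/-- A triangulation whose fans are spanned by the remaining inner diagonals. -/
def IsFanState (c : ℕ → Fin n) (N : ℕ) (pos : Fin n → ℕ) (T : Set (Finset (Fin n)))
    (X : Set (Sym2 (Fin n))) : Prop :=
  ∀ i, i + 1 ≤ N → ∀ u v, IsFanVertex c pos X i u → IsFanVertex c pos X i v → pos u < pos v →
    (∀ w, IsFanVertex c pos X i w → ¬ (pos u < pos w ∧ pos w < pos v)) → {c (i + 1), u, v} ∈ T

variable {X : Set (Sym2 (Fin n))} {T : Set (Finset (Fin n))}

theorem IsFanVertex.wbtw {i : ℕ} {v : Fin n} (h : IsFanVertex c pos X i v) :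
    Wbtw (pos (c i)) (pos (c (i + 2))) (pos v) := by
  rcases h with rfl | rfl | ⟨h, -⟩ <;> simp only [Btw, Wbtw] at * <;> omega

theorem IsFanState.exists_pred (hT : IsFanState c N pos T X) {i : ℕ} (hi : i + 1 ≤ N) {v w : Fin n}
    (hv : IsFanVertex c pos X i v) (hw : IsFanVertex c pos X i w) (h : pos w < pos v) :
    ∃ u, IsFanVertex c pos X i u ∧ pos u < pos v ∧
      (∀ w, IsFanVertex c pos X i w → ¬ (pos u < pos w ∧ pos w < pos v)) ∧
      {c (i + 1), u, v} ∈ T := by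
  classical
  obtain ⟨u, hu, hmax⟩ := Finset.exists_max_image
    (Finset.univ.filter fun u => IsFanVertex c pos X i u ∧ pos u < pos v) pos
    ⟨w, by simp [hw, h]⟩
  simp only [Finset.mem_filter, Finset.mem_univ, true_and] at hu hmax
  have hn : ∀ w, IsFanVertex c pos X i w → ¬ (pos u < pos w ∧ pos w < pos v) :=
    fun w hw ⟨h1, h2⟩ => absurd (hmax w ⟨hw, h2⟩) (by omega)
  exact ⟨u, hu.1, hu.2, hn, hT i hi u v hu.1 hv hu.2 hn⟩

theorem IsFanState.exists_succ (hT : IsFanState c N pos T X) {i : ℕ} (hi : i + 1 ≤ N) {v w : Fin n}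
    (hv : IsFanVertex c pos X i v) (hw : IsFanVertex c pos X i w) (h : pos v < pos w) :
    ∃ u, IsFanVertex c pos X i u ∧ pos v < pos u ∧
      (∀ w, IsFanVertex c pos X i w → ¬ (pos v < pos w ∧ pos w < pos u)) ∧
      {c (i + 1), v, u} ∈ T := by
  classical
  obtain ⟨u, hu, hmin⟩ := Finset.exists_min_image
    (Finset.univ.filter fun u => IsFanVertex c pos X i u ∧ pos v < pos u) pos
    ⟨w, by simp [hw, h]⟩
  simp only [Finset.mem_filter, Finset.mem_univ, true_and] at hu hmin
  have hn : ∀ w, IsFanVertex c pos X i w → ¬ (pos v < pos w ∧ pos w < pos u) :=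
    fun w hw ⟨h1, h2⟩ => absurd (hmin w ⟨hw, h1⟩) (by omega)
  exact ⟨u, hu.1, hu.2, hn, hT i hi v u hv hu.1 hu.2 hn⟩

theorem IsFanState.exists_edge (hL : IsLayout c N pos) (hT : IsFanState c N pos T X) {i : ℕ}
    (hi : i + 1 ≤ N) {v : Fin n} (hv : IsFanVertex c pos X i v) :
    ∃ u, {c (i + 1), v, u} ∈ T := by
  have b := hL.btw i hi
  have h1 : IsFanVertex c pos X i (c i) := Or.inl rfl
  have h2 : IsFanVertex c pos X i (c (i + 2)) := Or.inr (Or.inl rfl)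
  have hne : pos (c i) ≠ pos (c (i + 2)) := by simp only [Btw] at b; omega
  obtain ⟨w, hw, hvw⟩ : ∃ w, IsFanVertex c pos X i w ∧ pos w ≠ pos v := by
    by_cases e : pos (c i) = pos v
    · exact ⟨_, h2, by omega⟩
    · exact ⟨_, h1, e⟩
  rcases Nat.lt_or_gt_of_ne hvw with h | h
  · obtain ⟨u, -, -, -, hu⟩ := hT.exists_pred hi hv hw h
    exact ⟨u, by rwa [insert_swap]⟩
  · obtain ⟨u, -, -, -, hu⟩ := hT.exists_succ hi hv hw h
    exact ⟨u, hu⟩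

theorem mem_innerDiagonals (hL : IsLayout c N pos) {e : Sym2 (Fin n)} :
    e ∈ innerDiagonals c N ↔ ∃ i v, i + 1 ≤ N ∧ Btw (pos (c i)) (pos (c (i + 2))) (pos v) ∧
      e = s(c (i + 1), v) := by
  constructor
  · rintro ⟨i, v, h1, h2, h, rfl⟩
    obtain ⟨m, rfl⟩ : ∃ m, i = m + 1 := ⟨i - 1, by omega⟩
    exact ⟨m, v, h2, (hL.crosses_iff' h2 v).1 h, rfl⟩
  · rintro ⟨i, v, h1, h, rfl⟩
    exact ⟨i + 1, v, by omega, h1, (hL.crosses_iff' h1 v).2 h, rfl⟩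

/-- The generic triangulation. -/
theorem IsLayout.isFanState (hL : IsLayout c N pos) :
    IsFanState c N pos (genericTriangulation c N) (innerDiagonals c N) := by
  intro i hi u v hu hv huv hn
  refine IsLayout.mem_genericTriangulation.2 ⟨i, hi, (hL.mem_fanSegment hi _).2
    ⟨u, v, rfl, hu.wbtw, hv.wbtw, ?_⟩⟩
  by_contra hne
  have hu' := hu.wbtw
  have hv' := hv.wbtw
  obtain ⟨w, hw⟩ := hL.surj (pos u + 1) (by omega) (by have := hL.le v; omega)
  refine hn w (Or.inr (Or.inr ?_)) ⟨by omega, by omega⟩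
  have hb : Btw (pos (c i)) (pos (c (i + 2))) (pos w) := by
    simp only [Btw, Wbtw] at *; omega
  exact ⟨hb, (mem_innerDiagonals hL).2 ⟨i, w, hi, hb, rfl⟩⟩

theorem IsFanState.triangle (hL : IsLayout c N pos) (hT : IsFanState c N pos T ∅) {i : ℕ}
    (hi : i + 1 ≤ N) : {c (i + 1), c i, c (i + 2)} ∈ T := by
  have b := hL.btw i hi
  have h1 : IsFanVertex c pos ∅ i (c i) := Or.inl rfl
  have h2 : IsFanVertex c pos ∅ i (c (i + 2)) := Or.inr (Or.inl rfl)
  have h3 : ∀ w, IsFanVertex c pos ∅ i w → w = c i ∨ w = c (i + 2) := by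
    rintro w (h | h | h)
    · exact Or.inl h
    · exact Or.inr h
    · exact absurd h.2 (by simp)
  rcases Nat.lt_or_ge (pos (c i)) (pos (c (i + 2))) with h | h
  · refine hT i hi _ _ h1 h2 h fun w hw => ?_
    rcases h3 w hw with rfl | rfl <;> omega
  · rw [insert_swap]
    refine hT i hi _ _ h2 h1 (by simp only [Btw] at b; omega) fun w hw => ?_
    rcases h3 w hw with rfl | rfl <;> omega

/-- The fans after flipping the inner diagonal `(c (i + 1), w)`. -/
theorem IsFanState.flip (hL : IsLayout c N pos) (hT : IsFanState c N pos T X) {i : ℕ}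
    (hi : i + 1 ≤ N) {w u v : Fin n} (hw : Btw (pos (c i)) (pos (c (i + 2))) (pos w))
    (hu : IsFanVertex c pos X i u) (huw : pos u < pos w)
    (hun : ∀ x, IsFanVertex c pos X i x → ¬ (pos u < pos x ∧ pos x < pos w))
    (hv : IsFanVertex c pos X i v) (hwv : pos w < pos v)
    (hvn : ∀ x, IsFanVertex c pos X i x → ¬ (pos w < pos x ∧ pos x < pos v))
    {T' : Set (Finset (Fin n))} {X' : Set (Sym2 (Fin n))}
    (hX' : ∀ e, e ∈ X' ↔ e ∈ X ∧ e ≠ s(c (i + 1), w))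
    (h1 : ∀ t ∈ T, w ∉ t → t ∈ T') (h2 : {c (i + 1), u, v} ∈ T') :
    IsFanState c N pos T' X' := by
  have down : ∀ {j x}, IsFanVertex c pos X' j x → IsFanVertex c pos X j x := by
    rintro j x (h | h | ⟨h, h'⟩)
    · exact Or.inl h
    · exact Or.inr (Or.inl h)
    · exact Or.inr (Or.inr ⟨h, ((hX' _).1 h').1⟩)
  have up : ∀ {j x}, j + 1 ≤ N → IsFanVertex c pos X j x → ¬ (j = i ∧ x = w) →
      IsFanVertex c pos X' j x := by
    rintro j x hj (h | h | ⟨h, h'⟩) hn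
    · exact Or.inl h
    · exact Or.inr (Or.inl h)
    · refine Or.inr (Or.inr ⟨h, (hX' _).2 ⟨h', fun e => ?_⟩⟩)
      rcases Sym2.eq_iff.1 e with ⟨e1, e2⟩ | ⟨e1, e2⟩
      · exact hn ⟨by have := hL.center_inj (by omega) (by omega) e1; omega, e2⟩
      · exact hL.arc_ne_center hi (j := j + 1) (by omega) hw e1.symm
  have wX' : ¬ IsFanVertex c pos X' i w := by
    rintro (h | h | ⟨-, h⟩)
    · exact hL.arc_ne_center hi (by omega) hw h
    · exact hL.arc_ne_center hi (by omega) hw h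
    · exact ((hX' _).1 h).2 rfl
  have wn : ∀ {j x}, j + 1 ≤ N → IsFanVertex c pos X' j x → w ≠ x := by
    rintro j x hj hx rfl
    have := hL.arc_disjoint hi hj hw hx.wbtw
    subst this
    exact wX' hx
  intro j hj a b ha hb hab hn
  -- After the flip no fan involves `w`, so every other triangle required below avoids the flipped
  -- diagonal.
  have hwt : w ∉ ({c (j + 1), a, b} : Finset (Fin n)) := by
    simp only [Finset.mem_insert, Finset.mem_singleton, not_or]
    exact ⟨hL.arc_ne_center hi (by omega) hw, wn hj ha, wn hj hb⟩
  by_cases hc : ∀ x, IsFanVertex c pos X j x → ¬ (pos a < pos x ∧ pos x < pos b)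
  · exact h1 _ (hT j hj a b (down ha) (down hb) hab hc) hwt
  · push Not at hc
    obtain ⟨x, hx, hax, hxb⟩ := hc
    -- New neighbours `a, b` that were not neighbours before can have been separated only by `w`;
    -- hence they are the old neighbours `u, v` of `w`.
    have hjx : j = i ∧ x = w := by
      by_contra hne
      exact hn x (up hj hx hne) ⟨hax, hxb⟩
    obtain ⟨rfl, rfl⟩ := hjx
    have e1 : a = u := by
      apply hL.inj
      have n1 := hun a (down ha)
      have n2 := hn u (up hj hu (by rintro ⟨-, rfl⟩; omega))
      omega
    have e2 : b = v := by
      apply hL.inj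
      have n1 := hvn b (down hb)
      have n2 := hn v (up hj hv (by rintro ⟨-, rfl⟩; omega))
      omega
    rw [e1, e2]; exact h2

end Fans

end SuperTeich

end

/-! ## Sequences of flips -/

noncomputable section

namespace SuperTeich

open Matrix

namespace DecoratedTriangulation

variable {K M : Type*} [Field K] [LinearOrder K] [IsStrictOrderedRing K] [AddCommGroup M]
  [Module K M] {n N : ℕ} {c : ℕ → Fin n} {pos : Fin n → ℕ}

theorem flips_cons (S : DecoratedTriangulation K M n) (e : Sym2 (Fin n)) (L : List (Sym2 (Fin n))) :
    S.flips (e :: L) = (S.flipEdge e).flips L := rfl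

theorem flips_append (S : DecoratedTriangulation K M n) (L L' : List (Sym2 (Fin n))) :
    S.flips (L ++ L') = (S.flips L).flips L' := List.foldl_append

/-- The diagonals between consecutive fan centers are oriented `c_1 → c_2 → ⋯ → c_N`. -/
def HasArrows (S : DecoratedTriangulation K M n) (c : ℕ → Fin n) (N : ℕ) : Prop :=
  ∀ i, i + 2 ≤ N → S.IsArrow (c (i + 1)) (c (i + 2))

/-- The effect of flipping inner diagonals. -/
structure IsInnerFlip (c : ℕ → Fin n) (N : ℕ) (pos : Fin n → ℕ)
    (S : DecoratedTriangulation K M n) (G : Fin n → Fin n → Fin n → SuperMatrix K M)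
    (S' : DecoratedTriangulation K M n) (G' : Fin n → Fin n → Fin n → SuperMatrix K M) : Prop where
  dev : S'.IsDeveloped G'
  arrows : S.HasArrows c N → S'.HasArrows c N
  boundary : ∀ i j d, i ≤ N + 1 → j ≤ N + 1 → {c i, c j, d} ∈ S.tri →
    (IsNext (c i) (c j) ∨ IsNext (c j) (c i)) →
    ∃ d', {c i, c j, d'} ∈ S'.tri ∧ G' (c i) (c j) d' = G (c i) (c j) d

variable {S : DecoratedTriangulation K M n} {G : Fin n → Fin n → Fin n → SuperMatrix K M}

/-- The order of the flips is irrelevant because `IsFanState` describes the triangulation by the set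
of remaining diagonals only. That part holds for any orientation; the control of arrows and boundary
values needs the diagonals to point away from the centers. -/
theorem exists_innerFlips (hK : ∀ x : K, 0 < x → IsSquare x) (hL : IsLayout c N pos)
    (L : List (Sym2 (Fin n))) (hnd : L.Nodup)
    (hmem : ∀ e ∈ L, e ∈ innerDiagonals c N) : ∀ (S : DecoratedTriangulation K M n)
    (G : Fin n → Fin n → Fin n → SuperMatrix K M), S.IsDeveloped G →
    IsFanState c N pos S.tri {e | e ∈ L} →
    ∃ G', (S.flips L).IsDeveloped G' ∧
      (∀ V, IsRowSystem S.tri G V → IsRowSystem (S.flips L).tri G' V) ∧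
      IsFanState c N pos (S.flips L).tri ∅ ∧
      ((∀ i v, i + 1 ≤ N → Btw (pos (c i)) (pos (c (i + 2))) (pos v) → s(c (i + 1), v) ∈ L →
          S.IsArrow (c (i + 1)) v) → IsInnerFlip c N pos S G (S.flips L) G') := by
  induction L with
  | nil =>
    intro S G hG hT
    refine ⟨G, hG, fun V h => h, ?_, fun _ => ⟨hG, fun h => h, ?_⟩⟩
    · change IsFanState c N pos S.tri ∅
      simpa using hT
    · intro i j d _ _ h _
      exact ⟨d, h, rfl⟩
  | cons e L ih =>
    intro S G hG hT
    obtain ⟨i, w, hi, hw, rfl⟩ := (mem_innerDiagonals hL).1 (hmem e (by simp))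
    have b := hL.btw i hi
    have fw : IsFanVertex c pos {e | e ∈ s(c (i + 1), w) :: L} i w :=
      Or.inr (Or.inr ⟨hw, by simp⟩)
    have f1 : IsFanVertex c pos {e | e ∈ s(c (i + 1), w) :: L} i (c i) := Or.inl rfl
    have f2 : IsFanVertex c pos {e | e ∈ s(c (i + 1), w) :: L} i (c (i + 2)) :=
      Or.inr (Or.inl rfl)
    obtain ⟨u, hu, huw, hun, mu⟩ : ∃ u, IsFanVertex c pos {e | e ∈ s(c (i + 1), w) :: L} i u ∧
        pos u < pos w ∧ (∀ x, IsFanVertex c pos {e | e ∈ s(c (i + 1), w) :: L} i x →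
          ¬ (pos u < pos x ∧ pos x < pos w)) ∧ {c (i + 1), u, w} ∈ S.tri := by
      rcases hw with h | h
      · exact hT.exists_pred hi fw f1 h.1
      · exact hT.exists_pred hi fw f2 h.1
    obtain ⟨v, hv, hwv, hvn, mv⟩ : ∃ u, IsFanVertex c pos {e | e ∈ s(c (i + 1), w) :: L} i u ∧
        pos w < pos u ∧ (∀ x, IsFanVertex c pos {e | e ∈ s(c (i + 1), w) :: L} i x →
          ¬ (pos w < pos x ∧ pos x < pos u)) ∧ {c (i + 1), w, u} ∈ S.tri := by
      rcases hw with h | h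
      · exact hT.exists_succ hi fw f2 h.2
      · exact hT.exists_succ hi fw f1 h.2
    have mu' : {c (i + 1), w, u} ∈ S.tri := by rwa [insert_swap]
    obtain ⟨G₁, hR⟩ := hG.exists_flipResult hK mu' mv (by rintro rfl; omega)
    have hnd' := List.nodup_cons.1 hnd
    have hst : IsFanState c N pos (S.flipEdge s(c (i + 1), w)).tri {e | e ∈ L} := by
      refine hT.flip hL hi hw hu huw hun hv hwv hvn ?_ ?_ ?_
      · intro e
        simp only [Set.mem_ofPred_eq, List.mem_cons]
        constructor
        · intro he
          exact ⟨Or.inr he, fun h => hnd'.1 (h ▸ he)⟩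
        · tauto
      · intro t ht hwt
        refine (hR.mem_tri t).2 (Or.inl ⟨ht, ?_, ?_⟩) <;> rintro rfl <;> exact hwt (by simp)
      · exact (hR.mem_tri _).2 (Or.inr (Or.inl rfl))
    obtain ⟨G', hG', hV, hfan, hres⟩ :=
      ih hnd'.2 (fun e he => hmem e (List.mem_cons_of_mem _ he)) _ G₁ hR.dev hst
    rw [flips_cons]
    refine ⟨G', hG', fun V h => hV V (hR.rows V h), hfan, ?_⟩
    intro hA
    -- The head of the flipped diagonal is the arc vertex `w`, which is not a center, so the
    -- reversed side touches neither the path of centers nor another remaining arrow.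
    have ho : S.orient (c (i + 1)) w := (hA i w hi hw (by simp)).2
    have hwc : ∀ j ≤ N + 1, c j ≠ w := fun j hj => (hL.arc_ne_center hi hj hw).symm
    have hF := hres (by
      intro j x hj hx hm
      refine hR.arrow ho _ _ (hA j x hj hx (List.mem_cons_of_mem _ hm)) (hwc _ (by omega)) ?_
      rintro rfl
      have : i = j := hL.arc_disjoint hi hj hw (by simp only [Btw, Wbtw] at *; omega)
      subst this
      exact hnd'.1 hm)
    refine ⟨hF.dev, fun h => hF.arrows fun j hj =>
      hR.arrow ho _ _ (h j hj) (hwc _ (by omega)) (hwc _ (by omega)), ?_⟩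
    intro a b d ha hb hd hab
    obtain ⟨d₁, hd₁⟩ := hR.edge hG.nc hd (by
      intro e
      rcases Sym2.eq_iff.1 e with ⟨-, e⟩ | ⟨e, -⟩
      · exact hwc _ hb e
      · exact hwc _ ha e)
    obtain ⟨d₂, hd₂, e⟩ := hF.boundary a b d₁ ha hb hd₁ hab
    exact ⟨d₂, hd₂, e.trans (hR.boundary ho _ _ _ _ hd hd₁ hab (hwc _ ha) (hwc _ hb))⟩

theorem flipsUpFrom_one (c : ℕ → Fin n) : flipsUpFrom c 1 = [] := rfl

theorem flipsUpFrom_succ (c : ℕ → Fin n) (a : ℕ) :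
    flipsUpFrom c (a + 2) = s(c (a + 1), c (a + 2)) :: flipsUpFrom c (a + 1) := by
  unfold flipsUpFrom
  rw [show a + 2 - 1 = a + 1 from rfl, show a + 1 - 1 = a from rfl, List.range'_1_concat]
  simp [add_comm 1]

/-- Flipping the diagonals between consecutive fan centers. -/
theorem exists_centerFlips (hK : ∀ x : K, 0 < x → IsSquare x) (hL : IsLayout c N pos)
    {d : Fin n} (hs : IsNext (c 0) (c 1) ∨ IsNext (c 1) (c 0)) (a : ℕ) (ha : a + 1 ≤ N)
    (hd : ∀ i ≤ a + 1, d ≠ c i) : ∀ (S : DecoratedTriangulation K M n)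
    (G : Fin n → Fin n → Fin n → SuperMatrix K M), S.IsDeveloped G →
    {c a, c (a + 1), d} ∈ S.tri → (∀ i < a, {c (i + 1), c i, c (i + 2)} ∈ S.tri) →
    ∃ G', (S.flips (flipsUpFrom c (a + 1))).IsDeveloped G' ∧
      (∀ V, IsRowSystem S.tri G V → IsRowSystem (S.flips (flipsUpFrom c (a + 1))).tri G' V) ∧
      {c 0, c 1, d} ∈ (S.flips (flipsUpFrom c (a + 1))).tri ∧
      ((∀ i < a, S.IsArrow (c (i + 1)) (c (i + 2))) →
        (∀ z, {c 0, c 1, z} ∈ S.tri → G' (c 0) (c 1) d = G (c 0) (c 1) z) ∧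
        G' d (c 1) (c 0) 0 = G d (c (a + 1)) (c a) 0) := by
  induction a with
  | zero =>
    intro S G hG h _
    refine ⟨G, hG, fun V h => h, h, fun _ => ⟨?_, rfl⟩⟩
    intro z hz
    rw [hG.nc.eq_of_isNext hs h hz]
  | succ a ih =>
    intro S G hG h hfan
    have hq := hfan a (by omega)
    have hq' : {c (a + 1), c (a + 2), c a} ∈ S.tri := by rwa [insert_swap]
    have hne : d ≠ c a := hd a (by omega)
    have hci : ∀ i ≤ a + 1, c i ≠ c (a + 2) := fun i hi => hL.center_ne_of_lt (by omega) (by omega)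
    have hdc : d ≠ c (a + 2) := hd (a + 2) le_rfl
    -- The flip of `(c (a + 1), c (a + 2))` replaces `{c (a + 1), c (a + 2), d}` by `{c a, c (a +
    -- 1), d}`. The head `c (a + 2)` plays no role in the remaining flips, so no sign arises there.
    obtain ⟨G₁, hR⟩ := hG.exists_flipResult hK h hq' hne
    have keep : ∀ t ∈ S.tri, c (a + 2) ∉ t → t ∈ (S.flipEdge s(c (a + 1), c (a + 2))).tri := by
      intro t ht hn
      refine (hR.mem_tri t).2 (Or.inl ⟨ht, ?_, ?_⟩) <;> rintro rfl <;> exact hn (by simp)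
    have hnew : {c a, c (a + 1), d} ∈ (S.flipEdge s(c (a + 1), c (a + 2))).tri := by
      refine (hR.mem_tri _).2 (Or.inr (Or.inl ?_))
      ext; simp; tauto
    obtain ⟨G', hG', hV, hm, hres⟩ := ih (by omega) (fun i hi => hd i (by omega)) _ G₁ hR.dev hnew
      (fun i hi => keep _ (hfan i (by omega)) (by
        simp only [Finset.mem_insert, Finset.mem_singleton, not_or]
        exact ⟨(hci _ (by omega)).symm, (hci _ (by omega)).symm, (hci _ (by omega)).symm⟩))
    rw [flipsUpFrom_succ, flips_cons]
    refine ⟨G', hG', fun V h => hV V (hR.rows V h), hm, ?_⟩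
    intro hA
    have ho : S.orient (c (a + 1)) (c (a + 2)) := (hA a (by omega)).2
    obtain ⟨r1, r2⟩ := hres (fun i hi => hR.arrow ho _ _ (hA i (by omega))
      (hci _ (by omega)) (hci _ (by omega)))
    refine ⟨?_, ?_⟩
    · intro z hz
      obtain ⟨z', hz'⟩ := hR.edge hG.nc hz (by
        intro e
        rcases Sym2.eq_iff.1 e with ⟨-, e⟩ | ⟨e, -⟩
        · exact hci 1 (by omega) e
        · exact hci 0 (by omega) e)
      rw [r1 z' hz', hR.boundary ho _ _ _ _ hz hz' hs (hci 0 (by omega)) (hci 1 (by omega))]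
    · rw [r2, hR.corner ho]
      exact hG.row_zero_swap (by rw [← insert_rotate d]; exact h)

end DecoratedTriangulation

end SuperTeich

end

/-! ## Rows at the corners of a triangle -/

noncomputable section

namespace SuperTeich

open Matrix

namespace DecoratedTriangulation

variable {K M : Type*} [Field K] [LinearOrder K] [IsStrictOrderedRing K] [AddCommGroup M]
  [Module K M] {n : ℕ}

variable {S : DecoratedTriangulation K M n} {G : Fin n → Fin n → Fin n → SuperMatrix K M}
  {i j k : Fin n}

theorem IsDecorated.exists_roots (hS : S.IsDecorated) (h : {i, j, k} ∈ S.tri) (hij : i ≠ j)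
    (hik : i ≠ k) (hjk : j ≠ k) : ∃ p p' q q' r r' : Subring.center (ExteriorAlgebra K M),
      S.root s(i, j) = p • 1 ∧ p * p' = 1 ∧ S.root s(j, k) = q • 1 ∧ q * q' = 1 ∧
      S.root s(i, k) = r • 1 ∧ r * r' = 1 := by
  obtain ⟨p, p', hp, hpp⟩ := (hS.root_pos_of_mem h (by simp) (by simp) hij).exists_central
  obtain ⟨q, q', hq, hqq⟩ := (hS.root_pos_of_mem h (by simp) (by simp) hjk).exists_central
  obtain ⟨r, r', hr, hrr⟩ := (hS.root_pos_of_mem h (by simp) (by simp) hik).exists_central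
  exact ⟨p, p', q, q', r, r', hp, hpp, hq, hqq, hr, hrr⟩

theorem IsDecorated.lam_mul_hLength (hS : S.IsDecorated) (h : {i, j, k} ∈ S.tri) (hij : i ≠ j)
    (hik : i ≠ k) (hjk : j ≠ k) :
    S.lam i k * S.hLength i j k = S.lam j k * Ring.inverse (S.lam i j) := by
  obtain ⟨p, p', q, q', r, r', hp, hpp, hq, hqq, hr, hrr⟩ := hS.exists_roots h hij hik hjk
  rw [hLength, lam_central hij hp, lam_central hik hr, lam_central hjk hq, smul_mul_smul_comm,
    mul_one, ringInverse_central (z' := (p' * p') * (r' * r')),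
    ringInverse_central (z' := p' * p')]
  · simp only [smul_mul_smul_comm, mul_one]
    congr 1
    linear_combination (q * q * p' * p') * (r * r' + 1) * hrr
  · linear_combination (p * p' + 1) * hpp
  · linear_combination (r * r' + 1) * hrr + (r * r') ^ 2 * (p * p' + 1) * hpp

/-- Passing along a side turns `▲` at one of its ends into `▼` at the other; this is why the
holonomy contains `▼` although the angle matrices contain `▲`. -/
theorem IsDecorated.lam_mul_muUp (hS : S.IsDecorated) (h : {i, j, k} ∈ S.tri) (hij : i ≠ j)
    (hik : i ≠ k) (hjk : j ≠ k) : S.lam i k * S.muUp i j k = S.muDown k i j := by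
  obtain ⟨p, p', q, q', r, r', hp, hpp, hq, hqq, hr, hrr⟩ := hS.exists_roots h hij hik hjk
  have hr' : S.root s(k, i) = r • 1 := by rw [Sym2.eq_swap, hr]
  have hq' : S.root s(k, j) = q • 1 := by rw [Sym2.eq_swap, hq]
  rw [muDown, if_neg (by tauto), muUp, lam_central hik hr, hp, hq, hr, hr', hq',
    smul_mul_smul_comm, mul_one, ringInverse_central hpp, ringInverse_central (z' := p' * r'),
    insert_rotate k i j]
  · simp only [smul_mul_assoc, one_mul, smul_smul]
    congr 1
    linear_combination (r * q * p') * hrr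
  · linear_combination hrr + r * r' * hpp

theorem IsDecorated.muDown_comm (hS : S.IsDecorated) (h : {i, j, k} ∈ S.tri) (hij : i ≠ j)
    (hik : i ≠ k) : S.muDown i j k = S.muDown i k j := by
  have hp := (hS.root_pos_of_mem h (i := i) (j := j) (by simp) (by simp) hij).1.commute
    (S.root s(i, k))
  unfold muDown
  rw [hp.eq, Sym2.eq_swap (a := j), insert_swap i k j]
  congr 1
  apply propext
  tauto

theorem angle_row_one (X : SuperMatrix K M) : (S.angle i j k * X) 1
    = S.hLength i j k • X 0 + X 1 - S.muUp i j k • X 2 := by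
  ext b
  simp [angle, matA, Matrix.mul_apply, Fin.sum_univ_three, sub_eq_add_neg]

/-- The first row at a corner of a triangle, in terms of the value at the opposite side. -/
theorem IsDeveloped.row_corner_of_sbtw (hG : S.IsDeveloped G) (h : {i, j, k} ∈ S.tri)
    (hs : sbtw i j k) : G k j i 0 =
      ![-(S.lam j k * Ring.inverse (S.lam i j)), -S.lam i k, S.muDown k i j] ᵥ* G i j k := by
  obtain ⟨n1, n2, n3⟩ := sbtw_ne hs
  have hk : {k, i, j} ∈ S.tri := by rwa [← insert_rotate]
  rw [← hG.row_zero_swap hk, hG.flat.side i j k h hs, matE_mul_row_zero, hG.flat.angle i j k h hs,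
    angle_row_one, ← hG.dec.lam_mul_hLength h n1 n2 n3, ← hG.dec.lam_mul_muUp h n1 n2 n3]
  ext b
  simp [Matrix.vecMul, dotProduct, Fin.sum_univ_three, mul_add, mul_sub, mul_assoc]
  abel

theorem IsDeveloped.row_corner_of_sbtw' (hG : S.IsDeveloped G) (h : {i, j, k} ∈ S.tri)
    (hs : sbtw i k j) : G k j i 0 =
      ![-(S.lam j k * Ring.inverse (S.lam i j)), S.lam i k, S.muDown k i j] ᵥ* G i j k := by
  obtain ⟨n1, n2, n3⟩ := sbtw_ne hs
  have hk : {j, i, k} ∈ S.tri := by rwa [Finset.insert_comm]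
  have hs' : sbtw j i k := hs.cyclic_right
  have u := (hG.lam_pos h).isUnit
  have e1 : S.lam j k * S.hLength j i k = S.lam i k * Ring.inverse (S.lam i j) := by
    rw [hG.dec.lam_mul_hLength hk n2.symm n3.symm n1, lam_comm S j i]
  have e2 : S.lam j k * S.muUp j i k = S.muDown k i j := by
    rw [hG.dec.lam_mul_muUp hk n2.symm n3.symm n1]
    exact (hG.dec.muDown_comm (by rwa [← insert_rotate]) n1.symm n3).symm
  have e3 : S.lam i k = (S.lam j k * S.hLength j i k) * S.lam i j := by
    rw [e1, mul_assoc, Ring.inverse_mul_cancel _ u, mul_one]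
  -- For this cyclic order the corner `k` is reached by way of `j`: along `(i, j)`, through the
  -- angle at `j`, then along `(j, k)`.
  rw [hG.flat.side j i k hk hs', matE_mul_row_zero, hG.flat.angle j i k hk hs', angle_row_one,
    hG.flat.side i k j (by rwa [insert_swap]) hs, matE_mul_row_zero, matE_mul_row_one]
  have e4 : (matE (S.lam i j) * G i j k : SuperMatrix K M) 2 = G i j k 2 := by
    ext b; simp [matE, Matrix.mul_apply, Fin.sum_univ_three]
  rw [e4, e3, ← e2]
  ext b
  simp [Matrix.vecMul, dotProduct, Fin.sum_univ_three, mul_add, mul_sub, mul_assoc]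
  abel

end DecoratedTriangulation

end SuperTeich

end

/-! ## The default orientation and the reversed fan centers -/

noncomputable section

namespace SuperTeich

open Matrix DecoratedTriangulation

section Default

variable {n N : ℕ} {c : ℕ → Fin n} {pos : Fin n → ℕ}

namespace IsLayout

theorem exists_mem_fanSegment (hL : IsLayout c N pos) {i : ℕ} (hi : i + 1 ≤ N) {v : Fin n}
    (hv : Wbtw (pos (c i)) (pos (c (i + 2))) (pos v)) : ∃ u, {c (i + 1), v, u} ∈ fanSegment c (i + 1) := by
  have b := hL.btw i hi
  have l1 := hL.one_le (c i)
  have l2 := hL.le (c i)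
  have l3 := hL.one_le (c (i + 2))
  have l4 := hL.le (c (i + 2))
  by_cases h : Wbtw (pos (c i)) (pos (c (i + 2))) (pos v + 1)
  · obtain ⟨u, hu⟩ := hL.surj (pos v + 1) (by omega) (by simp only [Wbtw] at h; omega)
    exact ⟨u, (hL.mem_fanSegment hi _).2 ⟨v, u, rfl, hv, hu ▸ h, hu.symm⟩⟩
  · obtain ⟨u, hu⟩ := hL.surj (pos v - 1) (by simp only [Btw, Wbtw] at *; omega)
      (by simp only [Btw, Wbtw] at *; omega)
    exact ⟨u, (hL.mem_fanSegment hi _).2 ⟨u, v, (insert_swap _ _ _).symm,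
      by simp only [Btw, Wbtw] at *; omega, hv, by simp only [Btw, Wbtw] at *; omega⟩⟩

theorem exists_mem_fanSegment_pair (hL : IsLayout c N pos) {i : ℕ} (hi : i + 1 ≤ N) {v : Fin n}
    (hv : Btw (pos (c i)) (pos (c (i + 2))) (pos v)) : ∃ u w, u ≠ w ∧
      {c (i + 1), v, u} ∈ fanSegment c (i + 1) ∧ {c (i + 1), v, w} ∈ fanSegment c (i + 1) := by
  have b := hL.btw i hi
  have l1 := hL.one_le (c i)
  have l2 := hL.le (c i)
  have l3 := hL.one_le (c (i + 2))
  have l4 := hL.le (c (i + 2))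
  have hv' : Wbtw (pos (c i)) (pos (c (i + 2))) (pos v) := by simp only [Btw, Wbtw] at *; omega
  obtain ⟨u, hu⟩ := hL.surj (pos v + 1) (by omega) (by simp only [Btw] at hv; omega)
  obtain ⟨w, hw⟩ := hL.surj (pos v - 1) (by simp only [Btw] at hv; omega)
    (by simp only [Btw] at hv; omega)
  have hw' : pos w + 1 = pos v := by simp only [Btw] at hv; omega
  exact ⟨u, w, by rintro rfl; omega,
    (hL.mem_fanSegment hi _).2 ⟨v, u, rfl, hv', by simp only [Btw, Wbtw] at *; omega, hu.symm⟩,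
    (hL.mem_fanSegment hi _).2 ⟨w, v, (insert_swap _ _ _).symm,
      by simp only [Btw, Wbtw] at *; omega, hv', hw'⟩⟩

theorem fanSegment_disjoint (hL : IsLayout c N pos) {i j : ℕ} (hi : i + 1 ≤ N) (hj : j + 1 ≤ N)
    {t : Finset (Fin n)} (h : t ∈ fanSegment c (i + 1)) (h' : t ∈ fanSegment c (j + 1)) :
    i = j := by
  have key : ∀ {i j : ℕ}, i < j → j + 1 ≤ N → t ∈ fanSegment c (i + 1) →
      t ∈ fanSegment c (j + 1) → False := by
    intro i j hij hj h h'
    have b := hL.btw i (by omega)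
    obtain ⟨u, v, rfl, hu, hv, huv⟩ := (hL.mem_fanSegment (by omega) _).1 h
    have h1 := hL.wbtw_of_mem (i := i + 1) hij hj h' (v := u) (by simp)
    have h2 := hL.wbtw_of_mem (i := i + 1) hij hj h' (v := v) (by simp)
    rw [show i + 1 + 1 = i + 2 from rfl] at *
    simp only [Btw, Wbtw] at *
    omega
  rcases lt_trichotomy i j with h1 | h1 | h1
  · exact (key h1 hj h h').elim
  · exact h1
  · exact (key h1 hi h' h).elim

theorem mem_ccwSegments (hL : IsLayout c N pos) {i : ℕ} (hi : i + 1 ≤ N) {t : Finset (Fin n)}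
    (h : t ∈ fanSegment c (i + 1)) :
    t ∈ ccwSegments c N ↔ sbtw (c i) (c (i + 1)) (c (i + 2)) := by
  constructor
  · rintro ⟨j, h1, h2, h3, h4⟩
    obtain ⟨m, rfl⟩ : ∃ m, j = m + 1 := ⟨j - 1, by omega⟩
    obtain rfl := hL.fanSegment_disjoint hi h2 h h4
    exact h3
  · intro hs
    exact ⟨i + 1, by omega, hi, hs, h⟩

end IsLayout

theorem ccwSegments_subset : ccwSegments c N ⊆ genericTriangulation c N :=
  fun _ ⟨i, h1, h2, _, h⟩ => ⟨i, h1, h2, h⟩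

/-- `x → y` is one of the arrows of the default orientation. -/
def IsDefaultArrow (c : ℕ → Fin n) (N : ℕ) (pos : Fin n → ℕ) (x y : Fin n) : Prop :=
  ∃ i, (i + 2 ≤ N ∧ x = c (i + 1) ∧ y = c (i + 2)) ∨
    (i + 1 ≤ N ∧ x = c (i + 1) ∧ Btw (pos (c i)) (pos (c (i + 2))) (pos y))

theorem isDefault_iff (hL : IsLayout c N pos) {o : Fin n → Fin n → Prop} :
    IsDefault c N o ↔ ∀ x y, IsDefaultArrow c N pos x y → o x y := by
  constructor
  · rintro ⟨h1, h2⟩ x y ⟨i, ⟨hi, rfl, rfl⟩ | ⟨hi, rfl, hy⟩⟩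
    · exact h1 (i + 1) (by omega) (by omega)
    · exact h2 (i + 1) y (by omega) hi ((hL.crosses_iff' hi y).2 hy)
  · intro h
    refine ⟨fun i h1 h2 => ?_, fun i v h1 h2 hv => ?_⟩
    · obtain ⟨m, rfl⟩ : ∃ m, i = m + 1 := ⟨i - 1, by omega⟩
      exact h _ _ ⟨m, Or.inl ⟨h2, rfl, rfl⟩⟩
    · obtain ⟨m, rfl⟩ : ∃ m, i = m + 1 := ⟨i - 1, by omega⟩
      exact h _ _ ⟨m, Or.inr ⟨h2, rfl, (hL.crosses_iff' h2 v).1 hv⟩⟩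

theorem IsDefaultArrow.asymm (hL : IsLayout c N pos) {x y : Fin n} (h : IsDefaultArrow c N pos x y)
    (h' : IsDefaultArrow c N pos y x) : False := by
  obtain ⟨i, ⟨hi, rfl, rfl⟩ | ⟨hi, rfl, hy⟩⟩ := h
  · obtain ⟨j, ⟨hj, e1, e2⟩ | ⟨hj, e1, hy'⟩⟩ := h'
    · have := hL.center_inj (by omega) (by omega) e1
      have := hL.center_inj (by omega) (by omega) e2
      omega
    · exact hL.arc_ne_center hj (by omega) hy' rfl
  · obtain ⟨j, ⟨hj, e1, e2⟩ | ⟨hj, e1, hy'⟩⟩ := h'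
    · exact hL.arc_ne_center hi (by omega) hy e1
    · exact hL.arc_ne_center hi (by omega) hy e1

/-- A diagonal between consecutive centers lies between two different fans, any other default arrow
between two triangles of the same fan. -/
theorem IsDefaultArrow.exists_triangles (hL : IsLayout c N pos) {x y : Fin n}
    (h : IsDefaultArrow c N pos x y) : ∃ z w, z ≠ w ∧ {x, y, z} ∈ genericTriangulation c N ∧
      {x, y, w} ∈ genericTriangulation c N := by
  obtain ⟨i, ⟨hi, rfl, rfl⟩ | ⟨hi, rfl, hy⟩⟩ := h
  · obtain ⟨u, hu⟩ := hL.exists_mem_fanSegment (i := i) (v := c (i + 2)) (by omega)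
      (by simp only [Wbtw]; omega)
    obtain ⟨v, hv⟩ := hL.exists_mem_fanSegment (i := i + 1) (v := c (i + 1)) hi
      (by simp only [Wbtw]; omega)
    rw [Finset.insert_comm] at hv
    refine ⟨u, v, ?_, IsLayout.mem_genericTriangulation.2 ⟨i, by omega, hu⟩,
      IsLayout.mem_genericTriangulation.2 ⟨i + 1, hi, hv⟩⟩
    rintro rfl
    have := hL.fanSegment_disjoint (by omega) hi hu hv
    omega
  · obtain ⟨u, v, huv, hu, hv⟩ := hL.exists_mem_fanSegment_pair hi hy
    exact ⟨u, v, huv, IsLayout.mem_genericTriangulation.2 ⟨i, hi, hu⟩,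
      IsLayout.mem_genericTriangulation.2 ⟨i, hi, hv⟩⟩

/-! ### The reversed sequence of fan centers -/

/-- The fan centers in the opposite order. -/
def revCenters (c : ℕ → Fin n) (N i : ℕ) : Fin n := c (N + 1 - i)

theorem IsFanCenters.rev (hc : IsFanCenters c N) : IsFanCenters (revCenters c N) N := by
  have h1 := hc.one_le
  refine ⟨h1, ?_, ?_, ?_, ?_⟩
  · have := hc.last_side
    simp only [revCenters, Nat.sub_zero, Nat.add_sub_cancel]; tauto
  · have := hc.first_side
    simp only [revCenters, Nat.sub_self, Nat.add_sub_cancel_left]; tauto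
  · intro i hi hN
    have := hc.turn (N + 1 - i) (by omega) (by omega)
    simp only [revCenters]
    rw [show N + 1 - i - 1 = N + 1 - (i + 1) by omega,
      show N + 1 - i + 1 = N + 1 - (i - 1) by omega] at this
    tauto
  · intro i hi hN
    have := hc.alternate (N - i) (by omega) (by omega)
    simp only [revCenters]
    rw [show N - i - 1 = N + 1 - (i + 2) by omega, show N - i = N + 1 - (i + 1) by omega,
      show N + 1 - (i + 1) + 1 = N + 1 - i by omega,
      show N + 1 - (i + 1) + 2 = N + 1 - (i - 1) by omega] at this
    exact this.symm

theorem crosses_comm (p q x y : Fin n) : Crosses p q x y ↔ Crosses q p x y := by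
  unfold Crosses; tauto

theorem fanSegment_rev {i : ℕ} (hi : 1 ≤ i) (hN : i ≤ N) :
    fanSegment (revCenters c N) i = fanSegment c (N + 1 - i) := by
  ext t
  unfold fanSegment revCenters
  simp only [Set.mem_ofPred_eq]
  rw [show N + 1 - i - 1 = N + 1 - (i + 1) by omega,
    show N + 1 - i + 1 = N + 1 - (i - 1) by omega]
  have := crosses_comm (c (N + 1 - (i + 1))) (c (N + 1 - (i - 1))) (c (N + 1 - i))
  simp only [this]
  refine exists_congr fun u => exists_congr fun v => ?_
  tauto

theorem genericTriangulation_rev :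
    genericTriangulation (revCenters c N) N = genericTriangulation c N := by
  ext t
  constructor
  · rintro ⟨i, h1, h2, h⟩
    exact ⟨N + 1 - i, by omega, by omega, by rwa [← fanSegment_rev h1 h2]⟩
  · rintro ⟨i, h1, h2, h⟩
    refine ⟨N + 1 - i, by omega, by omega, ?_⟩
    rw [fanSegment_rev (by omega) (by omega)]
    rwa [show N + 1 - (N + 1 - i) = i by omega]

theorem innerDiagonals_rev :
    innerDiagonals (revCenters c N) N = innerDiagonals c N := by
  have key : ∀ i v, 1 ≤ i → i ≤ N → (Crosses (revCenters c N (i - 1)) (revCenters c N (i + 1))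
      (revCenters c N i) v ↔ Crosses (c (N + 1 - i - 1)) (c (N + 1 - i + 1)) (c (N + 1 - i)) v) := by
    intro i v h1 h2
    rw [crosses_comm, revCenters, revCenters, revCenters,
      show N + 1 - i - 1 = N + 1 - (i + 1) by omega, show N + 1 - i + 1 = N + 1 - (i - 1) by omega]
  ext e
  constructor
  · rintro ⟨i, v, h1, h2, h, rfl⟩
    exact ⟨N + 1 - i, v, by omega, by omega, (key i v h1 h2).1 h, rfl⟩
  · rintro ⟨i, v, h1, h2, h, rfl⟩
    refine ⟨N + 1 - i, v, by omega, by omega, (key _ v (by omega) (by omega)).2 ?_, ?_⟩ <;>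
      simp only [revCenters, show N + 1 - (N + 1 - i) = i by omega]
    exact h

theorem flipsDownFrom_eq {m : ℕ} (hm : 1 ≤ m) (hN : m ≤ N) :
    flipsDownFrom c m N = flipsUpFrom (revCenters c N) (N + 1 - m) := by
  unfold flipsDownFrom flipsUpFrom
  apply List.ext_getElem
  · simp
    omega
  · intro k h1 h2
    simp only [List.length_map, List.length_range', List.length_reverse] at h1 h2
    simp only [List.getElem_map, List.getElem_range', List.getElem_reverse, List.length_map,
      List.length_range', revCenters, one_mul]
    rw [Sym2.eq_swap]
    congr 3 <;> omega

end Default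

namespace DecoratedTriangulation

variable {K M : Type*} [Field K] [LinearOrder K] [IsStrictOrderedRing K] [AddCommGroup M]
  [Module K M] {n N : ℕ} {c : ℕ → Fin n} {pos : Fin n → ℕ} {S : DecoratedTriangulation K M n}

/-- The relation `W` handed to `IsAssembled.exists_reverse` marks the diagonals whose orientation
disagrees with the default one. -/
theorem exists_isDefault_reverse (hL : IsLayout c N pos) (hS : S.IsDecorated)
    (hT : S.tri = genericTriangulation c N) {p : Fin n}
    (hs : IsNext (c 0) (c 1) ∨ IsNext (c 1) (c 0)) (hp : {c 0, c 1, p} ∈ S.tri) :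
    ∃ R ⊆ S.tri, IsDefault c N (S.reverse R).orient := by
  have nc : IsNonCrossing S.tri := hT ▸ hL.isNonCrossing
  have hA := hL.isAssembled hs (hT ▸ hp)
  rw [← hT] at hA
  obtain ⟨R, hR, key⟩ := hA.exists_reverse nc subset_rfl
    (fun x y => (IsDefaultArrow c N pos x y ∧ S.orient y x) ∨
      (IsDefaultArrow c N pos y x ∧ S.orient x y)) (fun x y => or_comm)
  refine ⟨R, hR, (isDefault_iff hL).2 ?_⟩
  intro x y hxy
  obtain ⟨z, w, hzw, hz, hw⟩ := hxy.exists_triangles hL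
  rw [← hT] at hz hw
  have k := key x y z w hz hw hzw
  have o := hS.orient_symm hz (i := x) (j := y) (by simp) (by simp) (nc.ne hz).1
  have hyx : ¬ IsDefaultArrow c N pos y x := fun h => hxy.asymm hL h
  rw [reverse_orient nc hR hz hw hzw]
  grind

/-- Consecutive turns are opposite, so exactly one of two neighbouring fans is reversed and the
arrow between their centers changes direction. Both triangles at an inner diagonal belong to the
same fan, so these arrows stay. -/
theorem isDefault_reverse_ccwSegments (hc : IsFanCenters c N) (hL : IsLayout c N pos)
    (nc : IsNonCrossing S.tri) (hT : S.tri = genericTriangulation c N)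
    (hD : IsDefault c N S.orient) :
    IsDefault (revCenters c N) N (S.reverse (ccwSegments c N)).orient := by
  have hsub : ccwSegments c N ⊆ S.tri := by rw [hT]; exact ccwSegments_subset
  have mem : ∀ {i : ℕ} {t}, i + 1 ≤ N → t ∈ fanSegment c (i + 1) → t ∈ S.tri := fun hi h => by
    rw [hT]; exact IsLayout.mem_genericTriangulation.2 ⟨_, hi, h⟩
  constructor
  · intro i h1 h2
    obtain ⟨j, rfl⟩ : ∃ j, i = N - (j + 1) := ⟨N - i - 1, by omega⟩
    have hj : j + 2 ≤ N := by omega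
    rw [revCenters, revCenters, show N + 1 - (N - (j + 1)) = j + 2 by omega,
      show N + 1 - (N - (j + 1) + 1) = j + 1 by omega]
    obtain ⟨u, hu⟩ := hL.exists_mem_fanSegment (i := j) (v := c (j + 2)) (by omega)
      (by simp only [Wbtw]; omega)
    obtain ⟨v, hv⟩ := hL.exists_mem_fanSegment (i := j + 1) (v := c (j + 1)) hj
      (by simp only [Wbtw]; omega)
    have m1 := hL.mem_ccwSegments (by omega) hu
    have m2 := hL.mem_ccwSegments hj hv
    rw [Finset.insert_comm] at hu m1
    have huv : u ≠ v := by
      rintro rfl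
      have := hL.fanSegment_disjoint (by omega) hj hu hv
      omega
    rw [show j + 1 + 1 = j + 2 from rfl] at *
    rw [reverse_orient nc hsub (mem (by omega) hu) (mem hj hv) huv, m1, m2]
    right
    refine ⟨?_, hD.1 (j + 1) (by omega) (by omega)⟩
    have alt : (sbtw (c j) (c (j + 1)) (c (j + 2)) ↔ sbtw (c (j + 3)) (c (j + 2)) (c (j + 1))) :=
      hc.alternate (j + 1) (by omega) (by omega)
    have turn : sbtw (c (j + 1)) (c (j + 2)) (c (j + 3)) ∨ sbtw (c (j + 3)) (c (j + 2)) (c (j + 1)) :=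
      hc.turn (j + 2) (by omega) hj
    have as : sbtw (c (j + 1)) (c (j + 2)) (c (j + 3)) →
      ¬ sbtw (c (j + 3)) (c (j + 2)) (c (j + 1)) := fun h => sbtw_asymm h
    rw [show j + 1 + 2 = j + 3 from rfl] at *
    tauto
  · intro i v h1 h2 h
    obtain ⟨j, rfl⟩ : ∃ j, i = N - j := ⟨N - i, by omega⟩
    have hj : j + 1 ≤ N := by omega
    simp only [revCenters] at *
    rw [show N + 1 - (N - j) = j + 1 by omega, show N + 1 - (N - j - 1) = j + 2 by omega,
      show N + 1 - (N - j + 1) = j by omega, crosses_comm] at *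
    obtain ⟨u, w, huw, hu, hw⟩ := hL.exists_mem_fanSegment_pair hj ((hL.crosses_iff' hj v).1 h)
    rw [reverse_orient nc hsub (mem hj hu) (mem hj hw) huw, hL.mem_ccwSegments hj hu,
      hL.mem_ccwSegments hj hw]
    exact Or.inl ⟨Iff.rfl, hD.2 (j + 1) v (by omega) hj h⟩

end DecoratedTriangulation

end SuperTeich

end

/-! ## Rows at the ends of the longest arc -/

noncomputable section

namespace SuperTeich

open Matrix

theorem IsNext.sbtw {n : ℕ} {x y z : Fin n} (h : IsNext x y) (hx : x ≠ z) (hy : y ≠ z) :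
    sbtw x y z :=
  (sbtw_or_sbtw h.1 hx hy).resolve_right fun hs => h.2 _ hs

theorem orientationType_eq_one {n : ℕ} {x y z : Fin n} (h : sbtw x y z) :
    orientationType x y z = 1 := if_neg fun h' => sbtw_asymm h h'

theorem orientationType_eq_zero {n : ℕ} {x y z : Fin n} (h : sbtw x z y) :
    orientationType x y z = 0 := if_pos h.cyclic_left

/-- The side of the polygon on which the triangles at a boundary edge lie. -/
theorem sbtw_of_isNext {n : ℕ} {x y : Fin n} (h : IsNext x y ∨ IsNext y x) {z w : Fin n}
    (hz : x ≠ z ∧ y ≠ z) (hw : x ≠ w ∧ y ≠ w) :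
    (sbtw x y z ∧ sbtw x y w) ∨ (sbtw x z y ∧ sbtw x w y) := by
  rcases h with h | h
  · exact Or.inl ⟨h.sbtw hz.1 hz.2, h.sbtw hw.1 hw.2⟩
  · exact Or.inr ⟨(h.sbtw hz.2 hz.1).cyclic_left, (h.sbtw hw.2 hw.1).cyclic_left⟩

namespace DecoratedTriangulation

variable {K M : Type*} [Field K] [LinearOrder K] [IsStrictOrderedRing K] [AddCommGroup M]
  [Module K M] {n N : ℕ} {c : ℕ → Fin n} {pos : Fin n → ℕ}

variable {S : DecoratedTriangulation K M n} {G : Fin n → Fin n → Fin n → SuperMatrix K M}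
  {L : List (Sym2 (Fin n))}

/-- The value at a corner of a triangle with a boundary edge. -/
theorem IsDeveloped.row_corner {i j k z : Fin n} (hG : S.IsDeveloped G) (h : {i, j, k} ∈ S.tri)
    (hb : IsNext i j ∨ IsNext j i) (hi : i ≠ z) (hj : j ≠ z) : G k j i 0 =
      ![-(S.lam j k * Ring.inverse (S.lam i j)), (-1) ^ orientationType i j z * S.lam i k,
        S.muDown k i j] ᵥ* G i j k := by
  obtain ⟨-, n2, n3⟩ := hG.nc.ne h
  rcases sbtw_of_isNext hb ⟨n2, n3⟩ ⟨hi, hj⟩ with ⟨h1, h2⟩ | ⟨h1, h2⟩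
  · rw [hG.row_corner_of_sbtw h h1, orientationType_eq_one h2, pow_one, neg_one_mul]
  · rw [hG.row_corner_of_sbtw' h h1, orientationType_eq_zero h2, pow_zero, one_mul]

/-- The value at the other end of a boundary edge. -/
theorem IsDeveloped.row_zero_reverse {i j k z : Fin n} (hG : S.IsDeveloped G)
    (h : {i, j, k} ∈ S.tri) (hb : IsNext i j ∨ IsNext j i) (hi : i ≠ z) (hj : j ≠ z) :
    -G j i k 0 = ((-1) ^ orientationType i j z * S.lam i j) • G i j k 1 := by
  obtain ⟨-, n2, n3⟩ := hG.nc.ne h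
  rcases sbtw_of_isNext hb ⟨n2, n3⟩ ⟨hi, hj⟩ with ⟨h1, h2⟩ | ⟨h1, h2⟩
  · rw [hG.row_zero_of_sbtw' h h1, orientationType_eq_one h2, pow_one, neg_one_mul, neg_smul]
  · rw [hG.row_zero_of_sbtw h h1, orientationType_eq_zero h2, pow_zero, one_mul, neg_neg]

theorem exists_flips_innerDiagonals (hK : ∀ x : K, 0 < x → IsSquare x) (hL : IsLayout c N pos)
    (hG : S.IsDeveloped G) (hT : S.tri = genericTriangulation c N) (hnd : L.Nodup)
    (hmem : ∀ e, e ∈ L ↔ e ∈ innerDiagonals c N) :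
    ∃ G', (S.flips L).IsDeveloped G' ∧
      (∀ V, IsRowSystem S.tri G V → IsRowSystem (S.flips L).tri G' V) ∧
      (∀ i, i + 1 ≤ N → {c i, c (i + 1), c (i + 2)} ∈ (S.flips L).tri) ∧
      (IsDefault c N S.orient → IsInnerFlip c N pos S G (S.flips L) G') := by
  have hX : {e | e ∈ L} = innerDiagonals c N := Set.ext hmem
  have hst : IsFanState c N pos S.tri {e | e ∈ L} := by rw [hX, hT]; exact hL.isFanState
  obtain ⟨G', h1, h2, h3, h4⟩ :=
    exists_innerFlips hK hL L hnd (fun e he => (hmem e).1 he) S G hG hst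
  refine ⟨G', h1, h2, fun i hi => ?_, fun hD => h4 ?_⟩
  · rw [Finset.insert_comm]; exact h3.triangle hL hi
  · intro i v hi hv he
    obtain ⟨u, hu⟩ := hst.exists_edge hL hi (Or.inr (Or.inr ⟨hv, he⟩))
    exact ⟨isEdge_of_mem hG.nc hu, hD.2 (i + 1) v (by omega) hi ((hL.crosses_iff' hi v).2 hv)⟩

theorem hasArrows_of_isDefault (hL : IsLayout c N pos) (nc : IsNonCrossing S.tri)
    (hT : S.tri = genericTriangulation c N) (hD : IsDefault c N S.orient) : S.HasArrows c N := by
  intro i hi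
  obtain ⟨u, hu⟩ := (hT ▸ hL.isFanState : IsFanState c N pos S.tri _).exists_edge hL (i := i)
    (v := c (i + 2)) (by omega) (Or.inr (Or.inl rfl))
  exact ⟨isEdge_of_mem nc hu, hD.1 (i + 1) (by omega) (by omega)⟩

/-- With the default orientation the value at the side `(c 0, c 1)` is that of the original section,
while the row at `c (m + 2)` is compared with the intermediate section `G₁`: only for the latter is
the relation to the last side of the polygon immediate. -/
theorem exists_flips_triangle (hK : ∀ x : K, 0 < x → IsSquare x) (hL : IsLayout c N pos)
    (hs : IsNext (c 0) (c 1) ∨ IsNext (c 1) (c 0))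
    (hG : S.IsDeveloped G) (hT : S.tri = genericTriangulation c N) (hnd : L.Nodup)
    (hmem : ∀ e, e ∈ L ↔ e ∈ innerDiagonals c N) {m : ℕ} (hm : m + 1 ≤ N) :
    ∃ G₁ G', (S.flips (L ++ flipsUpFrom c (m + 1))).IsDeveloped G' ∧
      (∀ V, IsRowSystem S.tri G V → IsRowSystem (S.flips (L ++ flipsUpFrom c (m + 1))).tri G' V) ∧
      {c 0, c 1, c (m + 2)} ∈ (S.flips (L ++ flipsUpFrom c (m + 1))).tri ∧
      (∀ i, i + 1 ≤ N → {c i, c (i + 1), c (i + 2)} ∈ (S.flips L).tri) ∧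
      (IsDefault c N S.orient → IsInnerFlip c N pos S G (S.flips L) G₁ ∧
        (∀ z, {c 0, c 1, z} ∈ S.tri → G' (c 0) (c 1) (c (m + 2)) = G (c 0) (c 1) z) ∧
        G' (c (m + 2)) (c 1) (c 0) 0 = G₁ (c (m + 2)) (c (m + 1)) (c m) 0) := by
  obtain ⟨G₁, h1, h2, h3, h4⟩ := exists_flips_innerDiagonals hK hL hG hT hnd hmem
  obtain ⟨G', k1, k2, k3, k4⟩ := exists_centerFlips hK hL hs m hm
    (fun i hi => (hL.center_ne_of_lt (i := i) (j := m + 2) (by omega) (by omega)).symm) _ G₁ h1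
    (h3 m hm) (fun i hi => by rw [Finset.insert_comm]; exact h3 i (by omega))
  rw [flips_append]
  refine ⟨G₁, G', k1, fun V h => k2 V (h2 V h), k3, h3, fun hD => ?_⟩
  have hF := h4 hD
  obtain ⟨r1, r2⟩ := k4 fun i hi =>
    hF.arrows (hasArrows_of_isDefault hL hG.nc hT hD) i (by omega)
  refine ⟨hF, fun z hz => ?_, r2⟩
  obtain ⟨z', hz', e⟩ := hF.boundary 0 1 z (by omega) (by omega) hz hs
  rw [r1 z' hz', e]

variable {ℓ : Fin n → Fin n → ExteriorAlgebra K M} {p q : Fin n}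

theorem IsInnerFlip.apply_boundary {S' : DecoratedTriangulation K M n}
    {G' : Fin n → Fin n → Fin n → SuperMatrix K M} (hF : IsInnerFlip c N pos S G S' G') {i j : ℕ}
    (hi : i ≤ N + 1) (hj : j ≤ N + 1) (hb : IsNext (c i) (c j) ∨ IsNext (c j) (c i))
    {d d' : Fin n} (hd : {c i, c j, d} ∈ S.tri) (hd' : {c i, c j, d'} ∈ S'.tri) :
    G' (c i) (c j) d' = G (c i) (c j) d := by
  obtain ⟨d₁, h1, e⟩ := hF.boundary i j d hi hj hd hb
  rw [← e, hF.dev.nc.eq_of_isNext hb hd' h1]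

/-- The vector at the end of the longest arc. -/
theorem row_last_center (hK : ∀ x : K, 0 < x → IsSquare x) (hc : IsFanCenters c N)
    (hL : IsLayout c N pos) (hG : S.IsDeveloped G) (hT : S.tri = genericTriangulation c N)
    (hnd : L.Nodup) (hmem : ∀ e, e ∈ L ↔ e ∈ innerDiagonals c N) (hD : IsDefault c N S.orient)
    (hp : {c 0, c 1, p} ∈ S.tri) (hq : {c (N + 1), c N, q} ∈ S.tri)
    -- The lengths enter through an abstract function `ℓ`, so that one and the same super `λ`-length
    -- can serve both for `D` and for `D'` with the reversed centers.
    (hℓ : ∀ m, m + 1 ≤ N → ∀ x y z, ({x, y, z} : Finset (Fin n)) = {c 0, c 1, c (m + 2)} →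
      ℓ x y = (S.flips (L ++ flipsUpFrom c (m + 1))).lam x y) :
    G (c (N + 1)) (c N) q 0 = ![-(ℓ (c 1) (c (N + 1)) * Ring.inverse (ℓ (c 0) (c 1))),
      (-1) ^ orientationType (c 0) (c 1) (c 2) * ℓ (c 0) (c (N + 1)),
      (S.flips (L ++ flipsUpFrom c N)).muDown (c (N + 1)) (c 0) (c 1)] ᵥ* G (c 0) (c 1) p := by
  obtain ⟨m, rfl⟩ : ∃ m, N = m + 1 := ⟨N - 1, by have := hc.one_le; omega⟩
  obtain ⟨G₁, G', h1, -, h3, h4, h5⟩ :=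
    exists_flips_triangle hK hL hc.first_side hG hT hnd hmem (le_refl (m + 1))
  obtain ⟨hF, e1, e2⟩ := h5 hD
  have e3 : G₁ (c (m + 2)) (c (m + 1)) (c m) = G (c (m + 2)) (c (m + 1)) q :=
    hF.apply_boundary (by omega) (by omega) hc.last_side.symm hq
      (by rw [insert_rotate, Finset.insert_comm, ← insert_rotate]; exact h4 m (by omega))
  rw [hℓ m le_rfl _ _ _ (insert_rotate (c 0) (c 1) (c (m + 2))), hℓ m le_rfl _ _ _ rfl,
    hℓ m le_rfl _ _ _ (insert_swap (c 0) (c 1) (c (m + 2))), ← e1 p hp,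
    ← h1.row_corner h3 hc.first_side
      (hL.center_ne_of_lt (by omega) (by omega)) (hL.center_ne_of_lt (by omega) (by omega)), e2, e3]

/-- The vector at the last fan center. -/
theorem row_penultimate_center (hK : ∀ x : K, 0 < x → IsSquare x) (hc : IsFanCenters c N)
    (hL : IsLayout c N pos) (hG : S.IsDeveloped G) (hT : S.tri = genericTriangulation c N)
    (hnd : L.Nodup) (hmem : ∀ e, e ∈ L ↔ e ∈ innerDiagonals c N) (hD : IsDefault c N S.orient)
    (hp : {c 0, c 1, p} ∈ S.tri) (hq : {c (N + 1), c N, q} ∈ S.tri)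
    (hℓ₀ : ∀ x, ℓ x x = 0)
    (hℓ : ∀ m, m + 1 ≤ N → ∀ x y z, ({x, y, z} : Finset (Fin n)) = {c 0, c 1, c (m + 2)} →
      ℓ x y = (S.flips (L ++ flipsUpFrom c (m + 1))).lam x y) :
    -G (c N) (c (N + 1)) q 0 = ![-(ℓ (c 1) (c N) * Ring.inverse (ℓ (c 0) (c 1))),
      (-1) ^ orientationType (c 0) (c 1) (c 2) * ℓ (c 0) (c N),
      (S.flips (L ++ flipsUpFrom c (N - 1))).muDown (c N) (c 0) (c 1)] ᵥ* G (c 0) (c 1) p := by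
  have hN := hc.one_le
  have hq' : {c N, c (N + 1), q} ∈ S.tri := by rwa [Finset.insert_comm]
  obtain rfl | ⟨m, rfl⟩ : N = 1 ∨ ∃ m, N = m + 2 :=
    (Nat.eq_or_lt_of_le hN).imp Eq.symm fun h => ⟨N - 2, by omega⟩
  -- For `N = 1` the triangle with corners `c 0, c 1, c N` degenerates. The conventions for `λ` and
  -- `▼` at coinciding indices make the formula the relation along the side `(c 0, c 1)`.
  · obtain ⟨G₁, h1, -, h3, h4⟩ := exists_flips_innerDiagonals hK hL hG hT hnd hmem
    have hF := h4 hD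
    have t := h3 0 le_rfl
    have e1 : G₁ (c 0) (c 1) (c 2) = G (c 0) (c 1) p :=
      hF.apply_boundary (by omega) (by omega) hc.first_side hp t
    have e2 : G₁ (c 1) (c 2) (c 0) = G (c 1) (c 2) q :=
      hF.apply_boundary (by omega) (by omega) hc.last_side hq' (by rwa [insert_rotate])
    have e3 : ℓ (c 0) (c 1) = (S.flips L).lam (c 0) (c 1) := by
      simpa [flipsUpFrom_one] using hℓ 0 le_rfl (c 0) (c 1) (c 2) rfl
    have e4 := h1.row_zero_reverse t hc.first_side (z := c 2)
      (hL.center_ne_of_lt (by omega) (by omega)) (hL.center_ne_of_lt (by omega) (by omega))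
    rw [← e2, h1.row_zero_swap (by rwa [insert_rotate]), e4, e1, ← e3, hℓ₀, muDown, if_pos (by tauto)]
    ext b
    simp [Matrix.vecMul, dotProduct, Fin.sum_univ_three]
  · obtain ⟨G₁, G', h1, -, h3, h4, h5⟩ :=
      exists_flips_triangle hK hL hc.first_side hG hT hnd hmem (m := m) (by omega)
    obtain ⟨hF, e1, e2⟩ := h5 hD
    have t1 : {c (m + 2), c (m + 1), c m} ∈ (S.flips L).tri := by
      rw [insert_rotate, Finset.insert_comm, ← insert_rotate]; exact h4 m (by omega)
    have t2 : {c (m + 2), c (m + 1), c (m + 3)} ∈ (S.flips L).tri := by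
      rw [Finset.insert_comm]; exact h4 (m + 1) (by omega)
    have e3 : G₁ (c (m + 2)) (c (m + 3)) (c (m + 1)) = G (c (m + 2)) (c (m + 3)) q :=
      hF.apply_boundary (by omega) (by omega) hc.last_side hq' (by rwa [insert_swap])
    have a := (hF.arrows (hasArrows_of_isDefault hL hG.nc hT hD) m (by omega)).2
    have o := hF.dev.dec.orient_symm t1 (i := c (m + 2)) (j := c (m + 1)) (by simp) (by simp)
      (hF.dev.nc.ne t1).1
    -- The diagonal `(c (N - 1), c N)` is not flipped here and has to be crossed near its head `c
    -- N`. This is the origin of the minus sign in front of the row.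
    have cr : (S.flips L).crossing (c (m + 2)) (c (m + 1)) = matRho := if_neg (by tauto)
    have e4 : G₁ (c (m + 2)) (c (m + 1)) (c m) 0 = -G (c (m + 2)) (c (m + 3)) q 0 := by
      rw [hF.dev.flat.cross _ _ _ _ t2 t1 (hL.center_ne_of_lt (by omega) (by omega)).symm, cr,
        matRho_mul_row_zero, hF.dev.row_zero_swap t2, e3]
    rw [show m + 2 - 1 = m + 1 from rfl, show m + 2 + 1 = m + 3 from rfl]
    rw [hℓ m (by omega) _ _ _ (insert_rotate (c 0) (c 1) (c (m + 2))),
      hℓ m (by omega) _ _ _ rfl,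
      hℓ m (by omega) _ _ _ (insert_swap (c 0) (c 1) (c (m + 2))), ← e1 p hp,
      ← h1.row_corner h3 hc.first_side
        (hL.center_ne_of_lt (by omega) (by omega)) (hL.center_ne_of_lt (by omega) (by omega)), e2, e4]

/-- A spin equivalence can change the vectors at the polygon vertices only by signs, so lengths
computed from `S₂` are those of `S`. The flips of `S` are needed only to show that the arc is
reached. -/
theorem superLambda_eq_lam_flips (hK : ∀ x : K, 0 < x → IsSquare x) (hL : IsLayout c N pos)
    (hs : IsNext (c 0) (c 1) ∨ IsNext (c 1) (c 0)) (hG : S.IsDeveloped G)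
    (hT : S.tri = genericTriangulation c N) {V : Fin n → Fin 3 → ExteriorAlgebra K M}
    (hV : IsRowSystem S.tri G V) {S₂ : DecoratedTriangulation K M n}
    {G₂ : Fin n → Fin n → Fin n → SuperMatrix K M} (hG₂ : S₂.IsDeveloped G₂)
    (hT₂ : S₂.tri = genericTriangulation c N) (hV₂ : IsRowSystem S₂.tri G₂ V) (hnd : L.Nodup)
    (hmem : ∀ e, e ∈ L ↔ e ∈ innerDiagonals c N) (m : ℕ) (hm : m + 1 ≤ N) (x y z : Fin n)
    (h : ({x, y, z} : Finset (Fin n)) = {c 0, c 1, c (m + 2)}) :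
    S.superLambda x y = (S₂.flips (L ++ flipsUpFrom c (m + 1))).lam x y := by
  obtain ⟨-, G', h1, h2, h3, -⟩ := exists_flips_triangle hK hL hs hG hT hnd hmem hm
  obtain ⟨-, G₂', k1, k2, k3, -⟩ := exists_flips_triangle hK hL hs hG₂ hT₂ hnd hmem hm
  rw [← h] at h3 k3
  exact IsRealized.superLambda_eq hK ⟨G, hG, hV⟩ (reaches_flips S _) ⟨G₂', k1, k2 V hV₂⟩
    (isEdge_of_mem h1.nc h3) (isEdge_of_mem k1.nc k3)

end DecoratedTriangulation

end SuperTeich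

end

/-! ## The holonomy along the longest arc -/

noncomputable section

namespace SuperTeich

open Matrix DecoratedTriangulation

section

variable {K M : Type*} [Field K] [LinearOrder K] [IsStrictOrderedRing K] [AddCommGroup M]
  [Module K M] {n : ℕ}

local notation "Λ" => ExteriorAlgebra K M

theorem vecMul_reverseSign_apply_two (R : Set (Finset (Fin n))) (t : Finset (Fin n))
    (v : Fin 3 → Λ) : (v ᵥ* (reverseSign R t : SuperMatrix K M)) 2 = v 2 := by
  unfold reverseSign
  split_ifs <;> simp [matRho, Matrix.vecMul, dotProduct, Fin.sum_univ_three]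

theorem reverseSign_mul_row {R : Set (Finset (Fin n))} {t : Finset (Fin n)} {e : ℕ}
    (h : (t ∈ R ∧ e = 1) ∨ (t ∉ R ∧ e = 0)) (X : SuperMatrix K M) :
    (reverseSign R t * X : SuperMatrix K M) 0 = (-1 : Λ) ^ e • X 0 ∧
      (reverseSign R t * X : SuperMatrix K M) 1 = (-1 : Λ) ^ e • X 1 := by
  unfold reverseSign
  rcases h with ⟨h, rfl⟩ | ⟨h, rfl⟩ <;> simp only [h, if_true, if_false] <;>
    constructor <;> ext b <;> simp [matRho, Matrix.mul_apply, Fin.sum_univ_three]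

theorem IsOSp.eq_vecMul_superAdj {H : SuperMatrix K M} (hH : IsOSp H) {u v : Fin 3 → Λ}
    (h : u = v ᵥ* H) : v = u ᵥ* superAdj H := by
  rw [h, Matrix.vecMul_vecMul, hH.mul_adj, Matrix.vecMul_one]

/-- An orthosymplectic matrix is determined by four of its entries in odd position, and by its first
two rows. -/
theorem IsOSp.eq_of_rows {H : SuperMatrix K M} (hH : IsOSp H) {ea eb : ℕ}
    {lx ly u₁ u₂ v₁ v₂ α β γ δ : Λ} (hx : IsPosEven lx) (hy : IsPosEven ly)
    (h0 : H 0 = ![-(u₁ * Ring.inverse lx), (-1) ^ ea * u₂, γ])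
    (h1 : ((-1) ^ (eb + 1) * ly) • H 1 = ![-(v₁ * Ring.inverse lx), (-1) ^ ea * v₂, δ])
    (hα : α = lx * H 2 0) (hβ : β = (-1) ^ (ea + 1) * H 2 1) :
    H = !![-(u₁ * Ring.inverse lx), (-1) ^ ea * u₂, γ;
        (-1) ^ eb * (v₁ * Ring.inverse lx * Ring.inverse ly),
          (-1) ^ (ea + eb + 1) * (v₂ * Ring.inverse ly), (-1) ^ (eb + 1) * (Ring.inverse ly * δ);
        Ring.inverse lx * α, (-1) ^ (ea + 1) * β,
          1 + (-1) ^ (ea + 1) * (Ring.inverse lx * α * β)] ∧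
      1 + (-1) ^ (ea + 1) * (Ring.inverse lx * α * β)
        = 1 + (-1) ^ (eb + 1) * (Ring.inverse ly * γ * δ) := by
  have cy : ∀ z, z * Ring.inverse ly = Ring.inverse ly * z :=
    fun z => (hy.ringInverse.1.commute z).eq.symm
  have ix : ∀ z, Ring.inverse lx * (lx * z) = z := fun z => by
    rw [← mul_assoc, Ring.inverse_mul_cancel _ hx.isUnit, one_mul]
  have iy : ∀ z, Ring.inverse ly * (ly * z) = z := fun z => by
    rw [← mul_assoc, Ring.inverse_mul_cancel _ hy.isUnit, one_mul]
  have r : ∀ j, H 1 j = (-1) ^ (eb + 1) * (Ring.inverse ly *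
      (![-(v₁ * Ring.inverse lx), (-1) ^ ea * v₂, δ] : Fin 3 → Λ) j) := by
    intro j
    rw [← h1]
    simp only [Pi.smul_apply, smul_eq_mul]
    rcases neg_one_pow_eq_or Λ (eb + 1) with e | e <;> simp [e, iy]
  have h10 := r 0
  have h11 := r 1
  have h12 := r 2
  have e20 : Ring.inverse lx * α = H 2 0 := by rw [hα, ix]
  have e21 : (-1) ^ (ea + 1) * β = H 2 1 := by
    rw [hβ]
    rcases neg_one_pow_eq_or Λ (ea + 1) with e | e <;> simp [e]
  have e22 : (-1) ^ (ea + 1) * (Ring.inverse lx * α * β) = H 2 0 * H 2 1 := by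
    rw [e20, ← e21]
    rcases neg_one_pow_eq_or Λ (ea + 1) with e | e <;> simp [e]
  have e22' : (-1) ^ (eb + 1) * (Ring.inverse ly * γ * δ) = H 0 2 * H 1 2 := by
    rw [h12, h0, ← cy γ]
    rcases neg_one_pow_eq_or Λ (eb + 1) with e | e <;> simp [e, mul_assoc]
  obtain ⟨d1, d2⟩ := hH.apply_two_two
  rw [e22, e22', e20, e21, ← d1, ← d2]
  refine ⟨?_, rfl⟩
  ext i j
  fin_cases i <;> fin_cases j
  · exact congrFun h0 0
  · exact congrFun h0 1
  · exact congrFun h0 2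
  · change H 1 0 = (-1) ^ eb * (v₁ * Ring.inverse lx * Ring.inverse ly)
    rw [h10, cy]
    rcases neg_one_pow_eq_or Λ eb with e | e <;> simp [e, pow_succ]
  · change H 1 1 = (-1) ^ (ea + eb + 1) * (v₂ * Ring.inverse ly)
    rw [h11, cy]
    rcases neg_one_pow_eq_or Λ eb with e | e <;>
      rcases neg_one_pow_eq_or Λ ea with e' | e' <;> simp [e, e', pow_succ, pow_add]
  · exact h12
  · rfl
  · rfl
  · rfl

end

namespace DecoratedTriangulation

variable {K M : Type*} [Field K] [LinearOrder K] [IsStrictOrderedRing K] [AddCommGroup M]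
  [Module K M] {n N : ℕ} {c : ℕ → Fin n} {pos : Fin n → ℕ}

variable {S : DecoratedTriangulation K M n} {G : Fin n → Fin n → Fin n → SuperMatrix K M}
  {L : List (Sym2 (Fin n))} {ℓ : Fin n → Fin n → ExteriorAlgebra K M} {p q : Fin n}

/-- The orientation of a turn, as the membership of its fan segment in `ccwSegments`. -/
theorem mem_ccwSegments_or (hc : IsFanCenters c N) (hL : IsLayout c N pos) {i : ℕ} (hi : i + 1 ≤ N)
    {t : Finset (Fin n)} (h : t ∈ fanSegment c (i + 1)) :
    (t ∈ ccwSegments c N ∧ orientationType (c i) (c (i + 1)) (c (i + 2)) = 1) ∨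
      (t ∉ ccwSegments c N ∧ orientationType (c i) (c (i + 1)) (c (i + 2)) = 0) := by
  rw [hL.mem_ccwSegments hi h]
  rcases hc.turn (i + 1) (by omega) hi with h | h
  · exact Or.inl ⟨h, orientationType_eq_one h⟩
  · exact Or.inr ⟨sbtw_asymm h, orientationType_eq_zero h.cyclic_right⟩

theorem mem_fanSegment_of_isNext (hL : IsLayout c N pos) {i : ℕ} (hi : i + 1 ≤ N) {x z : Fin n}
    (hx : x = c i ∨ x = c (i + 2)) (hb : IsNext (c (i + 1)) x ∨ IsNext x (c (i + 1)))
    (h : {c (i + 1), x, z} ∈ genericTriangulation c N) :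
    {c (i + 1), x, z} ∈ fanSegment c (i + 1) := by
  obtain ⟨u, hu⟩ := hL.exists_mem_fanSegment hi (v := x) (by
    simp only [Wbtw]; rcases hx with rfl | rfl <;> omega)
  rwa [hL.isNonCrossing.eq_of_isNext hb h (IsLayout.mem_genericTriangulation.2 ⟨i, hi, hu⟩)]

/-- The value of the normalized section of a triangulation with the default orientation at the end
of the longest arc. -/
theorem apply_end_eq (hK : ∀ x : K, 0 < x → IsSquare x) (hc : IsFanCenters c N)
    (hG : S.IsDeveloped G) (hT : S.tri = genericTriangulation c N)
    (hnd : L.Nodup) (hmem : ∀ e, e ∈ L ↔ e ∈ innerDiagonals c N) (hD : IsDefault c N S.orient)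
    (hp : {c 0, c 1, p} ∈ S.tri) (hq : {c (N + 1), c N, q} ∈ S.tri) (h1 : G (c 0) (c 1) p = 1)
    (hℓ₀ : ∀ x, ℓ x x = 0) (hℓe : ∀ x y, S.IsEdge x y → ℓ x y = S.lam x y)
    (hℓ : ∀ m, m + 1 ≤ N → ∀ x y z, ({x, y, z} : Finset (Fin n)) = {c 0, c 1, c (m + 2)} →
      ℓ x y = (S.flips (L ++ flipsUpFrom c (m + 1))).lam x y)
    (hℓ' : ∀ m, m + 1 ≤ N → ∀ x y z, ({x, y, z} : Finset (Fin n)) =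
        {revCenters c N 0, revCenters c N 1, revCenters c N (m + 2)} →
      ℓ x y = ((S.reverse (ccwSegments c N)).flips
        (L ++ flipsUpFrom (revCenters c N) (m + 1))).lam x y) :
    let εa := orientationType (c 0) (c 1) (c 2)
    let εb := orientationType (c (N - 1)) (c N) (c (N + 1))
    let D' := S.reverse (ccwSegments c N)
    let γ := (S.flips (L ++ flipsUpFrom c N)).muDown (c (N + 1)) (c 0) (c 1)
    let δ := (S.flips (L ++ flipsUpFrom c (N - 1))).muDown (c N) (c 0) (c 1)
    let α := (D'.flips (L ++ flipsDownFrom c 2 N)).muDown (c 1) (c N) (c (N + 1))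
    let β := (D'.flips (L ++ flipsDownFrom c 1 N)).muDown (c 0) (c N) (c (N + 1))
    let x := Ring.inverse (ℓ (c 0) (c 1))
    let y := Ring.inverse (ℓ (c N) (c (N + 1)))
    G (c (N + 1)) (c N) q =
      !![-(ℓ (c 1) (c (N + 1)) * x), (-1) ^ εa * ℓ (c 0) (c (N + 1)), γ;
         (-1) ^ εb * (ℓ (c 1) (c N) * x * y),
           (-1) ^ (εa + εb + 1) * (ℓ (c 0) (c N) * y), (-1) ^ (εb + 1) * (y * δ);
         x * α, (-1) ^ (εa + 1) * β, 1 + (-1) ^ (εa + 1) * (x * α * β)] ∧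
      1 + (-1) ^ (εa + 1) * (x * α * β) = 1 + (-1) ^ (εb + 1) * (y * γ * δ) := by
  intro εa εb D' γ δ α β x y
  obtain ⟨pos, hL⟩ := hc.exists_layout
  obtain ⟨pos', hL'⟩ := hc.rev.exists_layout
  have hN := hc.one_le
  have r1 : revCenters c N (N + 1) = c 0 := by simp [revCenters]
  have r2 : revCenters c N N = c 1 := by simp [revCenters]
  have hOSp : IsOSp (G (c (N + 1)) (c N) q) := hG.osp _ _ _ hq
  have hp' : {c 1, c 0, p} ∈ S.tri := by rwa [Finset.insert_comm]
  have hq' : {c N, c (N + 1), q} ∈ S.tri := by rwa [Finset.insert_comm]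
  have lN : ℓ (c N) (c (N + 1)) = S.lam (c (N + 1)) (c N) := by
    rw [hℓe _ _ (isEdge_of_mem hG.nc hq'), lam_comm]
  have l0 : ℓ (c 0) (c 1) = S.lam (c 0) (c 1) := hℓe _ _ (isEdge_of_mem hG.nc hp)
  have nb : ∀ {i j}, i < j → j ≤ N + 1 → c i ≠ c j := fun hi hj => hL.center_ne_of_lt hi hj
  -- the orientations of the first and the last turn
  have ha : ({c 0, c 1, p} ∈ ccwSegments c N ∧ εa = 1) ∨
      ({c 0, c 1, p} ∉ ccwSegments c N ∧ εa = 0) := by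
    rw [Finset.insert_comm]
    exact mem_ccwSegments_or hc hL (i := 0) hN
      (mem_fanSegment_of_isNext hL hN (Or.inl rfl) hc.first_side.symm (hT ▸ hp'))
  have hb : orientationType (c (N + 1)) (c N) (c (N - 1)) = 1 ∧ εb = 0 ∨
      orientationType (c (N + 1)) (c N) (c (N - 1)) = 0 ∧ εb = 1 := by
    rcases hc.turn N hN le_rfl with h | h
    · exact Or.inr ⟨orientationType_eq_zero h.cyclic_right, orientationType_eq_one h⟩
    · exact Or.inl ⟨orientationType_eq_one h, orientationType_eq_zero h.cyclic_right⟩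
  -- Read from its other end, a turn has the opposite orientation.
  have hb' : (-1 : ExteriorAlgebra K M) ^ orientationType (c (N + 1)) (c N) (c (N - 1)) =
      (-1) ^ (εb + 1) := by
    rcases hb with ⟨e, e'⟩ | ⟨e, e'⟩ <;> simp [e, e']
  -- the first two rows
  have h0 := row_last_center hK hc hL hG hT hnd hmem hD hp hq hℓ
  have h2 := row_penultimate_center hK hc hL hG hT hnd hmem hD hp hq hℓ₀ hℓ
  rw [h1, Matrix.vecMul_one] at h0 h2
  rw [hG.row_zero_reverse hq hc.last_side.symm (nb (i := N - 1) (by omega) le_rfl).symm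
    (nb (i := N - 1) (by omega) (by omega)).symm, hb', ← lN] at h2
  -- the reversed sequence of fan centers
  have hsub : ccwSegments c N ⊆ S.tri := by rw [hT]; exact ccwSegments_subset
  have hG' := hG.reverse hsub
  have hT' : D'.tri = genericTriangulation (revCenters c N) N := by
    rw [genericTriangulation_rev]; exact hT
  have hmem' : ∀ e, e ∈ L ↔ e ∈ innerDiagonals (revCenters c N) N := by
    rw [innerDiagonals_rev]; exact hmem
  have hD' := isDefault_reverse_ccwSegments hc hL hG.nc hT hD
  -- With the centers reversed, the first and last side and their apexes exchange roles: the rows at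
  -- the start are expressed by the section at the end.
  have k0 := row_last_center (p := q) (q := p) hK hc.rev hL' hG' hT' hnd hmem' hD' hq
    (by rw [r1, r2]; exact hp) hℓ'
  have k2 := row_penultimate_center (p := q) (q := p) hK hc.rev hL' hG' hT' hnd hmem' hD' hq
    (by rw [r1, r2]; exact hp) hℓ₀ hℓ'
  rw [r1, r2, (reverseSign_mul_row ha _).1, h1] at k0
  have hp₂ : {c 0, c 1, p} ∈ D'.tri := hp
  have k1 := hG'.row_zero_reverse hp₂ hc.first_side (nb (j := 2) (by omega) (by omega))
    (nb (j := 2) (by omega) (by omega))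
  rw [r1, r2, k1, (reverseSign_mul_row ha _).2, h1] at k2
  rw [← Matrix.vecMul_vecMul] at k0 k2
  -- Solving for the coefficients brings in the inverse matrix, whose last column contains the
  -- entries `2 1` and `2 0` up to sign. The sign matrix at the end does not affect the last
  -- coordinate.
  have f0 := congrFun (hOSp.eq_vecMul_superAdj k0) 2
  have f2 := congrFun (hOSp.eq_vecMul_superAdj k2) 2
  rw [vecMul_reverseSign_apply_two] at f0 f2
  have sgn : ∀ (e : ℕ) (z : ExteriorAlgebra K M), (-1) ^ e * -z = (-1) ^ (e + 1) * z := by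
    intro e z; rw [pow_succ, mul_neg_one, neg_mul, mul_neg]
  have hβ : β = (-1) ^ (εa + 1) * G (c (N + 1)) (c N) q 2 1 := by
    have e : β = (D'.flips (L ++ flipsUpFrom (revCenters c N) N)).muDown (c 0) (c (N + 1))
        (c N) := by
      obtain ⟨m, rfl⟩ : ∃ m, N = m + 1 := ⟨N - 1, by omega⟩
      obtain ⟨-, G'', g1, -, g3, -⟩ :=
        exists_flips_triangle hK hL' hc.rev.first_side hG' hT' hnd hmem' (le_refl (m + 1))
      rw [show m + 2 = m + 1 + 1 from rfl, r1, insert_rotate] at g3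
      change (D'.flips (L ++ flipsDownFrom c 1 (m + 1))).muDown _ _ _ = _
      rw [flipsDownFrom_eq le_rfl (by omega)]
      exact g1.dec.muDown_comm (by rw [insert_swap]; exact g3) (nb (by omega) (by omega))
        (nb (by omega) le_rfl)
    rw [e, ← sgn]
    refine f0.trans ?_
    simp [superAdj, Matrix.vecMul, dotProduct, Fin.sum_univ_three]
  have hα : α = ℓ (c 0) (c 1) * G (c (N + 1)) (c N) q 2 0 := by
    have e : α = (D'.flips (L ++ flipsUpFrom (revCenters c N) (N - 1))).muDown (c 1) (c (N + 1))
        (c N) := by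
      obtain rfl | ⟨m, rfl⟩ : N = 1 ∨ ∃ m, N = m + 2 :=
        (Nat.eq_or_lt_of_le hN).imp Eq.symm fun h => ⟨N - 2, by omega⟩
      -- For `N = 1` two indices coincide and both sides are zero by convention.
      · simp [α, muDown]
      · obtain ⟨-, G'', g1, -, g3, -⟩ :=
          exists_flips_triangle hK hL' hc.rev.first_side hG' hT' hnd hmem' (m := m) (by omega)
        rw [r2, insert_rotate] at g3
        change (D'.flips (L ++ flipsDownFrom c 2 (m + 2))).muDown _ _ _ = _
        rw [flipsDownFrom_eq (by omega) (by omega)]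
        exact g1.dec.muDown_comm (by rw [insert_swap]; exact g3) (nb (by omega) (by omega))
          (nb (by omega) le_rfl)
    rw [e, l0]
    refine f2.trans ?_
    have hlam : (S.reverse (ccwSegments c N)).lam (c 0) (c 1) = S.lam (c 0) (c 1) := rfl
    have hε : orientationType (c 0) (c 1) (c 2) = εa := rfl
    rw [hlam, hε]
    rcases ha with ⟨-, h⟩ | ⟨-, h⟩ <;>
      simp [superAdj, Matrix.vecMul, dotProduct, Fin.sum_univ_three, h]
  exact hOSp.eq_of_rows (l0 ▸ hG.lam_pos hp) (lN ▸ hG.lam_pos hq) h0 h2 hα hβ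

/-- Flatness is a left condition, so right multiplication by a constant matrix adjusts the value at
the starting point. -/
theorem exists_normalized_section (hc : IsFanCenters c N) (hS : S.IsDecorated)
    (hT : S.tri = genericTriangulation c N) (hp : {c 0, c 1, p} ∈ S.tri) {g : SuperMatrix K M}
    (hg : IsOSp g) : ∃ G, S.IsDeveloped G ∧ G (c 0) (c 1) p = g ∧
      ∃ V : Fin n → Fin 3 → ExteriorAlgebra K M, IsRowSystem S.tri G V := by
  obtain ⟨pos, hL⟩ := hc.exists_layout
  have nc : IsNonCrossing S.tri := hT ▸ hL.isNonCrossing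
  have hA := hL.isAssembled hc.first_side (hT ▸ hp)
  rw [← hT] at hA
  obtain ⟨G, h1, h2, V, hV⟩ := hA.exists_section hS nc hp subset_rfl
  have ho := h2 _ _ _ hp
  have hG : S.IsDeveloped G := ⟨hS, nc, h1, h2⟩
  refine ⟨_, hG.mul_right (ho.adj.mul hg), ?_, _, hV.mul_right _⟩
  rw [← mul_assoc, ho.mul_adj, one_mul]

end DecoratedTriangulation

end SuperTeich

end

-- The equivalence for `H` contains both path independence and the existence of a path. The list `L`
-- is any order of the inner diagonals, and `p`, `q` are the apexes over the first and last side.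
open SuperTeich in
theorem theorem4p2 {K M : Type*} [Field K] [LinearOrder K] [IsStrictOrderedRing K]
    (hK : ∀ x : K, 0 < x → IsSquare x) [AddCommGroup M] [Module K M]
    {n N : ℕ} (c : ℕ → Fin n) (hc : IsFanCenters c N)
    (S : DecoratedTriangulation K M n) (hS : S.IsDecorated)
    (hT : S.tri = genericTriangulation c N)
    (p q : Fin n) (hp : {c 0, c 1, p} ∈ S.tri) (hq : {c (N + 1), c N, q} ∈ S.tri)
    (L : List (Sym2 (Fin n))) (hL : L.Nodup) (hLmem : ∀ e, e ∈ L ↔ e ∈ innerDiagonals c N) :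
    (∃ R ⊆ S.tri, IsDefault c N (S.reverse R).orient) ∧
    ∀ R ⊆ S.tri, IsDefault c N (S.reverse R).orient →
      let εa := orientationType (c 0) (c 1) (c 2)
      let εb := orientationType (c (N - 1)) (c N) (c (N + 1))
      let lam := S.superLambda
      let D := S.reverse R
      let D' := D.reverse (ccwSegments c N)
      let γ := (D.flips (L ++ flipsUpFrom c N)).muDown (c (N + 1)) (c 0) (c 1)
      let δ := (D.flips (L ++ flipsUpFrom c (N - 1))).muDown (c N) (c 0) (c 1)
      let α := (D'.flips (L ++ flipsDownFrom c 2 N)).muDown (c 1) (c N) (c (N + 1))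
      let β := (D'.flips (L ++ flipsDownFrom c 1 N)).muDown (c 0) (c N) (c (N + 1))
      let x := Ring.inverse (lam (c 0) (c 1))
      let y := Ring.inverse (lam (c N) (c (N + 1)))
      let ga : Matrix (Fin 3) (Fin 3) (ExteriorAlgebra K M) :=
        open Classical in if {c 0, c 1, p} ∈ R then matRho else 1
      let gb : Matrix (Fin 3) (Fin 3) (ExteriorAlgebra K M) :=
        open Classical in if {c (N + 1), c N, q} ∈ R then matRho else 1
      (∀ H, S.Holonomy (c 0, c 1, p) (c (N + 1), c N, q) H ↔
        H = gb *
          !![-(lam (c 1) (c (N + 1)) * x), (-1) ^ εa * lam (c 0) (c (N + 1)), γ;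
             (-1) ^ εb * (lam (c 1) (c N) * x * y),
               (-1) ^ (εa + εb + 1) * (lam (c 0) (c N) * y), (-1) ^ (εb + 1) * (y * δ);
             x * α, (-1) ^ (εa + 1) * β, 1 + (-1) ^ (εa + 1) * (x * α * β)] * ga) ∧
      1 + (-1) ^ (εa + 1) * (x * α * β) = 1 + (-1) ^ (εb + 1) * (y * γ * δ) := by
  obtain ⟨pos, hLay⟩ := hc.exists_layout
  obtain ⟨pos', hLay'⟩ := hc.rev.exists_layout
  refine ⟨DecoratedTriangulation.exists_isDefault_reverse hLay hS hT hc.first_side hp,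
    fun R hR hD => ?_⟩
  intro εa εb lam D D' γ δ α β x y ga gb
  -- The value at the start is the sign matrix of the first triangle, so that the section
  -- transported to `D` takes the value `1` there.
  obtain ⟨G, hG, hg, V, hV⟩ := DecoratedTriangulation.exists_normalized_section hc hS hT hp
    (DecoratedTriangulation.isOSp_reverseSign (K := K) (M := M) R {c 0, c 1, p})
  have hGD := hG.reverse hR
  have hTD : D.tri = genericTriangulation c N := hT
  have hsub : ccwSegments c N ⊆ D.tri := by rw [hTD]; exact ccwSegments_subset
  have hGD' := hGD.reverse hsub
  have hVD := hV.reverse R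
  have hVD' := DecoratedTriangulation.IsRowSystem.reverse (S := D) hVD (ccwSegments c N)
  have hrev := genericTriangulation_rev (c := c) (N := N)
  have hSr : S.IsRealized V := ⟨G, hG, hV⟩
  have hDr : D.IsRealized V := ⟨_, hGD, hVD⟩
  have main := DecoratedTriangulation.apply_end_eq hK hc hGD hTD hL hLmem hD hp hq
    (by rw [hg]; exact DecoratedTriangulation.reverseSign_mul_self _ _)
    (ℓ := S.superLambda) (fun x => DecoratedTriangulation.superLambda_self S x)
    (fun x y h => hSr.superLambda_eq hK Relation.ReflTransGen.refl hDr h h)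
    (DecoratedTriangulation.superLambda_eq_lam_flips hK hLay hc.first_side hG hT hV hGD hTD hVD
      hL hLmem)
    (DecoratedTriangulation.superLambda_eq_lam_flips hK hLay' hc.rev.first_side hG
      (hrev.symm ▸ hT) hV hGD' (hrev.symm ▸ hTD) hVD' hL (by rw [innerDiagonals_rev]; exact hLmem))
  -- Since `ρ² = 1`, the sign matrices that pass between `S` and `D` can be moved to the outside as
  -- `gb` and `ga`.
  have fwd : ∀ H, S.Holonomy (c 0, c 1, p) (c (N + 1), c N, q) H → H = gb *
      (DecoratedTriangulation.reverseSign R {c (N + 1), c N, q} * G (c (N + 1)) (c N) q) * ga := by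
    intro H hH
    have e := hG.holonomy hH
    change H = DecoratedTriangulation.reverseSign R {c (N + 1), c N, q} * _ *
      DecoratedTriangulation.reverseSign R {c 0, c 1, p}
    rw [← mul_assoc, DecoratedTriangulation.reverseSign_mul_self, one_mul, e, hg, mul_assoc,
      DecoratedTriangulation.reverseSign_mul_self, mul_one]
  rw [main.1] at fwd
  refine ⟨fun H => ⟨fwd H, ?_⟩, main.2⟩
  rintro rfl
  -- Some path exists because the triangulation is assembled from its first triangle; its holonomy
  -- must be the given matrix by the direction already proved.
  obtain ⟨H, hH⟩ := DecoratedTriangulation.IsAssembled.exists_holonomy hS hG.nc hp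
    (hLay.isAssembled hc.first_side (hT ▸ hp)) hT.ge _ _ _ (hT ▸ hq)
  rw [← fwd H hH]
  exact hH
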